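/- Setting. Let $d,K\ge 1$ be integers and let $\vec S_0,\vec S_1,\dots,\vec S_K$ be a Markov process on a filtered probability space $(\Omega,\mathcal F,(\mathcal F_k)_{k},\mathbb P)$ with values in $\mathcal S\subseteq\mathbb R^d$ and deterministic $\vec S_0$; conditional expectations given $\vec S_k=\vec s$ are taken for every $\vec s\in\mathcal S$ with respect to the transition laws of the process. Let $f_k^{\rm pay}\in L^2(\mathcal S,\mathrm{Law}(\vec S_k))$ be the payoff of a Bermudan option at exercise date $k\in\{1,\dots,K\}$. Put $V_k(\vec s)=\sup_\tau\mathbb E[f^{\rm pay}_\tau(\vec S_\tau)\mid\vec S_k=\vec s]$ for $1\le k\le K$, the supremum being over all $\{k,\dots,K\}$-valued stopping times, $V_0=\sup_\tau\mathbb E[f^{\rm pay}_\tau(\vec S_\tau)]$ over all $\{1,\dots,K\}$-valued stopping times, and $Q_k(\vec s)=\mathbb E[V_{k+1}(\vec S_{k+1})\mid \vec S_k=\vec s]$. Assumptions. 1. For every $0\le k\le K-1$ and $\vec s\in\mathcal S$, the law of $\vec S_{k+1}$ given $\vec S_k=\vec s$ has finite support (so that it can be prepared as a finite superposition by a quantum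 oracle). 2. For every $1\le k\le K-1$ there are given a hyper-rectangle $\mathcal D_k=\prod_{i=1}^d[L_{i,k},U_{i,k}]\subseteq\mathcal S$ with $L_{i,k}<U_{i,k}$, a function $V_k^{\rm OB}$ on $\mathcal S\setminus\mathcal D_k$, a set $\mathcal A_k\subseteq\mathcal S\setminus\mathcal D_k$ and a number $\epsilon_k^{\rm OB}>0$ such that $|V^{\rm OB}_k-V_k|<\epsilon^{\rm OB}_k$ on $\mathcal A_k$ and $|V_k\circ b_k-V_k|<\epsilon^{\rm OB}_k$ on $(\mathcal S\setminus\mathcal D_k)\setminus\mathcal A_k$, where $b_k(\vec s)_i=\min\{U_{i,k},\max\{L_{i,k},s_i\}\}$. For a function $H$ on $\mathcal D_k$, let $\mathbf G_k[H]=V_k^{\rm OB}$ on $\mathcal A_k$ and $\mathbf G_k[H]=H\circ b_k$ on $\mathcal S\setminus\mathcal A_k$; let $\mathbf G_K$ be the identity. 3. For every $1\le k\le K-1$ there are $\rho_k>1$ and $B_k>0$ such that the restriction of $Q_k$ to $\mathcal D_k$ has an analytic extension, bounded in modulus by $B_k$, to the generalized Bernstein ellipse of $\mathcal D_k$, i.e.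 to the product over $i$ of the images of the open region bounded by the ellipse $\{\frac12(u+u^{-1}):u\in\mathbb C,\ |u|=\rho_k\}$ under $z\mapsto\frac{U_{i,k}-L_{i,k}}2z+\frac{U_{i,k}+L_{i,k}}2$. Algorithm. Let $m_k\ge1$ $(1\le k\le K-1)$ be integers. Put $\widetilde V_K=f^{\rm pay}_K$. For $k=K-1,\dots,1$, let $\vec S_{k,\vec j}$, $\vec j\in\{0,\dots,m_k\}^d$, be the tensor grid in $\mathcal D_k$ of the Chebyshev nodes $\cos\big(\frac{j+1/2}{m_k+1}\pi\big)$; estimate the values at the nodes of $\widehat Q_k(\vec s)=\mathbb E[\mathbf G_{k+1}[\widetilde V_{k+1}](\vec S_{k+1})\mid\vec S_k=\vec s]$ by quantum amplitude estimation (QAE), with outcomes $\widehat Q^{\rm QAE}_{k,\vec j}\in\mathbb R$; let $\widetilde Q_k$ be the tensor Chebyshev interpolant on $\mathcal D_k$, of degree $m_k$ in each variable, of the data $\widehat Q^{\rm QAE}_{k,\vec j}$; and put $\widetilde V_k=\max\{f_k^{\rm pay},\widetilde Q_k\}$ on $\mathcal D_k$. Finally, estimate $\widehat V_0=\mathbb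 E[\mathbf G_1[\widetilde V_1](\vec S_1)]$ by QAE and call the outcome $\widetilde V_0$. Theorem. Suppose that there are positive numbers $\epsilon^{\rm QAE}_0,\dots,\epsilon^{\rm QAE}_{K-1}$ with $$\big|\widehat Q_k(\vec S_{k,\vec j})-\widehat Q^{\rm QAE}_{k,\vec j}\big|\le\epsilon^{\rm QAE}_k\quad\text{for all }1\le k\le K-1\text{ and all }\vec j,\qquad \big|\widehat V_0-\widetilde V_0\big|\le\epsilon^{\rm QAE}_0 .$$ Then $$|V_0-\widetilde V_0|\le\sum_{k=1}^{K-1}\widetilde\Lambda_{1,k-1}\,\epsilon^{\rm int}_k+\sum_{k=1}^{K-1}\widetilde\Lambda_{1,k-1}\,\epsilon^{\rm OB}_k+\sum_{k=0}^{K-1}\widetilde\Lambda_{1,k}\,\epsilon^{\rm QAE}_k,$$ where $$\epsilon^{\rm int}_k=2^{\frac d2+1}\sqrt d\,B_k\,\rho_k^{-m_k}\big(1-\rho_k^{-2}\big)^{-\frac d2},\qquad \widetilde\Lambda_{1,k}=\prod_{i=1}^{k}\Lambda_i\ \ (\widetilde\Lambda_{1,0}=1),\qquad \Lambda_i=\Big(\frac2\pi\log(m_i+1)+1\Big)^d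 .$$ -/

import Mathlib

open MeasureTheory ProbabilityTheory

noncomputable section

namespace Bermudan

/-! ### Chebyshev interpolation on hyper-rectangles -/

/-- A non-degenerate hyper-rectangle `[L₁, U₁] × ⋯ × [L_d, U_d]`. -/
structure Rect (d : ℕ) where
  lower : Fin d → ℝ
  upper : Fin d → ℝ
  lower_lt_upper : ∀ i, lower i < upper i

namespace Rect

variable {d : ℕ}

/-- The set of points of the hyper-rectangle (the order on `Fin d → ℝ` is coordinatewise). -/
def toSet (D : Rect d) : Set (Fin d → ℝ) := Set.Icc D.lower D.upper

/-- The affine map `η_i` from `[-1, 1]` to the `i`-th side (over `ℝ`). -/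
def fromUnit (D : Rect d) (i : Fin d) (x : ℝ) : ℝ :=
  (D.upper i - D.lower i) / 2 * x + (D.upper i + D.lower i) / 2

/-- The affine map `θ_i` from the `i`-th side to `[-1, 1]`. -/
def toUnit (D : Rect d) (i : Fin d) (s : ℝ) : ℝ :=
  (2 * s - D.upper i - D.lower i) / (D.upper i - D.lower i)

/-- The coordinatewise clamping map onto the hyper-rectangle. -/
def clamp (D : Rect d) (s : Fin d → ℝ) : Fin d → ℝ :=
  fun i => min (D.upper i) (max (D.lower i) (s i))

theorem clamp_mem (D : Rect d) (s : Fin d → ℝ) : D.clamp s ∈ D.toSet :=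
  ⟨fun i => le_min (D.lower_lt_upper i).le (le_max_left _ _), fun _ => min_le_left _ _⟩

/-- Flat extrapolation of a function on the hyper-rectangle. -/
def flat (D : Rect d) (H : D.toSet → ℝ) (s : Fin d → ℝ) : ℝ := H ⟨D.clamp s, D.clamp_mem s⟩

end Rect

/-- The Chebyshev node `x_{m,j} = cos ((j + 1/2) π / (m + 1))`. -/
def chebNode (m : ℕ) (j : Fin (m + 1)) : ℝ :=
  Real.cos (((j : ℕ) + 1 / 2 : ℝ) / ((m : ℝ) + 1) * Real.pi)

variable {d : ℕ}

/-- The tensor Chebyshev node with multi-index `j` in the hyper-rectangle `D`. -/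
def gridNode (D : Rect d) (m : ℕ) (j : Fin d → Fin (m + 1)) : Fin d → ℝ :=
  fun i => D.fromUnit i (chebNode m (j i))

/-- The tensorized Chebyshev polynomial on `D` with multi-index `l`. -/
def tensorCheb (D : Rect d) {m : ℕ} (l : Fin d → Fin (m + 1)) (s : Fin d → ℝ) : ℝ :=
  ∏ i, (Polynomial.Chebyshev.T ℝ ((l i : ℕ) : ℤ)).eval (D.toUnit i (s i))

/-- The coefficient `a_l = 2^{#{i | l_i > 0}} / (m + 1)^d * ∑_j q_j T_l (S_j)` computed from nodal
data `q`. -/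
def chebCoeff (D : Rect d) (m : ℕ) (q : (Fin d → Fin (m + 1)) → ℝ) (l : Fin d → Fin (m + 1)) : ℝ :=
  2 ^ (Finset.univ.filter fun i => 0 < (l i : ℕ)).card / ((m : ℝ) + 1) ^ d *
    ∑ j, q j * tensorCheb D l (gridNode D m j)

/-- The Chebyshev interpolant of degree `m` in every variable with nodal data `q`. -/
def chebInterp (D : Rect d) (m : ℕ) (q : (Fin d → Fin (m + 1)) → ℝ) (s : Fin d → ℝ) : ℝ :=
  ∑ l, chebCoeff D m q l * tensorCheb D l s

/-- The open Bernstein ellipse: the open region bounded by `{(u + u⁻¹) / 2 | ‖u‖ = ρ}`, written as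
the image of the open annulus `ρ⁻¹ < ‖u‖ < ρ` under the Joukowski map. -/
def bernsteinEllipse (ρ : ℝ) : Set ℂ :=
  {z | ∃ u : ℂ, ρ⁻¹ < ‖u‖ ∧ ‖u‖ < ρ ∧ z = (u + u⁻¹) / 2}

/-- The generalized Bernstein ellipse of a hyper-rectangle: the product of the images of the
Bernstein ellipse under the complexified affine maps `η_i`. -/
def genBernsteinEllipse (D : Rect d) (ρ : ℝ) : Set (Fin d → ℂ) :=
  {z | ∀ i, ∃ w ∈ bernsteinEllipse ρ, z i =
    (((D.upper i - D.lower i) / 2 : ℝ) : ℂ) * w + (((D.upper i + D.lower i) / 2 : ℝ) : ℂ)}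

/-- The function `f` on `D` has an analytic extension to the generalized Bernstein ellipse of
parameter `ρ` which is bounded there by `B`. -/
def HasBoundedAnalyticExtension (D : Rect d) (ρ B : ℝ) (f : D.toSet → ℝ) : Prop :=
  ∃ F : (Fin d → ℂ) → ℂ, AnalyticOnNhd ℂ F (genBernsteinEllipse D ρ) ∧
    (∀ x : D.toSet, F (fun i => ((x : Fin d → ℝ) i : ℂ)) = (f x : ℂ)) ∧
    ∀ z ∈ genBernsteinEllipse D ρ, ‖F z‖ ≤ B

/-- `ε_int(ρ, d, m, B) = 2^{d/2+1} √d B ρ^{-m} (1 - ρ^{-2})^{-d/2}`. -/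
def epsInt (ρ : ℝ) (d m : ℕ) (B : ℝ) : ℝ :=
  (2 : ℝ) ^ ((d : ℝ) / 2 + 1) * Real.sqrt d * B * (ρ ^ m)⁻¹ *
    (1 - (ρ ^ 2)⁻¹) ^ (-((d : ℝ) / 2))

/-- The bound `((2/π) log (m + 1) + 1)^d` on the Lebesgue constant of the Chebyshev nodes. -/
def lebesgueBound (d m : ℕ) : ℝ := (2 / Real.pi * Real.log ((m : ℝ) + 1) + 1) ^ d

/-- `∏_{i = k}^{k'} Λ_i` with `Λ_i` the Lebesgue bound for the degree `m i`; the product is `1`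
if `k' < k`. -/
def lebesgueProd (d : ℕ) (m : ℕ → ℕ) (k k' : ℕ) : ℝ :=
  ∏ i ∈ Finset.Icc k k', lebesgueBound d (m i)

/-! ### Bermudan options -/

/-- The value at date `k` of the right to receive `f n (X n)` on exercise at one of the dates
`n = k, …, K`: the supremum of the expected payoff over all `{k, …, K}`-valued stopping times. -/
def optimalStoppingValue {Ω E : Type*} {mΩ : MeasurableSpace Ω} (P : Measure Ω)
    (ℱ : Filtration ℕ mΩ) (X : ℕ → Ω → E) (f : ℕ → E → ℝ) (k K : ℕ) : ℝ :=
  sSup {v : ℝ | ∃ τ : Ω → ℕ, IsStoppingTime ℱ (fun ω => (τ ω : WithTop ℕ)) ∧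
    (∀ ω, k ≤ τ ω ∧ τ ω ≤ K) ∧ v = ∫ ω, f (τ ω) (X (τ ω) ω) ∂P}

/-- The data of a Bermudan option on a Markov process with values in a subset of `ℝ^d`: the state
space, the transition kernels (`trans k x` is the law of the state at date `k + 1` given that the
state at date `k` is `x`) and the payoffs. With `K` exercise dates only the transitions with index
`< K` and the payoffs with index in `1, …, K` play a role. -/
structure Model (d : ℕ) where
  states : Set (Fin d → ℝ)
  trans : ℕ → Kernel states states
  markov : ∀ k, IsMarkovKernel (trans k)
  payoff : ℕ → states → ℝ

namespace Model

variable (M : Model d)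

/-- The transition from date `n` to date `n + 1` as a kernel from the histories up to date `n`; it
depends on the current state only. -/
def historyTrans (n : ℕ) : Kernel (∀ _ : Finset.Iic n, M.states) M.states :=
  (M.trans n).comap (fun h => h ⟨n, Finset.mem_Iic.2 le_rfl⟩) (measurable_pi_apply _)

instance (n : ℕ) : IsMarkovKernel (M.historyTrans n) := by
  have := M.markov n
  unfold historyTrans
  infer_instance

/-- The law of the path of the Markov process given that its state at date `k` is `s`, on the
space of all paths. (The coordinates before date `k` are all set to `s`.) -/
def pathLaw (k : ℕ) (s : M.states) : Measure (ℕ → M.states) :=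
  Kernel.traj (X := fun _ => M.states) M.historyTrans k (fun _ => s)

/-- The option price `V_k` as a function of the state at date `k`: the supremum over the
`{k, …, K}`-valued stopping times of the expected payoff conditional on that state. -/
def price (K k : ℕ) (s : M.states) : ℝ :=
  optimalStoppingValue (M.pathLaw k s) Filtration.piLE (fun n ω => ω n) M.payoff k K

/-- The continuation value `Q_k(s) = E[V_{k+1}(S_{k+1}) | S_k = s]`. -/
def contValue (K k : ℕ) (s : M.states) : ℝ := ∫ x, M.price K (k + 1) x ∂(M.trans k s)

/-- For every date `k < K` and every present state, only finitely many states are possible at the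
next date. -/
def FiniteTransitions (K : ℕ) : Prop :=
  ∀ k < K, ∀ s, ∃ T : Finset M.states, M.trans k s (T : Set M.states)ᶜ = 0

/-- `S` is (up to date `K`) a Markov process on the filtered probability space `(Ω, ℱ, P)` with the
transition kernels of the model and the deterministic initial state `s₀`. -/
structure IsMarkovChain {Ω : Type*} {mΩ : MeasurableSpace Ω} (P : Measure Ω) (ℱ : Filtration ℕ mΩ)
    (K : ℕ) (s₀ : M.states) (S : ℕ → Ω → M.states) : Prop where
  adapted : ∀ k ≤ K, Measurable[ℱ k] (S k)
  init : ∀ᵐ ω ∂P, S 0 ω = s₀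
  transition : ∀ k < K, ∀ A : Set M.states, MeasurableSet A →
    P⟦S (k + 1) ⁻¹' A | ℱ k⟧ =ᵐ[P] fun ω => (M.trans k (S k ω)).real A

end Model

/-! ### The pricing algorithm -/

/-- The inputs of the pricing algorithm, and the outcomes of the amplitude estimations in one run
of it. Only the dates `k = 1, …, K - 1` (`1, …, K` for `vmax`) play a role. -/
structure Run (M : Model d) (K : ℕ) where
  /-- The hyper-rectangles `D_k`. -/
  box : ℕ → Rect d
  box_subset : ∀ k, 1 ≤ k → k < K → (box k).toSet ⊆ M.states
  /-- The degrees `m_k` of the Chebyshev interpolations. -/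
  deg : ℕ → ℕ
  /-- The approximate prices out of the boxes, `V^OB_k` (only its values outside `D_k` matter). -/
  outPrice : ℕ → M.states → ℝ
  /-- The sets `A_k` of the states at which `V^OB_k` is used. -/
  outSet : ℕ → Set M.states
  /-- The normalizations `Ṽ^max_k` used to encode the values in amplitudes. -/
  vmax : ℕ → ℝ
  /-- The estimates of the probabilities `P_{k,j}` returned by quantum amplitude estimation. -/
  nodeProb : (k : ℕ) → (Fin d → Fin (deg k + 1)) → ℝ
  /-- The estimate of the probability `P_0` returned by the last quantum amplitude estimation. -/
  finalProb : ℝ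

namespace Run

variable {M : Model d} {K : ℕ} (R : Run M K)

/-- A point of the box `D_k` as a state. -/
def boxState {k : ℕ} (h1 : 1 ≤ k) (h2 : k < K) (x : (R.box k).toSet) : M.states :=
  ⟨x, R.box_subset k h1 h2 x.2⟩

/-- The estimate of the nodal continuation value, `Q̂^QAE_{k,j} = (2 P̃_{k,j} - 1) Ṽ^max_{k+1}`. -/
def nodeEstimate (k : ℕ) (j : Fin d → Fin (R.deg k + 1)) : ℝ :=
  (2 * R.nodeProb k j - 1) * R.vmax (k + 1)

/-- The interpolant `Q̃_k` of the estimated nodal continuation values. -/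
def approxCont (k : ℕ) (x : Fin d → ℝ) : ℝ :=
  chebInterp (R.box k) (R.deg k) (R.nodeEstimate k) x

/-- The approximate price `Ṽ_k = max {f^pay_k, Q̃_k}` on `D_k`. -/
def approxPrice {k : ℕ} (h1 : 1 ≤ k) (h2 : k < K) (x : (R.box k).toSet) : ℝ :=
  max (M.payoff k (R.boxState h1 h2 x)) (R.approxCont k x)

open Classical in
/-- The extrapolation operator `G_k`: the value `V^OB_k` on `A_k`, flat extrapolation elsewhere. -/
def extrap (k : ℕ) (H : (R.box k).toSet → ℝ) (s : M.states) : ℝ :=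
  if s ∈ R.outSet k then R.outPrice k s else (R.box k).flat H s

/-- `G_k[Ṽ_k]` on the whole state space for the dates `k = 1, …, K`; at the last date `G_K` is the
identity and `Ṽ_K` is the payoff. -/
def extrapPrice (k : ℕ) : M.states → ℝ :=
  if h : 1 ≤ k ∧ k < K then R.extrap k (R.approxPrice h.1 h.2) else M.payoff K

/-- `Q̂_k(s) = E[G_{k+1}[Ṽ_{k+1}](S_{k+1}) | S_k = s]`, the target of the amplitude estimations. -/
def hatCont (k : ℕ) (s : M.states) : ℝ := ∫ x, R.extrapPrice (k + 1) x ∂(M.trans k s)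

/-- The node with multi-index `j` of the grid in `D_k`, as a point of `D_k`. -/
def boxNode (k : ℕ) (j : Fin d → Fin (R.deg k + 1)) : (R.box k).toSet :=
  ⟨gridNode (R.box k) (R.deg k) j, by
    have hc : ∀ i, -1 ≤ chebNode (R.deg k) (j i) ∧ chebNode (R.deg k) (j i) ≤ 1 := fun i =>
      ⟨Real.neg_one_le_cos _, Real.cos_le_one _⟩
    have hl := (R.box k).lower_lt_upper
    constructor <;> intro i <;> simp only [gridNode, Rect.fromUnit] <;>
      nlinarith [hc i, hl i, mul_nonneg (sub_nonneg.2 (hl i).le) (sub_nonneg.2 (hc i).1),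
        mul_nonneg (sub_nonneg.2 (hl i).le) (sub_nonneg.2 (hc i).2)]⟩

/-- The output `Ṽ_0 = (2 P̃_0 - 1) Ṽ^max_1` of the algorithm. -/
def output : ℝ := (2 * R.finalProb - 1) * R.vmax 1

/-- Outside `D_k`, the price is approximated up to `ε_k` by `V^OB_k` on the set `A_k` and by its
own flat extrapolation off `A_k`. -/
def ExtrapolationAccurate (ε : ℕ → ℝ) : Prop :=
  ∀ k, ∀ (h1 : 1 ≤ k) (h2 : k < K), ∀ s : M.states,
    (s ∈ R.outSet k → (s : Fin d → ℝ) ∉ (R.box k).toSet ∧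
      |R.outPrice k s - M.price K k s| < ε k) ∧
    ((s : Fin d → ℝ) ∉ (R.box k).toSet → s ∉ R.outSet k →
      |(R.box k).flat (fun x => M.price K k (R.boxState h1 h2 x)) s - M.price K k s| < ε k)

end Run

end Bermudan

end

/-! The proof is a backward induction on the dates. Let `e_k` be the uniform error of `G_k[Ṽ_k]` as
an approximation of `V_k`. By dynamic programming `V_k = max {f_k, Q_k}`, and the maximum is
1-Lipschitz. Averaging over a transition does not increase a uniform error. Interpolation errs by
`ε_int` on exact data and amplifies errors in the data by at most the Lebesgue constant.
Extrapolation adds at most `ε_OB`. Hence `e_k ≤ ε_int + Λ_k (e_{k+1} + ε_QAE) + ε_OB` with `e_K =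
0`, and this recursion unrolls to the claimed sums (`Run.abs_price_sub_extrapPrice_le_sum`). Three
ingredients have content.

Lebesgue constant (`sum_abs_chebKernel_le`). With `x = cos θ`, the Lagrange basis is a sum of two
shifted kernels `sin (n t) cot (t / 2)`, where `n = m + 1`. The sum of their absolute values is
largest at `θ = 0`, where it is a sum of cotangents; `cot x ≤ 1 / x - x / 3` and a harmonic sum give
`(2/π) log n + 1`. Tensorization raises this to the power `d`.

Interpolation error (`abs_sub_chebInterp_le`). Put `q = ρ⁻²`. In one variable, Cauchy's formula on
the ellipse, pulled back by the Joukowski map to a circle, represents both the interpolant and its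
error. Factoring the kernels and applying Cauchy-Schwarz with explicit mean squares bounds the
interpolant by `μ B`, where `μ² = (1 + q) / (1 - q)`, independently of `m`. The error is at most `2
ρ⁻ᵐ σ B`, where `σ² = 2 / (1 - q) = μ² + 1`; when `q` is so close to `1` that the contour bound is
too weak, the Lebesgue constant is used instead. Replacing one variable at a time gives `2 ρ⁻ᵐ B σ
∑_{i < d} μ ^ i`, which is at most `2 ρ⁻ᵐ B √d σ ^ d = ε_int`.

Dynamic programming (`Model.price_eq_max`, `Model.optimalStoppingValue_one_eq`). Transitions have
finite support, so every function of the state is integrable along the chain and an optimal stopping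
time can be built by backward recursion. -/

noncomputable section

namespace Bermudan

open Polynomial.Chebyshev

/-! ### The Lebesgue constant of the Chebyshev nodes -/

/-- The angle of the `j`-th Chebyshev node of degree `n`. -/
def chebAngle (n j : ℕ) : ℝ := (2 * (j : ℝ) + 1) * Real.pi / (2 * n)

theorem chebNode_eq_cos (m : ℕ) (j : Fin (m + 1)) :
    chebNode m j = Real.cos (chebAngle (m + 1) j) := by
  unfold chebNode chebAngle
  congr 1
  push_cast
  field_simp

/-- The modified Dirichlet kernel `1 + 2 ∑_{0 < l < n} cos (l t) + cos (n t)`. -/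
def modDirichlet (n : ℕ) (t : ℝ) : ℝ :=
  ∑ l ∈ Finset.range n, (Real.cos (l * t) + Real.cos ((l + 1 : ℕ) * t))

theorem modDirichlet_neg (n : ℕ) (t : ℝ) : modDirichlet n (-t) = modDirichlet n t := by
  simp only [modDirichlet, mul_neg, Real.cos_neg]

theorem modDirichlet_sub_comm (n : ℕ) (s t : ℝ) :
    modDirichlet n (s - t) = modDirichlet n (t - s) := by
  rw [← modDirichlet_neg, neg_sub]

theorem modDirichlet_add_two_pi (n : ℕ) (t : ℝ) :
    modDirichlet n (t + 2 * Real.pi) = modDirichlet n t := by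
  unfold modDirichlet
  refine Finset.sum_congr rfl fun l _ => ?_
  rw [mul_add, mul_add, Real.cos_add_nat_mul_two_pi, Real.cos_add_nat_mul_two_pi]

theorem continuous_modDirichlet (n : ℕ) : Continuous (modDirichlet n) := by
  unfold modDirichlet
  fun_prop

/-- This is the closed form `sin (n t) cot (t / 2)`, kept free of division because `sin (t / 2)` may
vanish. -/
theorem modDirichlet_mul_sin (n : ℕ) (t : ℝ) :
    modDirichlet n t * Real.sin (t / 2) = Real.sin (n * t) * Real.cos (t / 2) := by
  induction n with
  | zero => simp [modDirichlet]
  | succ n ih =>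
    have hs : modDirichlet (n + 1) t =
        modDirichlet n t + (Real.cos (n * t) + Real.cos ((n + 1 : ℕ) * t)) := by
      simp [modDirichlet, Finset.sum_range_succ]
    rw [hs, add_mul, ih]
    have h1 : ((n + 1 : ℕ) : ℝ) * t = n * t + 2 * (t / 2) := by push_cast; ring
    rw [h1, Real.cos_add, Real.sin_add, Real.sin_two_mul, Real.cos_two_mul]
    linear_combination (-2 * Real.sin (n * t) * Real.cos (t / 2)) *
      (Real.sin_sq_add_cos_sq (t / 2))

/-- The Lagrange basis polynomials of the Chebyshev nodes, through the Chebyshev expansion. -/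
def chebKernel (m : ℕ) (x : ℝ) (j : Fin (m + 1)) : ℝ :=
  ∑ l : Fin (m + 1), (if 0 < (l : ℕ) then 2 else 1) / ((m : ℝ) + 1) *
    ((T ℝ ((l : ℕ) : ℤ)).eval (chebNode m j) * (T ℝ ((l : ℕ) : ℤ)).eval x)

theorem cos_mul_chebAngle (n j : ℕ) (hn : n ≠ 0) : Real.cos (n * chebAngle n j) = 0 := by
  rw [Real.cos_eq_zero_iff]
  refine ⟨j, ?_⟩
  unfold chebAngle
  have : (n : ℝ) ≠ 0 := by exact_mod_cast hn
  push_cast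
  field_simp

/-- Product-to-sum produces the frequencies `0, …, m`, with half weight at `0`. The frequency `m +
1` of the modified kernel costs nothing, since `cos ((m + 1) φ) = 0` at a node; it is what makes the
closed form a single cotangent. -/
theorem chebKernel_cos (m : ℕ) (θ : ℝ) (j : Fin (m + 1)) :
    2 * ((m : ℝ) + 1) * chebKernel m (Real.cos θ) j =
      modDirichlet (m + 1) (θ - chebAngle (m + 1) j) +
        modDirichlet (m + 1) (θ + chebAngle (m + 1) j) := by
  set φ := chebAngle (m + 1) j with hφ
  have hm : (m : ℝ) + 1 ≠ 0 := by positivity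
  have hL : 2 * ((m : ℝ) + 1) * chebKernel m (Real.cos θ) j =
      ∑ l ∈ Finset.range (m + 1), (if 0 < l then 4 else 2) *
        (Real.cos (l * φ) * Real.cos (l * θ)) := by
    rw [chebKernel, ← Fin.sum_univ_eq_sum_range
      (fun l : ℕ => (if 0 < l then (4 : ℝ) else 2) * (Real.cos (l * φ) * Real.cos (l * θ))),
      Finset.mul_sum]
    refine Finset.sum_congr rfl fun l _ => ?_
    rw [chebNode_eq_cos, T_real_cos, T_real_cos, ← hφ]
    push_cast
    split_ifs <;> field_simp <;> ring
  have hR : ∀ l : ℕ, Real.cos (l * (θ - φ)) + Real.cos (l * (θ + φ)) =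
      2 * (Real.cos (l * φ) * Real.cos (l * θ)) := by
    intro l
    rw [mul_sub, mul_add, Real.cos_sub, Real.cos_add]
    ring
  have h0 : Real.cos ((m + 1 : ℕ) * φ) = 0 := cos_mul_chebAngle (m + 1) j (by simp)
  have hS : modDirichlet (m + 1) (θ - φ) + modDirichlet (m + 1) (θ + φ) =
      ∑ l ∈ Finset.range (m + 1), 2 * (Real.cos (l * φ) * Real.cos (l * θ)) +
      ∑ l ∈ Finset.range (m + 1),
        2 * (Real.cos ((l + 1 : ℕ) * φ) * Real.cos ((l + 1 : ℕ) * θ)) := by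
    unfold modDirichlet
    rw [← Finset.sum_add_distrib, ← Finset.sum_add_distrib]
    refine Finset.sum_congr rfl fun l _ => ?_
    rw [← hR, ← hR]
    ring
  rw [hL, hS, Finset.sum_range_succ', Finset.sum_range_succ', Finset.sum_range_succ, h0]
  simp only [Nat.succ_pos, if_true, lt_irrefl, if_false]
  have : ∀ x : ℝ, (4 : ℝ) * x = 2 * x + 2 * x := fun x => by ring
  simp_rw [this, Finset.sum_add_distrib]
  simp
  ring

/-- In other words, `sin (n x) / sin x` decreases as long as `n x ≤ π / 2`. In the induction the
addition formula leaves `cos x` and `cos (n x)`, which both decrease. -/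
theorem sin_mul_sin_nat_mul_le (n : ℕ) {a b : ℝ} (ha : 0 ≤ a) (hab : a ≤ b)
    (hb : n * b ≤ Real.pi / 2) (hb' : b ≤ Real.pi / 2) :
    Real.sin a * Real.sin (n * b) ≤ Real.sin b * Real.sin (n * a) := by
  induction n with
  | zero => simp
  | succ n ih =>
    have hb0 : 0 ≤ b := ha.trans hab
    have hpi := Real.pi_pos
    push_cast at hb
    have hn : (n : ℝ) * b ≤ Real.pi / 2 := by nlinarith
    have hna : (n : ℝ) * a ≤ n * b := by gcongr
    have hna0 : 0 ≤ (n : ℝ) * a := by positivity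
    have h := ih hn
    have hcos : Real.cos b ≤ Real.cos a := Real.cos_le_cos_of_nonneg_of_le_pi ha (by linarith) hab
    have hcosn : Real.cos (n * b) ≤ Real.cos (n * a) :=
      Real.cos_le_cos_of_nonneg_of_le_pi hna0 (by linarith) hna
    have hsa : 0 ≤ Real.sin a := Real.sin_nonneg_of_nonneg_of_le_pi ha (by linarith)
    have hsb : 0 ≤ Real.sin b := Real.sin_nonneg_of_nonneg_of_le_pi hb0 (by linarith)
    have hsna : 0 ≤ Real.sin (n * a) := Real.sin_nonneg_of_nonneg_of_le_pi hna0 (by linarith)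
    have hcb : 0 ≤ Real.cos b := Real.cos_nonneg_of_mem_Icc ⟨by linarith, hb'⟩
    push_cast
    rw [add_mul, add_mul, one_mul, one_mul, Real.sin_add, Real.sin_add]
    calc Real.sin a * (Real.sin (n * b) * Real.cos b + Real.cos (n * b) * Real.sin b)
        = (Real.sin a * Real.sin (n * b)) * Real.cos b +
          Real.sin a * Real.sin b * Real.cos (n * b) := by ring
      _ ≤ (Real.sin b * Real.sin (n * a)) * Real.cos a +
          Real.sin a * Real.sin b * Real.cos (n * a) := by gcongr
      _ = _ := by ring

/-- The sum of the absolute values of the modified Dirichlet kernels dominating the Lebesgue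
function. -/
def dirichletSum (n : ℕ) (θ : ℝ) : ℝ :=
  ∑ j ∈ Finset.range n, (|modDirichlet n (θ - chebAngle n j)| +
    |modDirichlet n (θ + chebAngle n j)|)

/-- Modulo `2 π` the angles `± φ_j` are the `2 n` odd multiples of `π / (2 n)`, so a shift by `π /
n` permutes them. `h3` and `h4` are the passages from one sign to the other, at `0` and at `π`. -/
theorem dirichletSum_periodic {n : ℕ} (hn : n ≠ 0) :
    Function.Periodic (dirichletSum n) (Real.pi / n) := by
  intro θ
  obtain ⟨k, rfl⟩ := Nat.exists_eq_succ_of_ne_zero hn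
  have hk : ((k + 1 : ℕ) : ℝ) ≠ 0 := by positivity
  have h1 : ∀ j : ℕ, θ + Real.pi / (k + 1 : ℕ) - chebAngle (k + 1) (j + 1) =
      θ - chebAngle (k + 1) j := by
    intro j; unfold chebAngle; field_simp; push_cast; ring
  have h2 : ∀ j : ℕ, θ + Real.pi / (k + 1 : ℕ) + chebAngle (k + 1) j =
      θ + chebAngle (k + 1) (j + 1) := by
    intro j; unfold chebAngle; field_simp; push_cast; ring
  have h3 : θ + Real.pi / (k + 1 : ℕ) - chebAngle (k + 1) 0 = θ + chebAngle (k + 1) 0 := by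
    unfold chebAngle; field_simp; push_cast; ring
  have h4 : θ + chebAngle (k + 1) (k + 1) = θ - chebAngle (k + 1) k + 2 * Real.pi := by
    unfold chebAngle; field_simp; push_cast; ring
  simp only [dirichletSum, Nat.succ_eq_add_one, Finset.sum_add_distrib, h2]
  rw [Finset.sum_range_succ' (fun j => |modDirichlet (k + 1)
      (θ + Real.pi / (k + 1 : ℕ) - chebAngle (k + 1) j)|),
    Finset.sum_range_succ (fun j => |modDirichlet (k + 1) (θ + chebAngle (k + 1) (j + 1))|),
    Finset.sum_range_succ (fun j => |modDirichlet (k + 1) (θ - chebAngle (k + 1) j)|),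
    Finset.sum_range_succ' (fun j => |modDirichlet (k + 1) (θ + chebAngle (k + 1) j)|),
    h3, h4, modDirichlet_add_two_pi]
  simp only [h1]
  ring

theorem continuous_dirichletSum (n : ℕ) : Continuous (dirichletSum n) := by
  unfold dirichletSum
  have := continuous_modDirichlet n
  fun_prop

theorem abs_sin_mul_chebAngle_add (n j : ℕ) (hn : n ≠ 0) (θ : ℝ) :
    |Real.sin (n * (chebAngle n j + θ))| = |Real.cos (n * θ)| := by
  have h : Real.cos (n * chebAngle n j) = 0 := cos_mul_chebAngle n j hn
  have h' : |Real.sin (n * chebAngle n j)| = 1 := by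
    have := Real.sin_sq_add_cos_sq (n * chebAngle n j)
    rw [h] at this
    rw [← sq_eq_sq₀ (abs_nonneg _) zero_le_one, sq_abs]
    linarith
  rw [mul_add, Real.sin_add, h, zero_mul, add_zero, abs_mul, h', one_mul]

/-- Equality holds at `θ = 0`. Since `cos (n φ) = 0`, each kernel equals `cos (n θ) cot ((φ ± θ) /
2)` up to sign. Adding the cotangents over the common denominator `a - b`, with `a = sin² (φ / 2)`
and `b = sin² (θ / 2)`, reduces the claim to `cos (n θ) a ≤ a - b`. -/
theorem abs_modDirichlet_add_le {n : ℕ} (hn : n ≠ 0) {j : ℕ} (hj : j < n) {θ : ℝ}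
    (hθ : |θ| < Real.pi / (2 * n)) :
    |modDirichlet n (θ - chebAngle n j)| + |modDirichlet n (θ + chebAngle n j)| ≤
      2 * Real.cot (chebAngle n j / 2) := by
  have hn0 : (0 : ℝ) < n := by positivity
  have hn1 : (1 : ℝ) ≤ n := by exact_mod_cast Nat.one_le_iff_ne_zero.2 hn
  set φ := chebAngle n j with hφ
  have hpi := Real.pi_pos
  have hjn : (j : ℝ) + 1 ≤ n := by exact_mod_cast hj
  have hφ1 : Real.pi / (2 * n) ≤ φ := by
    rw [hφ, chebAngle]
    gcongr
    nlinarith [(Nat.cast_nonneg j : (0 : ℝ) ≤ j)]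
  have hφ2 : φ + Real.pi / (2 * n) ≤ Real.pi := by
    rw [hφ, chebAngle, ← add_div, div_le_iff₀ (by positivity)]
    nlinarith
  have key : ∀ ε : ℝ, |ε| < Real.pi / (2 * n) → 0 < Real.sin ((φ + ε) / 2) ∧
      |modDirichlet n (φ + ε)| =
        |Real.cos (n * ε)| * Real.cos ((φ + ε) / 2) / Real.sin ((φ + ε) / 2) := by
    intro ε hε
    have h1 := abs_lt.1 hε
    have hs : 0 < Real.sin ((φ + ε) / 2) := Real.sin_pos_of_pos_of_lt_pi (by linarith) (by linarith)
    have hc : 0 ≤ Real.cos ((φ + ε) / 2) := Real.cos_nonneg_of_mem_Icc ⟨by linarith, by linarith⟩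
    refine ⟨hs, ?_⟩
    rw [eq_div_iff hs.ne']
    nth_rw 1 [← abs_of_pos hs]
    rw [← abs_mul, modDirichlet_mul_sin, abs_mul, abs_of_nonneg hc, hφ,
      abs_sin_mul_chebAngle_add n j hn]
  obtain ⟨hp, hP⟩ := key θ hθ
  obtain ⟨hm, hM⟩ := key (-θ) (by rwa [abs_neg])
  rw [modDirichlet_sub_comm, add_comm θ φ, sub_eq_add_neg, hP, hM, mul_neg, Real.cos_neg]
  have hcos : |Real.cos (n * θ)| = Real.cos (n * θ) := by
    refine abs_of_nonneg (Real.cos_nonneg_of_mem_Icc ?_)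
    rw [Set.mem_Icc, ← abs_le, abs_mul, abs_of_pos hn0]
    calc n * |θ| ≤ n * (Real.pi / (2 * n)) := by gcongr
      _ = Real.pi / 2 := by field_simp
  rw [hcos]
  have hsφ : 0 < Real.sin (φ / 2) := Real.sin_pos_of_pos_of_lt_pi
    (by have : 0 < Real.pi / (2 * n) := by positivity
        linarith) (by have : 0 < Real.pi / (2 * n) := by positivity
                      linarith)
  have hcφ : 0 ≤ Real.cos (φ / 2) := Real.cos_nonneg_of_mem_Icc
    ⟨by have : 0 < Real.pi / (2 * n) := by positivity
        linarith, by have : 0 < Real.pi / (2 * n) := by positivity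
                     linarith⟩
  set a := Real.sin (φ / 2) ^ 2 with ha
  set b := Real.sin (θ / 2) ^ 2 with hb
  have ha0 : 0 < a := by positivity
  have hprod : Real.sin ((φ + θ) / 2) * Real.sin ((φ + -θ) / 2) = a - b := by
    rw [ha, hb, show (φ + θ) / 2 = φ / 2 + θ / 2 by ring,
      show (φ + -θ) / 2 = φ / 2 - θ / 2 by ring, Real.sin_add, Real.sin_sub]
    linear_combination Real.sin (φ / 2) ^ 2 * Real.sin_sq_add_cos_sq (θ / 2) -
      Real.sin (θ / 2) ^ 2 * Real.sin_sq_add_cos_sq (φ / 2)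
  have hab : 0 < a - b := by rw [← hprod]; positivity
  have hnum : Real.cos ((φ + -θ) / 2) * Real.sin ((φ + θ) / 2) +
      Real.cos ((φ + θ) / 2) * Real.sin ((φ + -θ) / 2) =
      2 * Real.sin (φ / 2) * Real.cos (φ / 2) := by
    rw [← Real.sin_two_mul, mul_comm (Real.cos ((φ + -θ) / 2)), ← Real.sin_add]
    congr 1
    ring
  -- Here `|θ| / 2 ≤ π / (4 n) ≤ φ / 2`. The ratio `sin (n x) / sin x` is compared at `|θ| / 2` and
  -- at `π / (4 n)`, where its numerator is `√2 / 2`; squaring gives the factor `1 / 2`.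
  have hsin : b / 2 ≤ a * Real.sin (n * (θ / 2)) ^ 2 := by
    have h4 : Real.pi / (4 * n) ≤ Real.pi / 4 := by
      gcongr
      linarith
    have h := sin_mul_sin_nat_mul_le n (a := |θ| / 2) (b := Real.pi / (4 * n)) (by positivity)
      (by have : Real.pi / (4 * n) = Real.pi / (2 * n) / 2 := by field_simp; norm_num
          rw [this]; linarith)
      (by have : (n : ℝ) * (Real.pi / (4 * n)) = Real.pi / 4 := by field_simp
          rw [this]; linarith)
      (by linarith)
    have h5 : (n : ℝ) * (Real.pi / (4 * n)) = Real.pi / 4 := by field_simp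
    rw [h5, Real.sin_pi_div_four] at h
    have h6 : Real.sin (Real.pi / (4 * n)) ≤ Real.sin (φ / 2) := by
      refine Real.sin_le_sin_of_le_of_le_pi_div_two ?_ ?_ ?_
      · have : 0 < Real.pi / (4 * n) := by positivity
        linarith
      · have : 0 < Real.pi / (2 * n) := by positivity
        linarith
      · have : Real.pi / (4 * n) = Real.pi / (2 * n) / 2 := by field_simp; norm_num
        rw [this]; linarith
    have h7 : Real.sin (n * (|θ| / 2)) ^ 2 = Real.sin (n * (θ / 2)) ^ 2 := by
      rcases abs_choice θ with h | h <;> rw [h]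
      rw [neg_div, mul_neg, Real.sin_neg, neg_sq]
    have h8 : Real.sin (|θ| / 2) ^ 2 = b := by
      rw [hb]
      rcases abs_choice θ with h | h <;> rw [h]
      rw [neg_div, Real.sin_neg, neg_sq]
    have h9 : 0 ≤ Real.sin (|θ| / 2) := Real.sin_nonneg_of_nonneg_of_le_pi (by positivity) (by
      have : Real.pi / (2 * n) ≤ Real.pi / 2 := by gcongr; linarith
      linarith)
    have h10 : 0 ≤ Real.sin (n * (|θ| / 2)) := by
      refine Real.sin_nonneg_of_nonneg_of_le_pi (by positivity) ?_
      calc n * (|θ| / 2) ≤ n * (Real.pi / (2 * n) / 2) := by gcongr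
        _ = Real.pi / 4 := by field_simp; norm_num
        _ ≤ Real.pi := by linarith
    have h11 : Real.sin (|θ| / 2) * (√2 / 2) ≤ Real.sin (φ / 2) * Real.sin (n * (|θ| / 2)) :=
      h.trans (mul_le_mul_of_nonneg_right h6 h10)
    have h12 := pow_le_pow_left₀ (by positivity) h11 2
    rw [mul_pow, mul_pow, h7, h8, div_pow, Real.sq_sqrt (by norm_num)] at h12
    linarith
  have hmain : Real.cos (n * θ) * a ≤ a - b := by
    have : Real.cos (n * θ) = 1 - 2 * Real.sin (n * (θ / 2)) ^ 2 := by
      rw [show (n : ℝ) * θ = 2 * (n * (θ / 2)) by ring, Real.cos_two_mul, Real.cos_sq']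
      ring
    rw [this]
    linarith
  have hlhs : Real.cos (n * θ) * Real.cos ((φ + -θ) / 2) / Real.sin ((φ + -θ) / 2) +
      Real.cos (n * θ) * Real.cos ((φ + θ) / 2) / Real.sin ((φ + θ) / 2) =
      Real.cos (n * θ) * (2 * Real.sin (φ / 2) * Real.cos (φ / 2)) / (a - b) := by
    rw [← hprod, ← hnum]
    field_simp
  rw [hlhs, Real.cot_eq_cos_div_sin, div_le_iff₀ hab]
  have : 2 * (Real.cos (φ / 2) / Real.sin (φ / 2)) * (a - b) =
      (2 * Real.sin (φ / 2) * Real.cos (φ / 2)) / a * (a - b) := by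
    rw [ha]; field_simp
  rw [this, div_mul_eq_mul_div, le_div_iff₀ ha0]
  nlinarith [mul_nonneg hsφ.le hcφ]

/-- Periodicity brings `θ` to `[-π / (2 n), π / (2 n)]`. At the endpoints `φ_0 ± θ` can vanish,
which the pairwise bound excludes; continuity covers them. -/
theorem dirichletSum_le {n : ℕ} (hn : n ≠ 0) (θ : ℝ) :
    dirichletSum n θ ≤ ∑ j ∈ Finset.range n, 2 * Real.cot (chebAngle n j / 2) := by
  have hn0 : (0 : ℝ) < n := by positivity
  have hpos : 0 < Real.pi / n := by positivity
  obtain ⟨θ', hθ', heq⟩ := (dirichletSum_periodic hn).exists_mem_Ico hpos θ (-(Real.pi / (2 * n)))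
  rw [heq]
  have hcl : IsClosed {θ | dirichletSum n θ ≤
      ∑ j ∈ Finset.range n, 2 * Real.cot (chebAngle n j / 2)} :=
    isClosed_le (continuous_dirichletSum n) continuous_const
  have hsub : Set.Ioo (-(Real.pi / (2 * n))) (Real.pi / (2 * n)) ⊆ {θ | dirichletSum n θ ≤
      ∑ j ∈ Finset.range n, 2 * Real.cot (chebAngle n j / 2)} := by
    intro x hx
    exact Finset.sum_le_sum fun j hj =>
      abs_modDirichlet_add_le hn (Finset.mem_range.1 hj) (abs_lt.2 hx)
  have h2 : 0 < Real.pi / (2 * n) := by positivity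
  have := closure_minimal hsub hcl
  rw [closure_Ioo (by linarith)] at this
  refine this ⟨hθ'.1, hθ'.2.le.trans ?_⟩
  have : Real.pi / n = Real.pi / (2 * n) + Real.pi / (2 * n) := by field_simp; norm_num
  linarith

/-- Cleared of denominators this says `sin x (1 - x² / 3) - x cos x ≥ 0`: the left side vanishes at
`0` and has derivative `(x / 3) (sin x - x cos x) ≥ 0`. The correction `x / 3` is what brings the
additive constant in `sum_cot_le` below `1`. -/
theorem cot_le {x : ℝ} (hx0 : 0 < x) (hx : x ≤ Real.pi / 2) : Real.cot x ≤ 1 / x - x / 3 := by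
  have hpi := Real.pi_pos
  have hmono : MonotoneOn (fun x => Real.sin x * (1 - x ^ 2 / 3) - x * Real.cos x)
      (Set.Icc 0 Real.pi) := by
    refine monotoneOn_of_hasDerivWithinAt_nonneg (convex_Icc _ _) (by fun_prop)
      (f' := fun x => x / 3 * (Real.sin x - x * Real.cos x)) ?_ ?_
    · intro x _
      have h := (((Real.hasDerivAt_sin x).mul (((hasDerivAt_pow 2 x).div_const 3).const_sub 1)).sub
        ((hasDerivAt_id' x).mul (Real.hasDerivAt_cos x)))
      refine HasDerivAt.hasDerivWithinAt (h.congr_deriv ?_)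
      simp
      ring
    · intro x hx
      rw [interior_Icc] at hx
      refine mul_nonneg (by linarith [hx.1]) ?_
      rcases le_or_gt x (Real.pi / 2) with h | h
      · rcases h.eq_or_lt with h | h
        · rw [h]; simp
        · have hc : 0 < Real.cos x := Real.cos_pos_of_mem_Ioo ⟨by linarith [hx.1], h⟩
          have := Real.lt_tan hx.1 h
          rw [Real.tan_eq_sin_div_cos, lt_div_iff₀ hc] at this
          linarith
      · have hc := Real.cos_nonpos_of_pi_div_two_le_of_le h.le (by linarith [hx.2])
        have hs := Real.sin_nonneg_of_nonneg_of_le_pi hx.1.le hx.2.le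
        nlinarith [hx.1]
  have h := hmono ⟨le_rfl, hpi.le⟩ ⟨hx0.le, by linarith⟩ hx0.le
  simp only [Real.sin_zero, zero_mul, sub_zero] at h
  have hs : 0 < Real.sin x := Real.sin_pos_of_pos_of_lt_pi hx0 (by linarith)
  rw [Real.cot_eq_cos_div_sin, div_le_iff₀ hs, show 1 / x - x / 3 = (1 - x ^ 2 / 3) / x by
    field_simp, div_mul_eq_mul_div, le_div_iff₀ hx0]
  linarith

/-- The induction step is `1 / (2 n + 1) ≤ log (1 + 1 / n) / 2`, the first term of the series of the
logarithm. The constant makes `n = 2` an equality; an induction from `n = 1` would give the constant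
`1`, too large for `sum_cot_le`. -/
theorem sum_inv_odd_le {n : ℕ} (hn : 2 ≤ n) :
    ∑ j ∈ Finset.range n, 1 / (2 * (j : ℝ) + 1) ≤ Real.log n / 2 + 4 / 3 - Real.log 2 / 2 := by
  induction n, hn using Nat.le_induction with
  | base => norm_num [Finset.sum_range_succ]
  | succ n hn ih =>
    rw [Finset.sum_range_succ]
    have hn0 : (0 : ℝ) < n := by positivity
    have h := (Real.hasSum_log_one_add_inv hn0).summable.sum_le_tsum (Finset.range 1) (fun i _ => by
      positivity)
    rw [(Real.hasSum_log_one_add_inv hn0).tsum_eq] at h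
    simp only [Finset.range_one, Finset.sum_singleton] at h
    have hlog : Real.log (n + 1 : ℕ) = Real.log n + Real.log (1 + (n : ℝ)⁻¹) := by
      rw [← Real.log_mul hn0.ne' (by positivity)]
      congr 1
      push_cast
      field_simp
    rw [hlog]
    norm_num at h
    simp only [one_div] at ih ⊢
    linarith

theorem sum_odd (n : ℕ) : ∑ j ∈ Finset.range n, (2 * (j : ℝ) + 1) = (n : ℝ) ^ 2 := by
  induction n with
  | zero => simp
  | succ n ih => rw [Finset.sum_range_succ, ih]; push_cast; ring

theorem sum_cot_le {n : ℕ} (hn : 2 ≤ n) :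
    (1 / (n : ℝ)) * ∑ j ∈ Finset.range n, Real.cot (chebAngle n j / 2) ≤
      2 / Real.pi * Real.log n + 1 := by
  have hn0 : (0 : ℝ) < n := by positivity
  have hpi := Real.pi_pos
  have h1 : ∀ j ∈ Finset.range n, Real.cot (chebAngle n j / 2) ≤
      4 * n / Real.pi * (1 / (2 * (j : ℝ) + 1)) - Real.pi / (12 * n) * (2 * (j : ℝ) + 1) := by
    intro j hj
    have hjn : (j : ℝ) + 1 ≤ n := by exact_mod_cast Finset.mem_range.1 hj
    have hpos : 0 < chebAngle n j / 2 := by unfold chebAngle; positivity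
    refine (cot_le hpos ?_).trans (le_of_eq ?_)
    · unfold chebAngle
      rw [div_div, div_le_div_iff₀ (by positivity) (by positivity)]
      nlinarith
    · unfold chebAngle
      field_simp
      ring
  have h2 := Finset.sum_le_sum h1
  rw [Finset.sum_sub_distrib, ← Finset.mul_sum, ← Finset.mul_sum, sum_odd] at h2
  have h3 := sum_inv_odd_le hn
  have h4 : (1 / (n : ℝ)) * ∑ j ∈ Finset.range n, Real.cot (chebAngle n j / 2) ≤
      (1 / (n : ℝ)) * (4 * n / Real.pi * (Real.log n / 2 + 4 / 3 - Real.log 2 / 2) -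
        Real.pi / (12 * n) * (n : ℝ) ^ 2) := by
    gcongr
    refine h2.trans ?_
    gcongr
  refine h4.trans ?_
  have h5 : (1 / (n : ℝ)) * (4 * n / Real.pi * (Real.log n / 2 + 4 / 3 - Real.log 2 / 2) -
        Real.pi / (12 * n) * (n : ℝ) ^ 2) =
      2 / Real.pi * Real.log n + (4 * (4 / 3 - Real.log 2 / 2) / Real.pi - Real.pi / 12) := by
    field_simp
    ring
  rw [h5]
  gcongr
  -- The constant to be bounded by `1` is about `0.995`.
  rw [sub_le_iff_le_add, div_le_iff₀ hpi]
  nlinarith [Real.log_two_gt_d9, Real.pi_gt_d2]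

theorem sum_abs_chebKernel_le {m : ℕ} (hm : 1 ≤ m) {x : ℝ} (hx : x ∈ Set.Icc (-1 : ℝ) 1) :
    ∑ j, |chebKernel m x j| ≤ 2 / Real.pi * Real.log ((m : ℝ) + 1) + 1 := by
  have hm0 : (0 : ℝ) < (m : ℝ) + 1 := by positivity
  rw [← Real.cos_arccos hx.1 hx.2]
  set θ := Real.arccos x
  have h1 : ∀ j, |chebKernel m (Real.cos θ) j| ≤ 1 / (2 * ((m : ℝ) + 1)) *
      (|modDirichlet (m + 1) (θ - chebAngle (m + 1) j)| +
        |modDirichlet (m + 1) (θ + chebAngle (m + 1) j)|) := by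
    intro j
    have h := abs_add_le (modDirichlet (m + 1) (θ - chebAngle (m + 1) j))
      (modDirichlet (m + 1) (θ + chebAngle (m + 1) j))
    rw [← chebKernel_cos, abs_mul, abs_of_pos (by positivity)] at h
    rw [one_div_mul_eq_div, le_div_iff₀ (by positivity)]
    linarith
  have h2 := dirichletSum_le (n := m + 1) (by simp) θ
  have h3 := sum_cot_le (n := m + 1) (by omega)
  push_cast at h3
  calc ∑ j, |chebKernel m (Real.cos θ) j|
      ≤ ∑ j : Fin (m + 1), 1 / (2 * ((m : ℝ) + 1)) *
      (|modDirichlet (m + 1) (θ - chebAngle (m + 1) j)| +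
        |modDirichlet (m + 1) (θ + chebAngle (m + 1) j)|) := Finset.sum_le_sum fun j _ => h1 j
    _ = 1 / (2 * ((m : ℝ) + 1)) * dirichletSum (m + 1) θ := by
      rw [← Finset.mul_sum, dirichletSum, ← Fin.sum_univ_eq_sum_range
        (fun j : ℕ => |modDirichlet (m + 1) (θ - chebAngle (m + 1) j)| +
          |modDirichlet (m + 1) (θ + chebAngle (m + 1) j)|)]
    _ ≤ 1 / (2 * ((m : ℝ) + 1)) *
        ∑ j ∈ Finset.range (m + 1), 2 * Real.cot (chebAngle (m + 1) j / 2) := by gcongr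
    _ = 1 / ((m : ℝ) + 1) * ∑ j ∈ Finset.range (m + 1), Real.cot (chebAngle (m + 1) j / 2) := by
      rw [← Finset.mul_sum]; field_simp
    _ ≤ _ := h3

end Bermudan

end

noncomputable section

namespace Bermudan

open Polynomial.Chebyshev Real Complex

/-! ### Exactness of the Chebyshev interpolation on polynomials -/

theorem sum_eval_T_chebNode (m : ℕ) (k : ℤ) :
    ∑ j, (T ℝ k).eval (chebNode m j) = ((m : ℝ) + 1) / Real.pi * sumZeroes (m + 1) (T ℝ k) := by
  have hm : (m : ℝ) + 1 ≠ 0 := by positivity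
  rw [sumZeroes, ← mul_assoc, show ((m : ℝ) + 1) / Real.pi * (Real.pi / (m + 1 : ℕ)) = 1 by
    push_cast; field_simp, one_mul, ← Fin.sum_univ_eq_sum_range
    (fun i : ℕ => (T ℝ k).eval (Real.cos ((2 * i + 1) / (2 * (m + 1 : ℕ)) * Real.pi)))]
  refine Finset.sum_congr rfl fun j _ => ?_
  rw [chebNode_eq_cos, chebAngle]
  congr 2
  push_cast
  ring

/-- Discrete orthogonality: the product is the mean of `T_{l+k}` and `T_{l-k}`. Their indices are
below `2 (m + 1)` in absolute value, and in that range only `T_0` has a nonzero sum over the nodes.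
-/
theorem sum_eval_T_chebNode_mul (m : ℕ) {k l : ℕ} (hk : k ≤ m) (hl : l ≤ m) :
    ∑ j, (T ℝ (l : ℤ)).eval (chebNode m j) * (T ℝ (k : ℤ)).eval (chebNode m j) =
      if l = k then ((m : ℝ) + 1) / (if 0 < l then 2 else 1) else 0 := by
  have hm : (m : ℝ) + 1 ≠ 0 := by positivity
  have hpi := Real.pi_ne_zero
  have h : ∀ x : ℝ, (T ℝ (l : ℤ)).eval x * (T ℝ (k : ℤ)).eval x =
      1 / 2 * (T ℝ ((l : ℤ) + k)).eval x + 1 / 2 * (T ℝ ((l : ℤ) - k)).eval x := by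
    intro x
    have := congrArg (Polynomial.eval x) (T_mul_T ℝ (l : ℤ) k)
    simp only [Polynomial.eval_mul, Polynomial.eval_add, Polynomial.eval_ofNat] at this
    linarith
  have hz : ∀ p : ℤ, p ≠ 0 → |p| < 2 * ((m : ℤ) + 1) → sumZeroes (m + 1) (T ℝ p) = 0 := by
    intro p hp hp'
    refine sumZeroes_T_of_not_dvd fun hd => ?_
    have := Int.le_of_dvd (abs_pos.2 hp) ((dvd_abs _ _).2 hd)
    push_cast at this
    omega
  simp_rw [h]
  rw [Finset.sum_add_distrib, ← Finset.mul_sum, ← Finset.mul_sum, sum_eval_T_chebNode,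
    sum_eval_T_chebNode]
  have h0 := sumZeroes_T_zero (n := m + 1) (by simp)
  split_ifs with h1 h2
  · subst h1
    rw [sub_self, h0, hz _ (by omega) (by rw [abs_lt]; omega)]
    field_simp
    ring
  · obtain rfl : l = 0 := by omega
    subst h1
    simp only [Nat.cast_zero, add_zero, sub_self, h0]
    field_simp
    norm_num
  · rw [hz _ (by omega) (by rw [abs_lt]; omega), hz _ (by omega) (by rw [abs_lt]; omega)]
    simp

theorem sum_chebKernel_mul_T (m : ℕ) {k : ℕ} (hk : k ≤ m) (x : ℝ) :
    ∑ j, chebKernel m x j * (T ℝ (k : ℤ)).eval (chebNode m j) = (T ℝ (k : ℤ)).eval x := by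
  have hm : (m : ℝ) + 1 ≠ 0 := by positivity
  simp only [chebKernel, Finset.sum_mul]
  rw [Finset.sum_comm]
  have : ∀ l : Fin (m + 1), ∑ j, (if 0 < (l : ℕ) then 2 else 1) / ((m : ℝ) + 1) *
      ((T ℝ ((l : ℕ) : ℤ)).eval (chebNode m j) * (T ℝ ((l : ℕ) : ℤ)).eval x) *
        (T ℝ (k : ℤ)).eval (chebNode m j) =
      if l = (⟨k, by omega⟩ : Fin (m + 1)) then (T ℝ (k : ℤ)).eval x else 0 := by
    intro l
    have h := sum_eval_T_chebNode_mul m hk (Nat.lt_succ_iff.1 l.2)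
    calc _ = (if 0 < (l : ℕ) then 2 else 1) / ((m : ℝ) + 1) * (T ℝ ((l : ℕ) : ℤ)).eval x *
        ∑ j, (T ℝ ((l : ℕ) : ℤ)).eval (chebNode m j) * (T ℝ (k : ℤ)).eval (chebNode m j) := by
          rw [Finset.mul_sum]
          exact Finset.sum_congr rfl fun j _ => by ring
      _ = _ := by
        rw [h]
        simp only [Fin.ext_iff]
        by_cases hlk : (l : ℕ) = k
        · rw [if_pos hlk, if_pos hlk, hlk]
          split_ifs <;> field_simp
        · rw [if_neg hlk, if_neg hlk, mul_zero]
  rw [Finset.sum_congr rfl fun l _ => this l]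
  simp

theorem sum_chebKernel_mul_eval (m : ℕ) (x : ℝ) {P : Polynomial ℂ}
    (hP : P ∈ Polynomial.degreeLT ℂ (m + 1)) :
    ∑ j, (chebKernel m x j : ℂ) * P.eval (chebNode m j : ℂ) = P.eval (x : ℂ) := by
  rw [← Polynomial.Sequence.span_degreeLT (chebyshevTsequence ℂ) (by simp)] at hP
  induction hP using Submodule.span_induction with
  | mem P hP =>
    obtain ⟨k, hk, rfl⟩ := hP
    change ∑ j, (chebKernel m x j : ℂ) * (T ℂ (k : ℤ)).eval (chebNode m j : ℂ) =
      (T ℂ (k : ℤ)).eval (x : ℂ)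
    simp only [← complex_ofReal_eval_T]
    rw [← sum_chebKernel_mul_T m (Nat.lt_succ_iff.1 hk)]
    push_cast
    exact Finset.sum_congr rfl fun j _ => rfl
  | zero => simp
  | add P Q _ _ hP hQ =>
    simp only [Polynomial.eval_add, mul_add, Finset.sum_add_distrib, hP, hQ]
  | smul c P _ hP =>
    rw [Polynomial.eval_smul, smul_eq_mul, ← hP, Finset.mul_sum]
    exact Finset.sum_congr rfl fun j _ => by rw [Polynomial.eval_smul, smul_eq_mul]; ring

theorem eval_T_chebNode (m : ℕ) (j : Fin (m + 1)) :
    (T ℂ ((m + 1 : ℕ) : ℤ)).eval (chebNode m j : ℂ) = 0 := by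
  rw [← complex_ofReal_eval_T, chebNode_eq_cos, T_real_cos]
  have := cos_mul_chebAngle (m + 1) j (by simp)
  exact_mod_cast this

/-- The Chebyshev interpolant of `y ↦ (z - y)⁻¹`. -/
theorem sum_chebKernel_mul_inv (m : ℕ) (x : ℝ) {z : ℂ} (hx : z ≠ x) (hz : ∀ j, z ≠ chebNode m j)
    (hT : (T ℂ ((m + 1 : ℕ) : ℤ)).eval z ≠ 0) :
    ∑ j, (chebKernel m x j : ℂ) * (z - chebNode m j)⁻¹ =
      (z - x)⁻¹ * (1 - (T ℂ ((m + 1 : ℕ) : ℤ)).eval (x : ℂ) /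
        (T ℂ ((m + 1 : ℕ) : ℤ)).eval z) := by
  set Tn := T ℂ ((m + 1 : ℕ) : ℤ) with hTn
  -- `Q(y) = (T(y) - T(z)) / (y - z)` has degree `m`, so it is interpolated exactly. As `T` vanishes
  -- at the nodes, `Q / T(z)` takes there the values of `(z - y)⁻¹`.
  obtain ⟨Q, hQ⟩ := Polynomial.X_sub_C_dvd_sub_C_eval (p := Tn) (a := z)
  have hdT : Tn.natDegree = m + 1 := by rw [hTn, natDegree_T, Int.natAbs_natCast]
  have hQ0 : Q ≠ 0 := by
    rintro rfl
    have := congrArg Polynomial.natDegree hQ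
    rw [Polynomial.natDegree_sub_C, hdT] at this
    simp at this
  have hdQ : Q.natDegree = m := by
    have := congrArg Polynomial.natDegree hQ
    rw [Polynomial.natDegree_sub_C, hdT, Polynomial.natDegree_mul (Polynomial.X_sub_C_ne_zero z) hQ0,
      Polynomial.natDegree_X_sub_C] at this
    omega
  have hmem : Q ∈ Polynomial.degreeLT ℂ (m + 1) := by
    rw [Polynomial.mem_degreeLT, Polynomial.degree_eq_natDegree hQ0, hdQ]
    exact_mod_cast Nat.lt_succ_self m
  have heval : ∀ y : ℂ, Tn.eval y - Tn.eval z = (y - z) * Q.eval y := by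
    intro y
    simpa using congrArg (Polynomial.eval y) hQ
  have h := sum_chebKernel_mul_eval m x hmem
  have hQx : Q.eval (x : ℂ) = (Tn.eval z - Tn.eval (x : ℂ)) * (z - x)⁻¹ := by
    rw [eq_mul_inv_iff_mul_eq₀ (sub_ne_zero.2 hx)]
    linear_combination heval x
  have hQj : ∀ j, (z - chebNode m j)⁻¹ = (Tn.eval z)⁻¹ * Q.eval (chebNode m j : ℂ) := by
    intro j
    have h1 := heval (chebNode m j)
    rw [eval_T_chebNode] at h1
    have := sub_ne_zero.2 (hz j)
    field_simp
    linear_combination -h1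
  simp_rw [hQj]
  calc _ = (Tn.eval z)⁻¹ * ∑ j, (chebKernel m x j : ℂ) * Q.eval (chebNode m j : ℂ) := by
        rw [Finset.mul_sum]; exact Finset.sum_congr rfl fun j _ => by ring
    _ = _ := by rw [h, hQx]; field_simp

/-! ### The Joukowski map and Bernstein ellipses -/

/-- The Joukowski map. -/
def joukowski (w : ℂ) : ℂ := (w + w⁻¹) / 2

theorem joukowski_inv (w : ℂ) : joukowski w⁻¹ = joukowski w := by
  rw [joukowski, joukowski, inv_inv, add_comm]

theorem exists_joukowski_eq (z : ℂ) : ∃ w : ℂ, w ≠ 0 ∧ joukowski w = z := by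
  obtain ⟨s, hs⟩ := IsAlgClosed.exists_pow_nat_eq (z ^ 2 - 1) (n := 2) (by norm_num)
  have h : (z + s) * (z - s) = 1 := by linear_combination -hs
  have h0 : z + s ≠ 0 := left_ne_zero_of_mul_eq_one h
  refine ⟨z + s, h0, ?_⟩
  rw [joukowski, inv_eq_of_mul_eq_one_right h]
  ring

/-- Since `J(w) ∓ 1 = (w ∓ 1)² / (2 w)`, the sum of the focal distances is given by the
parallelogram law. This turns the ellipse into a strict inequality on `z`, which shows that it is
open. -/
theorem norm_joukowski_foci {w : ℂ} (hw : w ≠ 0) :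
    ‖joukowski w - 1‖ + ‖joukowski w + 1‖ = ‖w‖ + ‖w‖⁻¹ := by
  have h1 : joukowski w - 1 = (w - 1) ^ 2 / (2 * w) := by
    rw [joukowski]; field_simp; ring
  have h2 : joukowski w + 1 = (w + 1) ^ 2 / (2 * w) := by
    rw [joukowski]; field_simp; ring
  have h3 := parallelogram_law_with_norm ℝ w 1
  have hw' : ‖w‖ ≠ 0 := norm_ne_zero_iff.2 hw
  rw [h1, h2, norm_div, norm_div, norm_pow, norm_pow, norm_mul]
  simp only [Complex.norm_ofNat, norm_one] at *
  field_simp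
  linarith

theorem add_inv_lt_add_inv_iff {r ρ : ℝ} (hr : 0 < r) (hρ : 1 < ρ) :
    r + r⁻¹ < ρ + ρ⁻¹ ↔ ρ⁻¹ < r ∧ r < ρ := by
  have h0 : 0 < ρ := by linarith
  have h : ρ + ρ⁻¹ - (r + r⁻¹) = (ρ - r) * (r - ρ⁻¹) / r := by field_simp; ring
  have hρ1 : ρ⁻¹ < ρ := (inv_lt_one_of_one_lt₀ hρ).trans hρ
  rw [← sub_pos, h, div_pos_iff_of_pos_right hr, mul_pos_iff]
  constructor
  · rintro (h | h)
    · exact ⟨by linarith, by linarith⟩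
    · linarith
  · rintro ⟨h1, h2⟩
    exact Or.inl ⟨by linarith, by linarith⟩

theorem joukowski_mem_bernsteinEllipse {ρ : ℝ} {w : ℂ} (h1 : ρ⁻¹ < ‖w‖) (h2 : ‖w‖ < ρ) :
    joukowski w ∈ bernsteinEllipse ρ := ⟨w, h1, h2, rfl⟩

theorem bernsteinEllipse_eq {ρ : ℝ} (hρ : 1 < ρ) :
    bernsteinEllipse ρ = {z | ‖z - 1‖ + ‖z + 1‖ < ρ + ρ⁻¹} := by
  have h0 : 0 < ρ := by linarith
  ext z
  constructor
  · rintro ⟨w, h1, h2, rfl⟩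
    have hw : 0 < ‖w‖ := (inv_pos.2 h0).trans h1
    have := norm_joukowski_foci (norm_pos_iff.1 hw)
    rw [Set.mem_ofPred_eq]
    change ‖joukowski w - 1‖ + ‖joukowski w + 1‖ < _
    rw [this]
    exact (add_inv_lt_add_inv_iff hw hρ).2 ⟨h1, h2⟩
  · intro hz
    obtain ⟨w, hw, rfl⟩ := exists_joukowski_eq z
    rw [Set.mem_ofPred_eq, norm_joukowski_foci hw,
      add_inv_lt_add_inv_iff (norm_pos_iff.2 hw) hρ] at hz
    exact joukowski_mem_bernsteinEllipse hz.1 hz.2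

theorem isOpen_bernsteinEllipse {ρ : ℝ} (hρ : 1 < ρ) : IsOpen (bernsteinEllipse ρ) := by
  rw [bernsteinEllipse_eq hρ]
  exact isOpen_lt (by fun_prop) continuous_const

theorem exists_unit_joukowski {x : ℝ} (hx : x ∈ Set.Icc (-1 : ℝ) 1) :
    ∃ e : ℂ, ‖e‖ = 1 ∧ joukowski e = x := by
  refine ⟨Complex.exp (Real.arccos x * I), Complex.norm_exp_ofReal_mul_I _, ?_⟩
  rw [joukowski, ← Complex.exp_neg, ← neg_mul, ← Complex.cos, ← Complex.ofReal_cos,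
    Real.cos_arccos hx.1 hx.2]

theorem ofReal_mem_bernsteinEllipse {ρ : ℝ} (hρ : 1 < ρ) {x : ℝ} (hx : x ∈ Set.Icc (-1 : ℝ) 1) :
    (x : ℂ) ∈ bernsteinEllipse ρ := by
  obtain ⟨e, he, hex⟩ := exists_unit_joukowski hx
  rw [← hex]
  exact joukowski_mem_bernsteinEllipse (by rw [he]; exact inv_lt_one_of_one_lt₀ hρ) (by rwa [he])

theorem eval_T_joukowski (n : ℕ) {w : ℂ} (hw : w ≠ 0) :
    (T ℂ (n : ℤ)).eval (joukowski w) = joukowski (w ^ n) := by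
  have h : ∀ v : ℂ, v ≠ 0 → joukowski v = Complex.cos (-I * Complex.log v) := by
    intro v hv
    rw [joukowski, Complex.cos, show -I * Complex.log v * I = Complex.log v by
      linear_combination (-Complex.log v) * I_sq,
      show -(-I * Complex.log v) * I = -Complex.log v by
      linear_combination (Complex.log v) * I_sq, Complex.exp_neg, Complex.exp_log hv]
  rw [h w hw, T_complex_cos, Complex.cos, joukowski]
  have h1 : ((n : ℤ) : ℂ) * (-I * Complex.log w) * I = n * Complex.log w := by
    push_cast; linear_combination (-n * Complex.log w) * I_sq
  have h2 : -(((n : ℤ) : ℂ) * (-I * Complex.log w)) * I = -(n * Complex.log w) := by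
    push_cast; linear_combination (n * Complex.log w) * I_sq
  rw [h1, h2, Complex.exp_neg, Complex.exp_nat_mul, Complex.exp_log hw]

theorem differentiableAt_joukowski {w : ℂ} (hw : w ≠ 0) : DifferentiableAt ℂ joukowski w := by
  unfold joukowski
  fun_prop (disch := assumption)

/-! ### The Cauchy formula on Bernstein ellipses -/

/-- Up to a factor this is `∮ D dz = 0` on an ellipse. The integrand is holomorphic on `t ≤ |w| ≤
t⁻¹`, so its averages over the two boundary circles agree. The inversion `w ↦ w⁻¹` exchanges the
circles, fixes `J` and changes the sign of `w⁻¹ - w`, so they are also opposite. -/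
theorem circleAverage_joukowski_mul_eq_zero {ρ t : ℝ} (hρ : 1 < ρ) (ht : ρ⁻¹ < t) (ht1 : t < 1)
    {D : ℂ → ℂ} (hD : DifferentiableOn ℂ D (bernsteinEllipse ρ)) :
    circleAverage (fun w => D (joukowski w) * (w⁻¹ - w)) 0 t = 0 := by
  have hρ0 : 0 < ρ := by linarith
  have ht0 : 0 < t := (inv_pos.2 hρ0).trans ht
  have htinv : t⁻¹ < ρ := inv_lt_of_inv_lt₀ hρ0 ht
  set h : ℂ → ℂ := fun w => D (joukowski w) * (w⁻¹ - w) with hh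
  have hd : ∀ w : ℂ, t ≤ ‖w‖ → ‖w‖ ≤ t⁻¹ → DifferentiableAt ℂ h w := by
    intro w h1 h2
    have hw : w ≠ 0 := norm_pos_iff.1 (ht0.trans_le h1)
    have hmem : joukowski w ∈ bernsteinEllipse ρ :=
      joukowski_mem_bernsteinEllipse (ht.trans_le h1) (h2.trans_lt htinv)
    have hDw : DifferentiableAt ℂ D (joukowski w) :=
      hD.differentiableAt ((isOpen_bernsteinEllipse hρ).mem_nhds hmem)
    exact (hDw.comp w (differentiableAt_joukowski hw)).mul
      ((differentiableAt_inv hw).sub differentiableAt_id)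
  have htt : t ≤ t⁻¹ := ht1.le.trans (one_lt_inv₀ ht0 |>.2 ht1).le
  have hA : circleAverage h 0 t⁻¹ = circleAverage h 0 t := by
    rw [circleAverage_eq_circleIntegral (inv_pos.2 ht0).ne', circleAverage_eq_circleIntegral ht0.ne',
      circleIntegral_sub_center_inv_smul_eq_of_differentiable_on_annulus_off_countable ht0 htt
        Set.countable_empty]
    · intro z hz
      simp only [Set.mem_sdiff, Metric.mem_closedBall, dist_zero_right, Metric.mem_ball,
        not_lt] at hz
      exact (hd z hz.2 hz.1).continuousAt.continuousWithinAt
    · intro z hz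
      simp only [Set.mem_sdiff, Metric.mem_closedBall, dist_zero_right, Metric.mem_ball,
        not_le] at hz
      exact hd z hz.1.2.le hz.1.1.le
  have hB : circleAverage h 0 t⁻¹ = -circleAverage h 0 t := by
    rw [circleAverage_eq_circleAverage_zero_one, ← circleAverage_zero_one_congr_inv,
      circleAverage_eq_circleAverage_zero_one (R := t), ← neg_one_smul ℝ, ← circleAverage_fun_smul]
    congr 1
    ext z
    have hinv : ((t⁻¹ : ℝ) : ℂ) * z⁻¹ + 0 = ((t : ℂ) * z + 0)⁻¹ := by
      rw [add_zero, add_zero, mul_inv, Complex.ofReal_inv]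
    rw [hinv]
    simp only [hh, joukowski_inv, inv_inv, neg_smul, one_smul]
    ring
  have : circleAverage h 0 t = -circleAverage h 0 t := hA.symm.trans hB
  exact self_eq_neg.1 this

/-- The Poisson-type kernel of the Cauchy formula on Bernstein ellipses. -/
def ellipseKernel (y w : ℂ) : ℂ := (1 - w ^ 2) / (1 - 2 * y * w + w ^ 2)

theorem one_sub_two_mul_joukowski {e w : ℂ} (he : ‖e‖ = 1) :
    1 - 2 * joukowski e * w + w ^ 2 = (1 - w * e) * (1 - w * e⁻¹) := by
  have : e ≠ 0 := norm_ne_zero_iff.1 (by rw [he]; norm_num)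
  rw [joukowski]
  field_simp
  ring

theorem one_sub_mul_ne_zero {e w : ℂ} (he : ‖e‖ = 1) (hw : ‖w‖ < 1) : 1 - w * e ≠ 0 := by
  intro h
  have : ‖w * e‖ = 1 := by rw [← sub_eq_zero.1 h, norm_one]
  rw [norm_mul, he, mul_one] at this
  linarith

theorem ellipseKernel_denom_ne_zero {y : ℝ} (hy : y ∈ Set.Icc (-1 : ℝ) 1) {w : ℂ} (hw : ‖w‖ < 1) :
    1 - 2 * (y : ℂ) * w + w ^ 2 ≠ 0 := by
  obtain ⟨e, he, hey⟩ := exists_unit_joukowski hy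
  rw [← hey, one_sub_two_mul_joukowski he]
  exact mul_ne_zero (one_sub_mul_ne_zero he hw)
    (one_sub_mul_ne_zero (by rw [norm_inv, he, inv_one]) hw)

theorem differentiableAt_ellipseKernel {y : ℝ} (hy : y ∈ Set.Icc (-1 : ℝ) 1) {w : ℂ}
    (hw : ‖w‖ < 1) : DifferentiableAt ℂ (ellipseKernel y) w := by
  have := ellipseKernel_denom_ne_zero hy hw
  unfold ellipseKernel
  fun_prop (disch := assumption)

theorem joukowski_sub {y w : ℂ} (hw : w ≠ 0) :
    joukowski w - y = (1 - 2 * y * w + w ^ 2) / (2 * w) := by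
  rw [joukowski]; field_simp; ring

theorem continuousOn_comp_joukowski {ρ t : ℝ} (hρ : 1 < ρ) (ht : ρ⁻¹ < t) (ht1 : t < 1)
    {G : ℂ → ℂ} (hG : DifferentiableOn ℂ G (bernsteinEllipse ρ)) :
    ContinuousOn (fun w => G (joukowski w)) (Metric.sphere 0 t) := by
  have hρ0 : 0 < ρ := by linarith
  have ht0 : 0 < t := (inv_pos.2 hρ0).trans ht
  intro w hw
  rw [mem_sphere_zero_iff_norm] at hw
  have hw0 : w ≠ 0 := norm_pos_iff.1 (by rw [hw]; exact ht0)
  have hmem : joukowski w ∈ bernsteinEllipse ρ :=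
    joukowski_mem_bernsteinEllipse (by rwa [hw]) (by rw [hw]; linarith)
  have := (hG.differentiableAt ((isOpen_bernsteinEllipse hρ).mem_nhds hmem)).comp w
    (differentiableAt_joukowski hw0)
  exact this.continuousAt.continuousWithinAt

theorem continuousOn_ellipseKernel {t : ℝ} (ht1 : t < 1) {y : ℝ} (hy : y ∈ Set.Icc (-1 : ℝ) 1) :
    ContinuousOn (ellipseKernel y) (Metric.sphere 0 t) := fun w hw =>
  (differentiableAt_ellipseKernel hy (by
    rw [mem_sphere_zero_iff_norm] at hw; linarith)).continuousAt.continuousWithinAt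

theorem circleAverage_ellipseKernel {t : ℝ} (ht0 : 0 < t) (ht1 : t < 1) {y : ℝ}
    (hy : y ∈ Set.Icc (-1 : ℝ) 1) : circleAverage (ellipseKernel y) 0 t = 1 := by
  rw [circleAverage_of_differentiable_on_off_countable Set.countable_empty]
  · simp [ellipseKernel]
  · intro z hz
    rw [mem_closedBall_zero_iff, abs_of_pos ht0] at hz
    exact (differentiableAt_ellipseKernel hy (by linarith)).continuousAt.continuousWithinAt
  · intro z hz
    have := hz.1
    rw [mem_ball_zero_iff, abs_of_pos ht0] at this
    exact differentiableAt_ellipseKernel hy (by linarith)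

/-- The kernel is `(w⁻¹ - w) / 2` divided by `J(w) - y`. Writing `G = G(y) + (z - y) dslope G y`
separates a multiple of the kernel, whose average is its value `1` at `0`, from a term to which
Cauchy's theorem applies. -/
theorem circleAverage_mul_ellipseKernel {ρ t : ℝ} (hρ : 1 < ρ) (ht : ρ⁻¹ < t) (ht1 : t < 1)
    {G : ℂ → ℂ} (hG : DifferentiableOn ℂ G (bernsteinEllipse ρ)) {y : ℝ}
    (hy : y ∈ Set.Icc (-1 : ℝ) 1) :
    circleAverage (fun w => G (joukowski w) * ellipseKernel y w) 0 t = G y := by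
  have hρ0 : 0 < ρ := by linarith
  have ht0 : 0 < t := (inv_pos.2 hρ0).trans ht
  have hmem := ofReal_mem_bernsteinEllipse hρ hy
  have hD : DifferentiableOn ℂ (dslope G y) (bernsteinEllipse ρ) :=
    (Complex.differentiableOn_dslope ((isOpen_bernsteinEllipse hρ).mem_nhds hmem)).2 hG
  have h0 := circleAverage_joukowski_mul_eq_zero hρ ht ht1 hD
  have hs : Set.EqOn (fun w => G (joukowski w) * ellipseKernel y w)
      (fun w => G y • ellipseKernel y w +
        (1 / 2 : ℂ) • (dslope G y (joukowski w) * (w⁻¹ - w))) (Metric.sphere 0 |t|) := by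
    intro w hw
    rw [mem_sphere_zero_iff_norm, abs_of_pos ht0] at hw
    have hw0 : w ≠ 0 := norm_pos_iff.1 (by rw [hw]; exact ht0)
    have h1 := sub_smul_dslope G (y : ℂ) (joukowski w)
    have h2 := ellipseKernel_denom_ne_zero hy (w := w) (by linarith)
    have h3 : G (joukowski w) = G y + (joukowski w - y) * dslope G y (joukowski w) := by
      rw [← smul_eq_mul, h1]; ring
    simp only [smul_eq_mul]
    rw [h3, add_mul, joukowski_sub hw0, ellipseKernel]
    generalize 1 - 2 * (y : ℂ) * w + w ^ 2 = Dn at h2 ⊢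
    field_simp
  have hc1 : CircleIntegrable (ellipseKernel y) 0 t :=
    (continuousOn_ellipseKernel ht1 hy).circleIntegrable ht0.le
  have hc2 : CircleIntegrable (fun w => dslope G y (joukowski w) * (w⁻¹ - w)) 0 t := by
    refine ContinuousOn.circleIntegrable ht0.le ((continuousOn_comp_joukowski hρ ht ht1 hD).mul ?_)
    refine (continuousOn_inv₀.mono fun w hw => ?_).sub continuousOn_id
    rw [mem_sphere_zero_iff_norm] at hw
    exact norm_pos_iff.1 (by rw [hw]; exact ht0)
  rw [circleAverage_congr_sphere hs, circleAverage_fun_add, circleAverage_fun_smul,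
    circleAverage_fun_smul, h0, circleAverage_ellipseKernel ht0 ht1 hy]
  · simp
  · exact hc1.const_smul
  · exact hc2.const_smul

end Bermudan

end

noncomputable section

namespace Bermudan

open Polynomial.Chebyshev Real Complex

/-! ### Mean squares on circles -/

theorem circleAverage_const_mul (a : ℝ) (f : ℂ → ℝ) (c : ℂ) (R : ℝ) :
    circleAverage (fun w => a * f w) c R = a * circleAverage f c R :=
  circleAverage_fun_smul (a := a)

theorem circleIntegrable_const_mul {f : ℂ → ℝ} {c : ℂ} {R : ℝ} (hf : CircleIntegrable f c R)
    (a : ℝ) : CircleIntegrable (fun w => a * f w) c R := hf.const_fun_smul (a := a)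

theorem circleAverage_sq_norm_sum (s : Finset ℕ) (p : ℕ → ℂ) (t : ℝ) :
    circleAverage (fun w => ‖∑ k ∈ s, p k * w ^ k‖ ^ 2) 0 t =
      ∑ k ∈ s, ‖p k‖ ^ 2 * t ^ (2 * k) := by
  set P : Polynomial ℂ := ∑ k ∈ s, Polynomial.monomial k (p k * (t : ℂ) ^ k) with hP
  have hc : ∀ i, P.coeff i = if i ∈ s then p i * (t : ℂ) ^ i else 0 := by
    intro i
    simp [hP, Polynomial.finsetSum_coeff, Polynomial.coeff_monomial]
  have h := P.sum_sq_norm_coeff_eq_circleAverage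
  have hs : ∑ i ∈ P.support, ‖P.coeff i‖ ^ 2 = ∑ k ∈ s, ‖p k‖ ^ 2 * t ^ (2 * k) := by
    have hsub : P.support ⊆ s := by
      intro i hi
      by_contra hns
      rw [Polynomial.mem_support_iff, hc, if_neg hns] at hi
      exact hi rfl
    rw [Finset.sum_subset hsub]
    · refine Finset.sum_congr rfl fun k hk => ?_
      rw [hc, if_pos hk, norm_mul, norm_pow, Complex.norm_real, mul_pow, ← pow_mul, mul_comm k 2,
        pow_mul ‖t‖, Real.norm_eq_abs, sq_abs, ← pow_mul]
    · intro i _ hi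
      rw [Polynomial.notMem_support_iff.1 hi]
      simp
  rw [← hs, h, circleAverage_eq_circleAverage_zero_one]
  congr 1
  ext w
  rw [hP, Polynomial.eval_finsetSum]
  congr 2
  refine Finset.sum_congr rfl fun k _ => ?_
  rw [Polynomial.eval_monomial, add_zero, mul_pow]
  ring

theorem one_sub_mul_pow_ne_zero {c w : ℂ} (hc : ‖c‖ = 1) (hw : ‖w‖ < 1) {N : ℕ} (hN : N ≠ 0) :
    1 - c * w ^ N ≠ 0 := by
  rw [mul_comm]
  exact one_sub_mul_ne_zero hc (by rw [norm_pow]; exact pow_lt_one₀ (norm_nonneg _) hw hN)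

/-- The numerator `P` has degree below `N`, so the blocks `P c^i w^{iN}` of the geometric series are
orthogonal. Concretely, the quotient satisfies `h = P + c w^N h`, and on the circle the cross term
`P̄ c w^N h` coincides with a holomorphic `R` vanishing at `0`, because `w̄ w = t²`. What remains is
a linear equation for the mean square of `h`. -/
theorem circleAverage_sq_norm_div {s : Finset ℕ} {N : ℕ} (hs : ∀ k ∈ s, k < N) (hN : N ≠ 0)
    (p : ℕ → ℂ) {c : ℂ} (hc : ‖c‖ = 1) {t : ℝ} (ht0 : 0 < t) (ht1 : t < 1) :
    circleAverage (fun w => ‖(∑ k ∈ s, p k * w ^ k) / (1 - c * w ^ N)‖ ^ 2) 0 t =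
      (∑ k ∈ s, ‖p k‖ ^ 2 * t ^ (2 * k)) / (1 - t ^ (2 * N)) := by
  set h : ℂ → ℂ := fun w => (∑ k ∈ s, p k * w ^ k) / (1 - c * w ^ N) with hh
  set R : ℂ → ℂ := fun w =>
    (∑ k ∈ s, (starRingEnd ℂ (p k) * (t : ℂ) ^ (2 * k)) * w ^ (N - k)) * c * h w with hR
  have hd : ∀ w : ℂ, ‖w‖ < 1 → DifferentiableAt ℂ h w := by
    intro w hw
    have := one_sub_mul_pow_ne_zero hc hw hN
    simp only [hh]
    fun_prop (disch := assumption)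
  have hdR : ∀ w : ℂ, ‖w‖ < 1 → DifferentiableAt ℂ R w := by
    intro w hw
    have := hd w hw
    simp only [hR]
    fun_prop
  have hR0 : circleAverage R 0 t = 0 := by
    rw [circleAverage_of_differentiable_on_off_countable Set.countable_empty]
    · simp only [hR]
      rw [Finset.sum_eq_zero, zero_mul, zero_mul]
      intro k hk
      rw [zero_pow (by have := hs k hk; omega), mul_zero]
    · intro z hz
      rw [mem_closedBall_zero_iff, abs_of_pos ht0] at hz
      exact (hdR z (by linarith)).continuousAt.continuousWithinAt
    · intro z hz
      have := hz.1
      rw [mem_ball_zero_iff, abs_of_pos ht0] at this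
      exact hdR z (by linarith)
  have hcont : ∀ f : ℂ → ℂ, (∀ w : ℂ, ‖w‖ < 1 → DifferentiableAt ℂ f w) →
      ContinuousOn f (Metric.sphere 0 t) := fun f hf w hw => by
    rw [mem_sphere_zero_iff_norm] at hw
    exact (hf w (by linarith)).continuousAt.continuousWithinAt
  have hiR : CircleIntegrable R 0 t := (hcont R hdR).circleIntegrable ht0.le
  have hih : CircleIntegrable (fun w => ‖h w‖ ^ 2) 0 t :=
    ((hcont h hd).norm.pow 2).circleIntegrable ht0.le
  have hiP : CircleIntegrable (fun w : ℂ => ‖∑ k ∈ s, p k * w ^ k‖ ^ 2) 0 t :=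
    Continuous.continuousOn (by fun_prop) |>.circleIntegrable ht0.le
  have hRre : circleAverage (fun w => (R w).re) 0 t = 0 := by
    have := ContinuousLinearMap.circleAverage_comp_comm Complex.reCLM hiR
    rw [hR0] at this
    simpa [Function.comp_def] using this
  have hiRre : CircleIntegrable (fun w => (R w).re) 0 t :=
    (Complex.continuous_re.comp_continuousOn (hcont R hdR)).circleIntegrable ht0.le
  have key : Set.EqOn (fun w => ‖h w‖ ^ 2) (fun w => (‖∑ k ∈ s, p k * w ^ k‖ ^ 2 +
      t ^ (2 * N) * ‖h w‖ ^ 2) + 2 * (R w).re) (Metric.sphere 0 |t|) := by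
    intro w hw
    rw [mem_sphere_zero_iff_norm, abs_of_pos ht0] at hw
    have hne := one_sub_mul_pow_ne_zero hc (w := w) (by linarith) hN
    set P := ∑ k ∈ s, p k * w ^ k with hP
    have h1 : h w = P + c * w ^ N * h w := by
      simp only [hh, ← hP]
      field_simp
      ring
    have hww : starRingEnd ℂ w * w = (t : ℂ) ^ 2 := by
      rw [mul_comm, Complex.mul_conj, Complex.normSq_eq_norm_sq, hw]
      push_cast
      rfl
    have h2 : R w = starRingEnd ℂ P * (c * w ^ N * h w) := by
      simp only [hR, hP, map_sum, map_mul, map_pow]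
      rw [← mul_assoc, ← mul_assoc]
      congr 1
      simp only [Finset.sum_mul]
      refine Finset.sum_congr rfl fun k hk => ?_
      have : w ^ N = w ^ k * w ^ (N - k) := by
        rw [← pow_add, Nat.add_sub_cancel' (hs k hk).le]
      rw [this, pow_mul, ← hww, mul_pow]
      ring
    have h3 : ‖c * w ^ N * h w‖ ^ 2 = t ^ (2 * N) * ‖h w‖ ^ 2 := by
      rw [norm_mul, norm_mul, hc, norm_pow, hw, mul_pow, one_mul, ← pow_mul, mul_comm N 2]
    have h4 : ‖P + c * w ^ N * h w‖ ^ 2 = ‖P‖ ^ 2 + ‖c * w ^ N * h w‖ ^ 2 + 2 * (R w).re := by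
      rw [h2, ← Complex.normSq_eq_norm_sq, ← Complex.normSq_eq_norm_sq,
        ← Complex.normSq_eq_norm_sq, Complex.normSq_add, ← Complex.conj_re (P * _),
        map_mul (starRingEnd ℂ) P, Complex.conj_conj]
    simp only
    rw [← h3, ← h4, ← h1]
  have hfin : circleAverage (fun w => ‖h w‖ ^ 2) 0 t =
      (∑ k ∈ s, ‖p k‖ ^ 2 * t ^ (2 * k)) + t ^ (2 * N) *
        circleAverage (fun w => ‖h w‖ ^ 2) 0 t := by
    conv_lhs => rw [circleAverage_congr_sphere key]
    have hih' := circleIntegrable_const_mul hih (t ^ (2 * N))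
    have hsum : CircleIntegrable (fun w => ‖∑ k ∈ s, p k * w ^ k‖ ^ 2 +
        t ^ (2 * N) * ‖h w‖ ^ 2) 0 t := hiP.add hih'
    rw [circleAverage_fun_add hsum (circleIntegrable_const_mul hiRre 2),
      circleAverage_fun_add hiP hih', circleAverage_const_mul, circleAverage_const_mul,
      hRre, circleAverage_sq_norm_sum, mul_zero, add_zero]
  have hlt : t ^ (2 * N) < 1 := pow_lt_one₀ ht0.le ht1 (by omega)
  rw [eq_div_iff (by linarith)]
  linarith

theorem norm_circleAverage_le_of_norm_le_mul {F f g : ℂ → ℂ} {t B a b : ℝ} (ht : 0 < t)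
    (hB : 0 ≤ B) (hf : ContinuousOn f (Metric.sphere 0 t)) (hg : ContinuousOn g (Metric.sphere 0 t))
    (hF : ∀ w ∈ Metric.sphere (0 : ℂ) t, ‖F w‖ ≤ B * (‖f w‖ * ‖g w‖))
    (ha : circleAverage (fun w => ‖f w‖ ^ 2) 0 t = a)
    (hb : circleAverage (fun w => ‖g w‖ ^ 2) 0 t = b) (ha0 : 0 < a) (hb0 : 0 < b) :
    ‖circleAverage F 0 t‖ ≤ B * √(a * b) := by
  -- This is Cauchy-Schwarz through `2 u v ≤ l u² + v² / l`, with the weight that makes the averages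
  -- of both terms equal.
  set l : ℝ := √(b / a) with hl
  have hl0 : 0 < l := Real.sqrt_pos.2 (by positivity)
  have hif : CircleIntegrable (fun w => ‖f w‖ ^ 2) 0 t := (hf.norm.pow 2).circleIntegrable ht.le
  have hig : CircleIntegrable (fun w => ‖g w‖ ^ 2) 0 t := (hg.norm.pow 2).circleIntegrable ht.le
  have hi : CircleIntegrable (fun w => B * l / 2 * ‖f w‖ ^ 2 + B / (2 * l) * ‖g w‖ ^ 2) 0 t :=
    (circleIntegrable_const_mul hif _).add (circleIntegrable_const_mul hig _)
  have h1 : ‖circleAverage F 0 t‖ ≤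
      circleAverage (fun w => B * l / 2 * ‖f w‖ ^ 2 + B / (2 * l) * ‖g w‖ ^ 2) 0 t := by
    rw [circleAverage, circleAverage, norm_smul, Real.norm_of_nonneg (by positivity), smul_eq_mul]
    gcongr
    refine intervalIntegral.norm_integral_le_of_norm_le (by positivity)
      (Filter.Eventually.of_forall fun θ _ => ?_) hi
    refine (hF _ (circleMap_mem_sphere _ ht.le _)).trans ?_
    generalize ‖f (circleMap 0 t θ)‖ = u
    generalize ‖g (circleMap 0 t θ)‖ = v
    have : B * l / 2 * u ^ 2 + B / (2 * l) * v ^ 2 - B * (u * v) =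
        B / (2 * l) * (l * u - v) ^ 2 := by field_simp; ring
    have h2 : 0 ≤ B / (2 * l) * (l * u - v) ^ 2 := by positivity
    linarith
  refine h1.trans (le_of_eq ?_)
  rw [circleAverage_fun_add (circleIntegrable_const_mul hif _) (circleIntegrable_const_mul hig _),
    circleAverage_const_mul, circleAverage_const_mul, ha, hb]
  have hsa : √a ^ 2 = a := Real.sq_sqrt ha0.le
  have hsb : √b ^ 2 = b := Real.sq_sqrt hb0.le
  have h3 : 0 < √a := Real.sqrt_pos.2 ha0
  have h4 : 0 < √b := Real.sqrt_pos.2 hb0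
  rw [hl, Real.sqrt_div' _ ha0.le, Real.sqrt_mul ha0.le]
  nth_rw 2 [← hsa]
  nth_rw 3 [← hsb]
  field_simp
  ring

/-! ### Interpolation on Bernstein ellipses in one variable -/

section Unit

variable {e w : ℂ}

/-- The partial fractions have one simple pole each, so that each half factors into functions of
known mean square. -/
theorem ellipseKernel_joukowski (he : ‖e‖ = 1) (hw : ‖w‖ < 1) :
    ellipseKernel (joukowski e) w =
      1 / 2 * ((1 + w * e) / (1 - w * e) + (1 + w * e⁻¹) / (1 - w * e⁻¹)) := by
  have he0 : e ≠ 0 := norm_ne_zero_iff.1 (by rw [he]; norm_num)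
  have h1 := one_sub_mul_ne_zero he hw
  have h2 := one_sub_mul_ne_zero (e := e⁻¹) (by rw [norm_inv, he, inv_one]) hw
  rw [ellipseKernel, one_sub_two_mul_joukowski he, div_add_div _ _ h1 h2, one_div_mul_eq_div,
    div_div, div_eq_div_iff (mul_ne_zero h1 h2)
    (mul_ne_zero (mul_ne_zero h1 h2) two_ne_zero)]
  have : e * e⁻¹ = 1 := mul_inv_cancel₀ he0
  linear_combination (2 * w ^ 2 * (1 - w * e) * (1 - w * e⁻¹)) * this

theorem one_add_pow_ne_zero (hw : ‖w‖ < 1) {n : ℕ} (hn : n ≠ 0) : 1 + w ^ (2 * n) ≠ 0 := by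
  have := one_sub_mul_pow_ne_zero (c := -1) (by simp) hw (N := 2 * n) (by omega)
  simpa using this

theorem eval_T_ratio (he : ‖e‖ = 1) (hw0 : w ≠ 0) (hw : ‖w‖ < 1) {n : ℕ} (hn : n ≠ 0) :
    (T ℂ (n : ℤ)).eval (joukowski e) / (T ℂ (n : ℤ)).eval (joukowski w) =
      (e ^ n + (e⁻¹) ^ n) * w ^ n / (1 + w ^ (2 * n)) := by
  have he0 : e ≠ 0 := norm_ne_zero_iff.1 (by rw [he]; norm_num)
  have h := one_add_pow_ne_zero hw hn
  rw [eval_T_joukowski n he0, eval_T_joukowski n hw0, joukowski, joukowski]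
  have h2 : w ^ n + (w ^ n)⁻¹ = (1 + w ^ (2 * n)) / w ^ n := by
    field_simp
    ring
  rw [h2, inv_pow]
  field_simp

theorem sum_chebKernel_mul_ellipseKernel (m : ℕ) {x : ℝ} (he : ‖e‖ = 1) (hx : joukowski e = x)
    (hxI : x ∈ Set.Icc (-1 : ℝ) 1) (hw0 : w ≠ 0) (hw : ‖w‖ < 1) :
    ∑ j, (chebKernel m x j : ℂ) * ellipseKernel (chebNode m j) w =
      ellipseKernel x w *
        (1 - (e ^ (m + 1) + (e⁻¹) ^ (m + 1)) * w ^ (m + 1) / (1 + w ^ (2 * (m + 1)))) := by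
  have hk : ∀ y : ℝ, y ∈ Set.Icc (-1 : ℝ) 1 → joukowski w ≠ y ∧
      ellipseKernel y w = (w⁻¹ - w) / 2 * (joukowski w - y)⁻¹ := by
    intro y hy
    have h1 := ellipseKernel_denom_ne_zero hy hw
    have h2 := joukowski_sub (y := y) hw0
    refine ⟨sub_ne_zero.1 (by rw [h2]; exact div_ne_zero h1 (mul_ne_zero two_ne_zero hw0)), ?_⟩
    rw [h2, ellipseKernel]
    generalize 1 - 2 * (y : ℂ) * w + w ^ 2 = Dn at h1 ⊢
    field_simp
  have hnode : ∀ j, chebNode m j ∈ Set.Icc (-1 : ℝ) 1 := fun j =>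
    ⟨Real.neg_one_le_cos _, Real.cos_le_one _⟩
  have hT : (T ℂ ((m + 1 : ℕ) : ℤ)).eval (joukowski w) ≠ 0 := by
    rw [eval_T_joukowski _ hw0, joukowski]
    have h := one_add_pow_ne_zero hw (n := m + 1) (by simp)
    have h2 : w ^ (m + 1) + (w ^ (m + 1))⁻¹ = (1 + w ^ (2 * (m + 1))) / w ^ (m + 1) := by
      field_simp
      ring
    rw [h2]
    exact div_ne_zero (div_ne_zero h (pow_ne_zero _ hw0)) two_ne_zero
  have h := sum_chebKernel_mul_inv m x (hk x hxI).1 (fun j => (hk _ (hnode j)).1) hT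
  rw [← hx, eval_T_ratio he hw0 hw (by simp), hx] at h
  rw [(hk x hxI).2, mul_assoc, ← h, Finset.mul_sum]
  refine Finset.sum_congr rfl fun j _ => ?_
  rw [(hk _ (hnode j)).2]
  ring

end Unit

end Bermudan

end

/-! ### Contour bounds for the interpolant and its error in one variable -/

noncomputable section

namespace Bermudan

open Polynomial.Chebyshev Real Complex

theorem norm_circleAverage_half_add_le {H f₁ g₁ f₂ g₂ : ℂ → ℂ} {t B a b : ℝ} (ht : 0 < t)
    (hB : ∀ w ∈ Metric.sphere (0 : ℂ) t, ‖H w‖ ≤ B) (hH : ContinuousOn H (Metric.sphere 0 t))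
    (hf₁ : ContinuousOn f₁ (Metric.sphere 0 t)) (hg₁ : ContinuousOn g₁ (Metric.sphere 0 t))
    (hf₂ : ContinuousOn f₂ (Metric.sphere 0 t)) (hg₂ : ContinuousOn g₂ (Metric.sphere 0 t))
    (ha₁ : circleAverage (fun w => ‖f₁ w‖ ^ 2) 0 t = a)
    (hb₁ : circleAverage (fun w => ‖g₁ w‖ ^ 2) 0 t = b)
    (ha₂ : circleAverage (fun w => ‖f₂ w‖ ^ 2) 0 t = a)
    (hb₂ : circleAverage (fun w => ‖g₂ w‖ ^ 2) 0 t = b) (ha : 0 < a) (hb : 0 < b) :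
    ‖circleAverage (fun w => H w * (1 / 2 * (f₁ w * g₁ w + f₂ w * g₂ w))) 0 t‖ ≤
      B * √(a * b) := by
  have hB0 : 0 ≤ B := (norm_nonneg _).trans (hB (t : ℂ) (by simp [abs_of_pos ht]))
  have hle : ∀ f g : ℂ → ℂ, ∀ w ∈ Metric.sphere (0 : ℂ) t,
      ‖H w * (f w * g w)‖ ≤ B * (‖f w‖ * ‖g w‖) := by
    intro f g w hw
    rw [norm_mul, norm_mul]
    gcongr
    exact hB w hw
  have h1 := norm_circleAverage_le_of_norm_le_mul ht hB0 hf₁ hg₁ (hle f₁ g₁) ha₁ hb₁ ha hb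
  have h2 := norm_circleAverage_le_of_norm_le_mul ht hB0 hf₂ hg₂ (hle f₂ g₂) ha₂ hb₂ ha hb
  have hi1 : CircleIntegrable (fun w => H w * (f₁ w * g₁ w)) 0 t :=
    (hH.mul (hf₁.mul hg₁)).circleIntegrable ht.le
  have hi2 : CircleIntegrable (fun w => H w * (f₂ w * g₂ w)) 0 t :=
    (hH.mul (hf₂.mul hg₂)).circleIntegrable ht.le
  have h3 : circleAverage (fun w => H w * (1 / 2 * (f₁ w * g₁ w + f₂ w * g₂ w))) 0 t =
      (1 / 2 : ℂ) • (circleAverage (fun w => H w * (f₁ w * g₁ w)) 0 t +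
        circleAverage (fun w => H w * (f₂ w * g₂ w)) 0 t) := by
    rw [← circleAverage_fun_add hi1 hi2, ← circleAverage_fun_smul]
    congr 1
    ext w
    rw [smul_eq_mul]
    ring
  rw [h3, norm_smul]
  have h4 := norm_add_le (circleAverage (fun w => H w * (f₁ w * g₁ w)) 0 t)
    (circleAverage (fun w => H w * (f₂ w * g₂ w)) 0 t)
  have h5 : ‖(1 / 2 : ℂ)‖ = 1 / 2 := by simp
  rw [h5]
  linarith

section OneVariable

variable {ρ : ℝ} {G : ℂ → ℂ} {m : ℕ} {x : ℝ}

theorem sum_chebKernel_mul_eq_circleAverage {t : ℝ} (hρ : 1 < ρ) (ht : ρ⁻¹ < t) (ht1 : t < 1)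
    (hG : DifferentiableOn ℂ G (bernsteinEllipse ρ)) :
    ∑ j, (chebKernel m x j : ℂ) * G (chebNode m j) = circleAverage (fun w => G (joukowski w) *
      ∑ j, (chebKernel m x j : ℂ) * ellipseKernel (chebNode m j) w) 0 t := by
  have ht0 : 0 < t := (inv_pos.2 (by linarith)).trans ht
  have hnode : ∀ j, chebNode m j ∈ Set.Icc (-1 : ℝ) 1 := fun j =>
    ⟨Real.neg_one_le_cos _, Real.cos_le_one _⟩
  have hi : ∀ j, CircleIntegrable (fun w => G (joukowski w) * ellipseKernel (chebNode m j) w) 0 t :=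
    fun j => ((continuousOn_comp_joukowski hρ ht ht1 hG).mul
      (continuousOn_ellipseKernel ht1 (hnode j))).circleIntegrable ht0.le
  have h1 : ∀ j, (chebKernel m x j : ℂ) * G (chebNode m j) = circleAverage (fun w =>
      (chebKernel m x j : ℂ) • (G (joukowski w) * ellipseKernel (chebNode m j) w)) 0 t := by
    intro j
    rw [circleAverage_fun_smul, circleAverage_mul_ellipseKernel hρ ht ht1 hG (hnode j), smul_eq_mul]
  rw [Finset.sum_congr rfl fun j _ => h1 j,
    ← circleAverage_fun_sum fun j _ => (hi j).const_fun_smul]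
  congr 1
  ext w
  rw [Finset.mul_sum]
  refine Finset.sum_congr rfl fun j _ => ?_
  rw [smul_eq_mul]
  ring

theorem norm_comp_joukowski_le {B t : ℝ} (ht : ρ⁻¹ < t) (htρ : t < ρ)
    (hB : ∀ z ∈ bernsteinEllipse ρ, ‖G z‖ ≤ B) {w : ℂ} (hw : w ∈ Metric.sphere (0 : ℂ) t) :
    ‖G (joukowski w)‖ ≤ B := by
  rw [mem_sphere_zero_iff_norm] at hw
  exact hB _ (joukowski_mem_bernsteinEllipse (by rwa [hw]) (by rwa [hw]))

theorem sq_norm_sum_geom {e : ℂ} (he : ‖e‖ = 1) {t : ℝ} (ht1 : t ^ 2 < 1) (n : ℕ) :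
    circleAverage (fun w => ‖∑ k ∈ Finset.range n, e ^ k * w ^ k‖ ^ 2) 0 t =
      (1 - (t ^ 2) ^ n) / (1 - t ^ 2) := by
  rw [circleAverage_sq_norm_sum]
  have : ∀ k ∈ Finset.range n, ‖e ^ k‖ ^ 2 * t ^ (2 * k) = (t ^ 2) ^ k := by
    intro k _
    rw [norm_pow, he, one_pow, one_pow, one_mul, pow_mul]
  rw [Finset.sum_congr rfl this, geom_sum_eq (by linarith), ← neg_div_neg_eq, neg_sub, neg_sub]

/-- For `u = e` and `v = e⁻¹`, or the reverse, the half kernel is `f g` with `f = (1 - (u w)^n) / (1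
- u w)`, a geometric polynomial, and `g = (1 + u w) (1 - (v w)^n) / (1 + w^{2n})`. The factor `1 -
t^{2n}` appears in the mean square of `f` and, inverted, in that of `g`. It cancels, which makes the
bound independent of the degree. -/
theorem norm_sum_chebKernel_mul_le_aux (hm : 1 ≤ m) {t B : ℝ} (hρ : 1 < ρ) (ht : ρ⁻¹ < t)
    (ht1 : t < 1) (hG : DifferentiableOn ℂ G (bernsteinEllipse ρ))
    (hB : ∀ z ∈ bernsteinEllipse ρ, ‖G z‖ ≤ B) (hx : x ∈ Set.Icc (-1 : ℝ) 1) :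
    ‖∑ j, (chebKernel m x j : ℂ) * G (chebNode m j)‖ ≤
      B * √((1 + t ^ 2) / (1 - t ^ 2)) := by
  have ht0 : 0 < t := (inv_pos.2 (by linarith)).trans ht
  obtain ⟨e, he, hex⟩ := exists_unit_joukowski hx
  have he' : ‖e⁻¹‖ = 1 := by rw [norm_inv, he, inv_one]
  have he0 : e ≠ 0 := norm_ne_zero_iff.1 (by rw [he]; norm_num)
  have hee : e * e⁻¹ = 1 := mul_inv_cancel₀ he0
  set n := m + 1 with hn
  have hn0 : n ≠ 0 := by omega
  -- From `m ≥ 1`: the exponents `0, 1, n, n + 1` of the numerator of `g` must be distinct for its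
  -- mean square to be read off.
  have hn1 : n ≠ 1 := by omega
  set p : ℂ → ℂ → ℕ → ℂ := fun u v k => if k = 0 then 1 else if k = 1 then u else if k = n
    then -v ^ n else -(u * v ^ n) with hp
  set s : Finset ℕ := {0, 1, n, n + 1} with hs
  set f : ℂ → ℂ → ℂ := fun u w => ∑ k ∈ Finset.range n, u ^ k * w ^ k with hf
  set g : ℂ → ℂ → ℂ → ℂ := fun u v w =>
    (∑ k ∈ s, p u v k * w ^ k) / (1 - (-1) * w ^ (2 * n)) with hg
  have hq1 : t ^ 2 < 1 := pow_lt_one₀ ht0.le ht1 (by norm_num)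
  have hqn : (t ^ 2) ^ n < 1 := pow_lt_one₀ (by positivity) hq1 (by omega)
  have hsum : ∀ F : ℕ → ℂ, ∑ k ∈ s, F k = F 0 + F 1 + F n + F (n + 1) := by
    intro F
    rw [hs, Finset.sum_insert (by simp [hn]), Finset.sum_insert (by simp; omega),
      Finset.sum_insert (by simp), Finset.sum_singleton]
    ring
  have hsumR : ∀ F : ℕ → ℝ, ∑ k ∈ s, F k = F 0 + F 1 + F n + F (n + 1) := by
    intro F
    rw [hs, Finset.sum_insert (by simp [hn]), Finset.sum_insert (by simp; omega),
      Finset.sum_insert (by simp), Finset.sum_singleton]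
    ring
  have hfa : ∀ u : ℂ, ‖u‖ = 1 → circleAverage (fun w => ‖f u w‖ ^ 2) 0 t =
      (1 - (t ^ 2) ^ n) / (1 - t ^ 2) := fun u hu => sq_norm_sum_geom hu hq1 n
  have hga : ∀ u v : ℂ, ‖u‖ = 1 → ‖v‖ = 1 → circleAverage (fun w => ‖g u v w‖ ^ 2) 0 t =
      (1 + t ^ 2) / (1 - (t ^ 2) ^ n) := by
    intro u v hu hv
    rw [hg, circleAverage_sq_norm_div (N := 2 * n) (by simp [hs]; omega) (by omega) _ (by simp)
      ht0 ht1, hsumR]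
    have h1 : t ^ (2 * (2 * n)) = (t ^ 2) ^ n * (t ^ 2) ^ n := by ring
    have h2 : t ^ (2 * n) = (t ^ 2) ^ n := by ring
    have h3 : t ^ (2 * (n + 1)) = (t ^ 2) ^ n * t ^ 2 := by ring
    have hnorm : ‖p u v 0‖ = 1 ∧ ‖p u v 1‖ = 1 ∧ ‖p u v n‖ = 1 ∧ ‖p u v (n + 1)‖ = 1 := by
      simp [hp, hn0, hn1, hu, hv]
    rw [hnorm.1, hnorm.2.1, hnorm.2.2.1, hnorm.2.2.2, h1, h2, h3]
    have hQ : 0 ≤ (t ^ 2) ^ n := by positivity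
    generalize (t ^ 2) ^ n = Q at hqn hQ ⊢
    have h4 : 1 - Q ≠ 0 := by linarith
    have h6 : 1 - Q * Q ≠ 0 := by nlinarith
    rw [div_eq_div_iff h6 h4]
    ring
  have hcf : ∀ u : ℂ, ContinuousOn (f u) (Metric.sphere 0 t) := fun u =>
    Continuous.continuousOn (by simp only [hf]; fun_prop)
  have hden : ∀ w ∈ Metric.sphere (0 : ℂ) t, 1 - (-1) * w ^ (2 * n) ≠ 0 := by
    intro w hw
    rw [mem_sphere_zero_iff_norm] at hw
    exact one_sub_mul_pow_ne_zero (by simp) (by linarith) (by omega)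
  have hcg : ∀ u v : ℂ, ContinuousOn (g u v) (Metric.sphere 0 t) := fun u v =>
    ContinuousOn.div (by fun_prop) (by fun_prop) hden
  have hpos1 : 0 < (1 - (t ^ 2) ^ n) / (1 - t ^ 2) := div_pos (by linarith) (by linarith)
  have hpos2 : 0 < (1 + t ^ 2) / (1 - (t ^ 2) ^ n) := div_pos (by positivity) (by linarith)
  have hfg : ∀ u v w : ℂ, ‖u‖ = 1 → u * v = 1 → ‖w‖ = t → f u w * g u v w =
      (1 + w * u) / (1 - w * u) *
        (1 - (u ^ n + v ^ n) * w ^ n / (1 + w ^ (2 * n))) := by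
    intro u v w hu huv hw
    have h1 := one_sub_mul_ne_zero (w := w) hu (by linarith)
    have h2 := one_add_pow_ne_zero (w := w) (by linarith) hn0
    have h3 : f u w = (1 - (w * u) ^ n) / (1 - w * u) := by
      rw [eq_div_iff h1, ← geom_sum_mul_neg]
      simp only [hf]
      congr 1
      exact Finset.sum_congr rfl fun k _ => by rw [mul_pow, mul_comm]
    have h4 : g u v w = (1 + w * u) * (1 - (w * v) ^ n) / (1 + w ^ (2 * n)) := by
      simp only [hg]
      rw [hsum, neg_one_mul, sub_neg_eq_add]
      simp only [hp, hn0, hn1, if_true, if_false, Nat.add_eq_zero_iff, one_ne_zero, and_false,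
        Nat.add_eq_right, Nat.add_eq_left]
      congr 1
      ring
    have h5 : u ^ n * v ^ n = 1 := by rw [← mul_pow, huv, one_pow]
    have h6 : 1 - (u ^ n + v ^ n) * w ^ n / (1 + w ^ (2 * n)) =
        (1 - (w * u) ^ n) * (1 - (w * v) ^ n) / (1 + w ^ (2 * n)) := by
      rw [eq_div_iff h2, sub_mul, div_mul_cancel₀ _ h2]
      linear_combination (-w ^ (2 * n)) * h5
    rw [h3, h4, h6]
    ring
  have htρ : t < ρ := by linarith
  have hmain := norm_circleAverage_half_add_le ht0 (fun w hw => norm_comp_joukowski_le ht htρ hB hw)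
    (continuousOn_comp_joukowski hρ ht ht1 hG) (hcf e) (hcg e e⁻¹) (hcf e⁻¹) (hcg e⁻¹ e)
    (hfa e he) (hga e e⁻¹ he he') (hfa e⁻¹ he') (hga e⁻¹ e he' he) hpos1 hpos2
  have hab : (1 - (t ^ 2) ^ n) / (1 - t ^ 2) * ((1 + t ^ 2) / (1 - (t ^ 2) ^ n)) =
      (1 + t ^ 2) / (1 - t ^ 2) := by
    have : 1 - (t ^ 2) ^ n ≠ 0 := by linarith
    have : 1 - t ^ 2 ≠ 0 := by linarith
    field_simp
  rw [hab] at hmain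
  rw [sum_chebKernel_mul_eq_circleAverage hρ ht ht1 hG]
  refine (le_of_eq ?_).trans hmain
  congr 1
  refine circleAverage_congr_sphere fun w hw => ?_
  rw [mem_sphere_zero_iff_norm, abs_of_pos ht0] at hw
  have hw0 : w ≠ 0 := norm_pos_iff.1 (by rw [hw]; exact ht0)
  rw [sum_chebKernel_mul_ellipseKernel m he hex hx hw0 (by linarith), ← hex,
    ellipseKernel_joukowski he (by linarith), hfg e e⁻¹ w he hee hw,
    hfg e⁻¹ e w he' (by rw [mul_comm, hee]) hw]
  ring

/-- The error kernel contains `(e^n + e^{-n}) w^n`, of modulus at most `2 t^n`. It is absorbed in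
the bounded factor, and Cauchy-Schwarz is applied to `1 / (1 - u w)` and `(1 + u w) / (1 + w^{2n})`.
-/
theorem norm_sub_sum_chebKernel_mul_le_aux {t B : ℝ} (hρ : 1 < ρ) (ht : ρ⁻¹ < t)
    (ht1 : t < 1) (hG : DifferentiableOn ℂ G (bernsteinEllipse ρ))
    (hB : ∀ z ∈ bernsteinEllipse ρ, ‖G z‖ ≤ B) (hx : x ∈ Set.Icc (-1 : ℝ) 1) :
    ‖G x - ∑ j, (chebKernel m x j : ℂ) * G (chebNode m j)‖ ≤
      B * (2 * t ^ (m + 1)) * √(1 / (1 - t ^ 2) * ((1 + t ^ 2) / (1 - (t ^ 2) ^ (2 * (m + 1))))) := by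
  have ht0 : 0 < t := (inv_pos.2 (by linarith)).trans ht
  obtain ⟨e, he, hex⟩ := exists_unit_joukowski hx
  have he' : ‖e⁻¹‖ = 1 := by rw [norm_inv, he, inv_one]
  have he0 : e ≠ 0 := norm_ne_zero_iff.1 (by rw [he]; norm_num)
  set n := m + 1 with hn
  have hn0 : n ≠ 0 := by omega
  set f : ℂ → ℂ → ℂ := fun u w =>
    (∑ k ∈ Finset.range 1, 1 * w ^ k) / (1 - u * w ^ 1) with hf
  set g : ℂ → ℂ → ℂ := fun u w =>
    (∑ k ∈ Finset.range 2, u ^ k * w ^ k) / (1 - (-1) * w ^ (2 * n)) with hg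
  have hq1 : t ^ 2 < 1 := pow_lt_one₀ ht0.le ht1 (by norm_num)
  have hqn : (t ^ 2) ^ (2 * n) < 1 := pow_lt_one₀ (by positivity) hq1 (by omega)
  have hfa : ∀ u : ℂ, ‖u‖ = 1 → circleAverage (fun w => ‖f u w‖ ^ 2) 0 t = 1 / (1 - t ^ 2) := by
    intro u hu
    rw [hf, circleAverage_sq_norm_div (N := 1) (by simp) (by omega) (fun _ => 1) hu ht0 ht1]
    simp
  have hga : ∀ u : ℂ, ‖u‖ = 1 → circleAverage (fun w => ‖g u w‖ ^ 2) 0 t =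
      (1 + t ^ 2) / (1 - (t ^ 2) ^ (2 * n)) := by
    intro u hu
    rw [hg, circleAverage_sq_norm_div (N := 2 * n) (by simp; omega) (by omega) (fun k => u ^ k)
      (by simp) ht0 ht1, pow_mul t 2 (2 * n)]
    simp [Finset.sum_range_succ, hu]
  have hcf : ∀ u : ℂ, ‖u‖ = 1 → ContinuousOn (f u) (Metric.sphere 0 t) := fun u hu =>
    ContinuousOn.div (by fun_prop) (by fun_prop) fun w hw => by
      rw [mem_sphere_zero_iff_norm] at hw
      exact one_sub_mul_pow_ne_zero hu (by linarith) (by omega)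
  have hcg : ∀ u : ℂ, ContinuousOn (g u) (Metric.sphere 0 t) := fun u =>
    ContinuousOn.div (by fun_prop) (by fun_prop) fun w hw => by
      rw [mem_sphere_zero_iff_norm] at hw
      exact one_sub_mul_pow_ne_zero (by simp) (by linarith) (by omega)
  have hfg : ∀ u w : ℂ, ‖w‖ = t → f u w * g u w =
      (1 + w * u) / (1 - w * u) / (1 + w ^ (2 * n)) := by
    intro u w hw
    simp only [hf, hg, Finset.sum_range_succ, Finset.sum_range_zero]
    rw [neg_one_mul, sub_neg_eq_add]
    ring
  have htρ : t < ρ := by linarith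
  have hpos1 : 0 < 1 / (1 - t ^ 2) := div_pos one_pos (by linarith)
  have hpos2 : 0 < (1 + t ^ 2) / (1 - (t ^ 2) ^ (2 * n)) := div_pos (by positivity) (by linarith)
  have hH : ∀ w ∈ Metric.sphere (0 : ℂ) t,
      ‖G (joukowski w) * ((e ^ n + e⁻¹ ^ n) * w ^ n)‖ ≤ B * (2 * t ^ n) := by
    intro w hw
    have h1 := norm_comp_joukowski_le ht htρ hB hw
    rw [mem_sphere_zero_iff_norm] at hw
    rw [norm_mul, norm_mul, norm_pow, hw]
    have h2 : ‖e ^ n + e⁻¹ ^ n‖ ≤ 2 := by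
      refine (norm_add_le _ _).trans ?_
      rw [norm_pow, norm_pow, he, he', one_pow]
      norm_num
    have hB0 : 0 ≤ B := (norm_nonneg _).trans h1
    gcongr
  have hmain := norm_circleAverage_half_add_le ht0 hH
    ((continuousOn_comp_joukowski hρ ht ht1 hG).mul (by fun_prop)) (hcf e he) (hcg e)
    (hcf e⁻¹ he') (hcg e⁻¹) (hfa e he) (hga e he) (hfa e⁻¹ he') (hga e⁻¹ he') hpos1 hpos2
  have hnode : ∀ j, chebNode m j ∈ Set.Icc (-1 : ℝ) 1 := fun j =>
    ⟨Real.neg_one_le_cos _, Real.cos_le_one _⟩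
  have hi1 : CircleIntegrable (fun w => G (joukowski w) * ellipseKernel x w) 0 t :=
    ((continuousOn_comp_joukowski hρ ht ht1 hG).mul
      (continuousOn_ellipseKernel ht1 hx)).circleIntegrable ht0.le
  have hi2 : CircleIntegrable (fun w => G (joukowski w) *
      ∑ j, (chebKernel m x j : ℂ) * ellipseKernel (chebNode m j) w) 0 t :=
    ((continuousOn_comp_joukowski hρ ht ht1 hG).mul (continuousOn_finsetSum _ fun j _ =>
      continuousOn_const.mul (continuousOn_ellipseKernel ht1 (hnode j)))).circleIntegrable ht0.le
  rw [sum_chebKernel_mul_eq_circleAverage hρ ht ht1 hG,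
    ← circleAverage_mul_ellipseKernel hρ ht ht1 hG hx, ← circleAverage_fun_sub hi1 hi2]
  refine (le_of_eq ?_).trans hmain
  congr 1
  refine circleAverage_congr_sphere fun w hw => ?_
  rw [mem_sphere_zero_iff_norm, abs_of_pos ht0] at hw
  have hw0 : w ≠ 0 := norm_pos_iff.1 (by rw [hw]; exact ht0)
  rw [sum_chebKernel_mul_ellipseKernel m he hex hx hw0 (by linarith), ← hex,
    ellipseKernel_joukowski he (by linarith), hfg e w hw, hfg e⁻¹ w hw]
  ring

/-- The circle of radius `ρ⁻¹` is mapped to the boundary of the ellipse, where nothing is known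
about `G`; the bounds reach it only as limits. -/
theorem le_of_forall_inv_lt (hρ : 1 < ρ) {A : ℝ} {φ : ℝ → ℝ} (hφ : ContinuousAt φ ρ⁻¹)
    (h : ∀ t, ρ⁻¹ < t → t < 1 → A ≤ φ t) : A ≤ φ ρ⁻¹ := by
  have h1 : ρ⁻¹ < 1 := inv_lt_one_of_one_lt₀ hρ
  refine ge_of_tendsto (hφ.tendsto.mono_left nhdsWithin_le_nhds : Filter.Tendsto φ
    (nhdsWithin ρ⁻¹ (Set.Ioi ρ⁻¹)) (nhds (φ ρ⁻¹))) ?_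
  filter_upwards [Ioo_mem_nhdsGT h1] with t ht using h t ht.1 ht.2

theorem norm_sum_chebKernel_mul_le (hm : 1 ≤ m) {B : ℝ} (hρ : 1 < ρ)
    (hG : DifferentiableOn ℂ G (bernsteinEllipse ρ))
    (hB : ∀ z ∈ bernsteinEllipse ρ, ‖G z‖ ≤ B) (hx : x ∈ Set.Icc (-1 : ℝ) 1) :
    ‖∑ j, (chebKernel m x j : ℂ) * G (chebNode m j)‖ ≤
      B * √((1 + ρ⁻¹ ^ 2) / (1 - ρ⁻¹ ^ 2)) := by
  have h0 : 0 < ρ⁻¹ := inv_pos.2 (by linarith)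
  have hq : ρ⁻¹ ^ 2 < 1 := pow_lt_one₀ h0.le (inv_lt_one_of_one_lt₀ hρ) (by norm_num)
  have hne : 1 - ρ⁻¹ ^ 2 ≠ 0 := by linarith
  refine le_of_forall_inv_lt hρ (φ := fun t => B * √((1 + t ^ 2) / (1 - t ^ 2))) ?_
    fun t ht ht1 => norm_sum_chebKernel_mul_le_aux hm hρ ht ht1 hG hB hx
  fun_prop (disch := assumption)

theorem norm_sub_sum_chebKernel_mul_le_of_circle {B : ℝ} (hρ : 1 < ρ)
    (hG : DifferentiableOn ℂ G (bernsteinEllipse ρ))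
    (hB : ∀ z ∈ bernsteinEllipse ρ, ‖G z‖ ≤ B) (hx : x ∈ Set.Icc (-1 : ℝ) 1) :
    ‖G x - ∑ j, (chebKernel m x j : ℂ) * G (chebNode m j)‖ ≤
      B * (2 * ρ⁻¹ ^ (m + 1)) *
        √(1 / (1 - ρ⁻¹ ^ 2) * ((1 + ρ⁻¹ ^ 2) / (1 - (ρ⁻¹ ^ 2) ^ (2 * (m + 1))))) := by
  have h0 : 0 < ρ⁻¹ := inv_pos.2 (by linarith)
  have hq : ρ⁻¹ ^ 2 < 1 := pow_lt_one₀ h0.le (inv_lt_one_of_one_lt₀ hρ) (by norm_num)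
  have hne : 1 - ρ⁻¹ ^ 2 ≠ 0 := by linarith
  have hqn : (ρ⁻¹ ^ 2) ^ (2 * (m + 1)) < 1 := pow_lt_one₀ (by positivity) hq (by omega)
  have hne' : 1 - (ρ⁻¹ ^ 2) ^ (2 * (m + 1)) ≠ 0 := by linarith
  refine le_of_forall_inv_lt hρ (φ := fun t => B * (2 * t ^ (m + 1)) *
      √(1 / (1 - t ^ 2) * ((1 + t ^ 2) / (1 - (t ^ 2) ^ (2 * (m + 1)))))) ?_
    fun t ht ht1 => norm_sub_sum_chebKernel_mul_le_aux hρ ht ht1 hG hB hx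
  fun_prop (disch := assumption)

theorem norm_sub_sum_chebKernel_mul_le_of_lebesgue (hm : 1 ≤ m) {B : ℝ} (hρ : 1 < ρ)
    (hB : ∀ z ∈ bernsteinEllipse ρ, ‖G z‖ ≤ B) (hx : x ∈ Set.Icc (-1 : ℝ) 1) :
    ‖G x - ∑ j, (chebKernel m x j : ℂ) * G (chebNode m j)‖ ≤
      B * (2 + 2 / Real.pi * Real.log ((m : ℝ) + 1)) := by
  have hnode : ∀ j, chebNode m j ∈ Set.Icc (-1 : ℝ) 1 := fun j =>
    ⟨Real.neg_one_le_cos _, Real.cos_le_one _⟩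
  have h1 := hB x (ofReal_mem_bernsteinEllipse hρ hx)
  have hB0 : 0 ≤ B := (norm_nonneg _).trans h1
  have h2 : ‖∑ j, (chebKernel m x j : ℂ) * G (chebNode m j)‖ ≤
      B * (2 / Real.pi * Real.log ((m : ℝ) + 1) + 1) := by
    calc _ ≤ ∑ j, ‖(chebKernel m x j : ℂ) * G (chebNode m j)‖ := norm_sum_le _ _
      _ ≤ ∑ j, |chebKernel m x j| * B := Finset.sum_le_sum fun j _ => by
          rw [norm_mul, Complex.norm_real, Real.norm_eq_abs]
          exact mul_le_mul_of_nonneg_left (hB _ (ofReal_mem_bernsteinEllipse hρ (hnode j)))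
            (abs_nonneg _)
      _ = B * ∑ j, |chebKernel m x j| := by rw [← Finset.sum_mul, mul_comm]
      _ ≤ _ := mul_le_mul_of_nonneg_left (sum_abs_chebKernel_le hm hx) hB0
  have h3 := norm_sub_le (G x) (∑ j, (chebKernel m x j : ℂ) * G (chebNode m j))
  linarith

end OneVariable

end Bermudan

end

/-! ### The error constant in one variable, and tensorization -/

noncomputable section

namespace Bermudan

open Polynomial.Chebyshev

/-- The hypothesis is the failure of the contour bound. It forces `s = 1 - q` to be at most of order
`n^{-1/2}`, so that the right side dominates a logarithm. -/
theorem two_add_log_le {n : ℕ} (hn : 1 ≤ n) {q : ℝ} (hq0 : 0 < q) (hq1 : q < 1)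
    (h : 2 * (1 - q ^ (2 * n)) < q * (1 + q)) :
    2 + 2 / Real.pi * Real.log n ≤ √(8 * q ^ n / (1 - q)) := by
  have hpi := Real.pi_pos
  have hn0 : (1 : ℝ) ≤ n := by exact_mod_cast hn
  set s := 1 - q with hs
  have hs0 : 0 < s := by linarith
  have hQ : s ≤ q ^ (2 * n) := by nlinarith
  -- Bernoulli's inequality for `(1 + s)^{2n}`, together with `(1 + s) q ≤ 1` and `s ≤ q^{2n}`.
  have hs2 : 2 * n * s ^ 2 ≤ 1 := by
    have h1 : 1 + ((2 * n : ℕ) : ℝ) * s ≤ (1 + s) ^ (2 * n) :=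
      one_add_mul_le_pow (by linarith) _
    have h2 : (1 + s) ^ (2 * n) * q ^ (2 * n) ≤ 1 := by
      rw [← mul_pow]
      refine pow_le_one₀ (by positivity) ?_
      nlinarith
    have h3 : (1 + ((2 * n : ℕ) : ℝ) * s) * s ≤ 1 :=
      (mul_le_mul h1 hQ hs0.le (by positivity)).trans h2
    push_cast at h3
    nlinarith
  -- The logarithm is bounded by `3 n^{1/8}`; its eighth power `6561 n` can then be compared with
  -- the eighth power of the square root, since `6561 / 2 ≤ 4096`.
  set y := Real.log n / 8 with hy
  have hy0 : 0 ≤ y := div_nonneg (Real.log_nonneg hn0) (by norm_num)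
  have hL : 2 + 2 / Real.pi * Real.log n ≤ 3 * Real.exp y := by
    have h1 : 2 / Real.pi ≤ 0.6375 := by
      rw [div_le_iff₀ hpi]; nlinarith [Real.pi_gt_d2]
    have h2 : 2 / Real.pi * Real.log n ≤ 0.6375 * (8 * y) := by
      rw [hy, mul_div_cancel₀ _ (by norm_num : (8 : ℝ) ≠ 0)]
      exact mul_le_mul_of_nonneg_right h1 (Real.log_nonneg hn0)
    have h3 := Real.quadratic_le_exp_of_nonneg hy0
    nlinarith [sq_nonneg (y - 0.7)]
  have hL8 : (2 + 2 / Real.pi * Real.log n) ^ 8 ≤ 6561 * n := by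
    refine (pow_le_pow_left₀ (by positivity) hL 8).trans (le_of_eq ?_)
    rw [mul_pow, ← Real.exp_nat_mul, hy]
    push_cast
    rw [mul_div_cancel₀ _ (by norm_num : (8 : ℝ) ≠ 0), Real.exp_log (by linarith)]
    norm_num
  refine (pow_le_pow_iff_left₀ (by positivity) (Real.sqrt_nonneg _) (n := 8) (by norm_num)).1
    (hL8.trans ?_)
  have hR : √(8 * q ^ n / s) ^ 8 = 4096 * (q ^ (2 * n)) ^ 2 / s ^ 4 := by
    rw [show √(8 * q ^ n / s) ^ 8 = (√(8 * q ^ n / s) ^ 2) ^ 4 by ring,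
      Real.sq_sqrt (by positivity)]
    ring_nf
  rw [hR, le_div_iff₀ (by positivity)]
  have h1 : s ^ 2 ≤ (q ^ (2 * n)) ^ 2 := pow_le_pow_left₀ hs0.le hQ 2
  have h2 : (2 * n * s ^ 2) * s ^ 2 ≤ s ^ 2 := mul_le_of_le_one_left (by positivity) hs2
  have h3 : 6561 * n * s ^ 4 = 3280.5 * ((2 * n * s ^ 2) * s ^ 2) := by ring
  rw [h3]
  have : 0 ≤ s ^ 2 := by positivity
  linarith

/-- With `q = ρ⁻²`, the contour bound exceeds the target by the factor `√(q (1 + q) / (2 (1 -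
q^{2n})))`. If this is at most `1` the contour bound suffices; otherwise the Lebesgue constant does.
-/
theorem norm_sub_sum_chebKernel_mul_le {ρ : ℝ} {G : ℂ → ℂ} {m : ℕ} {x : ℝ} (hm : 1 ≤ m) {B : ℝ}
    (hρ : 1 < ρ) (hG : DifferentiableOn ℂ G (bernsteinEllipse ρ))
    (hB : ∀ z ∈ bernsteinEllipse ρ, ‖G z‖ ≤ B) (hx : x ∈ Set.Icc (-1 : ℝ) 1) :
    ‖G x - ∑ j, (chebKernel m x j : ℂ) * G (chebNode m j)‖ ≤
      B * (2 * ρ⁻¹ ^ m * √(2 / (1 - ρ⁻¹ ^ 2))) := by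
  have hB0 : 0 ≤ B := (norm_nonneg _).trans (hB x (ofReal_mem_bernsteinEllipse hρ hx))
  set t := ρ⁻¹ with ht
  have ht0 : 0 < t := inv_pos.2 (by linarith)
  have hq0 : 0 < t ^ 2 := by positivity
  have hq1 : t ^ 2 < 1 := pow_lt_one₀ ht0.le (inv_lt_one_of_one_lt₀ hρ) (by norm_num)
  have hs0 : 0 < 1 - t ^ 2 := by linarith
  rcases le_or_gt (t ^ 2 * (1 + t ^ 2)) (2 * (1 - (t ^ 2) ^ (2 * (m + 1)))) with h | h
  · refine (norm_sub_sum_chebKernel_mul_le_of_circle hρ hG hB hx).trans ?_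
    rw [← ht, mul_assoc]
    refine mul_le_mul_of_nonneg_left ?_ hB0
    rw [mul_assoc, mul_assoc, pow_succ, mul_assoc]
    refine mul_le_mul_of_nonneg_left (mul_le_mul_of_nonneg_left ?_ (by positivity)) (by norm_num)
    have hqn : (t ^ 2) ^ (2 * (m + 1)) < 1 := pow_lt_one₀ hq0.le hq1 (by omega)
    refine Real.le_sqrt_of_sq_le ?_
    rw [mul_pow, Real.sq_sqrt (by
      have : 0 < 1 - (t ^ 2) ^ (2 * (m + 1)) := by linarith
      positivity), one_div_mul_eq_div, div_div, mul_div_assoc', div_le_div_iff₀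
      (mul_pos (by linarith) hs0) hs0]
    nlinarith
  · refine (norm_sub_sum_chebKernel_mul_le_of_lebesgue hm hρ hB hx).trans ?_
    refine mul_le_mul_of_nonneg_left ?_ hB0
    have h1 := two_add_log_le (n := m + 1) (by omega) hq0 hq1 h
    push_cast at h1
    refine h1.trans (Real.sqrt_le_iff.2 ⟨by positivity, ?_⟩)
    rw [mul_pow, Real.sq_sqrt (by positivity), mul_div_assoc']
    refine div_le_div_of_nonneg_right ?_ hs0.le
    rw [show (2 * t ^ m) ^ 2 * 2 = 8 * (t ^ 2) ^ m by ring, pow_succ]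
    have : 0 < (t ^ 2) ^ m := by positivity
    nlinarith

/-! ### Tensor interpolation -/

/-- Holomorphy in each variable on a product domain. -/
def SeparatelyHolomorphicOn {d : ℕ} (E : Set ℂ) (F : (Fin d → ℂ) → ℂ) : Prop :=
  ∀ z, (∀ i, z i ∈ E) → ∀ i, DifferentiableOn ℂ (fun w => F (Function.update z i w)) E

namespace SeparatelyHolomorphicOn

variable {d : ℕ} {E : Set ℂ}

theorem fin_cons {F : (Fin (d + 1) → ℂ) → ℂ} (hF : SeparatelyHolomorphicOn E F) {w : ℂ}
    (hw : w ∈ E) :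
    SeparatelyHolomorphicOn E fun v : Fin d → ℂ => F (Fin.cons w v : Fin (d + 1) → ℂ) := by
  intro z hz i
  have h := hF (Fin.cons w z : Fin (d + 1) → ℂ) (fun j => by
    refine Fin.cases ?_ (fun j => ?_) j
    · exact hw
    · exact hz j) i.succ
  simpa only [Fin.cons_update] using h

theorem differentiableOn_cons {F : (Fin (d + 1) → ℂ) → ℂ} (hF : SeparatelyHolomorphicOn E F)
    {v : Fin d → ℂ} (hv : ∀ i, v i ∈ E) :
    DifferentiableOn ℂ (fun w => F (Fin.cons w v : Fin (d + 1) → ℂ)) E := by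
  intro w hw
  have h := hF (Fin.cons w v : Fin (d + 1) → ℂ) (fun j => by
    refine Fin.cases ?_ (fun j => ?_) j
    · exact hw
    · exact hv j) 0
  simp only [Fin.update_cons_zero] at h
  exact h w hw

theorem sub {F H : (Fin d → ℂ) → ℂ} (hF : SeparatelyHolomorphicOn E F)
    (hH : SeparatelyHolomorphicOn E H) : SeparatelyHolomorphicOn E fun z => F z - H z :=
  fun z hz i => (hF z hz i).sub (hH z hz i)

theorem sum_mul {ι : Type*} [Fintype ι] {F : ι → (Fin d → ℂ) → ℂ} (c : ι → ℂ)
    (hF : ∀ a, SeparatelyHolomorphicOn E (F a)) :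
    SeparatelyHolomorphicOn E fun z => ∑ a, c a * F a z :=
  fun z hz i => DifferentiableOn.fun_sum fun a _ => (hF a z hz i).const_mul (c a)

end SeparatelyHolomorphicOn

theorem sum_fin_succ_pi {ι : Type*} [Fintype ι] {d : ℕ} (φ : (Fin (d + 1) → ι) → ℂ) :
    ∑ a, φ a = ∑ a₀, ∑ a : Fin d → ι, φ (Fin.cons a₀ a) := by
  rw [← (Fin.consEquiv fun _ => ι).sum_comp, Fintype.sum_prod_type]
  rfl

/-- The norm of a tensor product of finite functionals on bounded holomorphic functions is at most
the product of the norms. -/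
theorem norm_sum_prod_mul_le {ι : Type*} [Fintype ι] {E : Set ℂ} {N B : ℝ} {d : ℕ}
    (c p : Fin d → ι → ℂ) (hp : ∀ i a, p i a ∈ E)
    (hN : ∀ i, ∀ (G : ℂ → ℂ) (B : ℝ), DifferentiableOn ℂ G E → (∀ z ∈ E, ‖G z‖ ≤ B) →
      ‖∑ a, c i a * G (p i a)‖ ≤ B * N)
    {F : (Fin d → ℂ) → ℂ} (hF : SeparatelyHolomorphicOn E F)
    (hB : ∀ z, (∀ i, z i ∈ E) → ‖F z‖ ≤ B) :
    ‖∑ a : Fin d → ι, (∏ i, c i (a i)) * F fun i => p i (a i)‖ ≤ B * N ^ d := by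
  induction d with
  | zero =>
    simpa using hB _ (fun i => i.elim0)
  | succ d ih =>
    have hcons : ∀ (a₀ : ι) (a : Fin d → ι),
        (fun i : Fin (d + 1) => p i ((Fin.cons a₀ a : Fin (d + 1) → ι) i)) =
          (Fin.cons (p 0 a₀) (fun i : Fin d => p i.succ (a i)) : Fin (d + 1) → ℂ) := by
      intro a₀ a
      funext i
      refine Fin.cases ?_ (fun i => ?_) i <;> simp
    -- The other functionals act first, with the first variable frozen at `w`. The induction
    -- hypothesis bounds `H` on all of `E`, as the bound in one variable requires.
    set H : ℂ → ℂ := fun w => ∑ a : Fin d → ι, (∏ i, c i.succ (a i)) *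
      F (Fin.cons w (fun i => p i.succ (a i)) : Fin (d + 1) → ℂ) with hH
    have h1 : ∑ a : Fin (d + 1) → ι, (∏ i, c i (a i)) * F (fun i => p i (a i)) =
        ∑ a₀, c 0 a₀ * H (p 0 a₀) := by
      rw [sum_fin_succ_pi]
      refine Finset.sum_congr rfl fun a₀ _ => ?_
      rw [hH, Finset.mul_sum]
      refine Finset.sum_congr rfl fun a _ => ?_
      rw [hcons, Fin.prod_univ_succ]
      simp only [Fin.cons_zero, Fin.cons_succ]
      ring
    rw [h1, pow_succ, ← mul_assoc]
    refine hN 0 H _ ?_ ?_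
    · exact DifferentiableOn.fun_sum fun a _ =>
        (hF.differentiableOn_cons fun i => hp i.succ (a i)).const_mul _
    · intro w hw
      refine ih (fun i => c i.succ) (fun i => p i.succ) (fun i => hp i.succ) (fun i => hN i.succ)
        (hF.fin_cons hw) fun z hz => hB _ fun i => ?_
      refine Fin.cases ?_ (fun i => ?_) i
      · exact hw
      · exact hz i

/-- The error of a tensor interpolation through the norms and the errors of the interpolations in
one variable. -/
theorem norm_sub_sum_prod_mul_le {ι : Type*} [Fintype ι] {E : Set ℂ} {N η B : ℝ} {d : ℕ}
    (c : Fin d → ι → ℂ) (p : ι → ℂ) (x : Fin d → ℂ) (hp : ∀ a, p a ∈ E) (hx : ∀ i, x i ∈ E)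
    (hN : ∀ i, ∀ (G : ℂ → ℂ) (B : ℝ), DifferentiableOn ℂ G E → (∀ z ∈ E, ‖G z‖ ≤ B) →
      ‖∑ a, c i a * G (p a)‖ ≤ B * N)
    (hη : ∀ i, ∀ (G : ℂ → ℂ) (B : ℝ), DifferentiableOn ℂ G E → (∀ z ∈ E, ‖G z‖ ≤ B) →
      ‖G (x i) - ∑ a, c i a * G (p a)‖ ≤ B * η)
    {F : (Fin d → ℂ) → ℂ} (hF : SeparatelyHolomorphicOn E F)
    (hB : ∀ z, (∀ i, z i ∈ E) → ‖F z‖ ≤ B) :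
    ‖F x - ∑ a : Fin d → ι, (∏ i, c i (a i)) * F fun i => p (a i)‖ ≤
      B * η * ∑ i ∈ Finset.range d, N ^ i := by
  induction d with
  | zero =>
    have : x = fun i : Fin 0 => p ((default : Fin 0 → ι) i) := funext fun i => i.elim0
    simp [this]
  | succ d ih =>
    have hcons : ∀ (a₀ : ι) (a : Fin d → ι),
        (fun i : Fin (d + 1) => p ((Fin.cons a₀ a : Fin (d + 1) → ι) i)) =
          (Fin.cons (p a₀) (fun i : Fin d => p (a i)) : Fin (d + 1) → ℂ) := by
      intro a₀ a
      funext i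
      refine Fin.cases ?_ (fun i => ?_) i <;> simp
    have hmem : ∀ {w : ℂ} {z : Fin d → ℂ}, w ∈ E → (∀ i, z i ∈ E) →
        ∀ i, (Fin.cons w z : Fin (d + 1) → ℂ) i ∈ E := by
      intro w z hw hz i
      refine Fin.cases ?_ (fun i => ?_) i
      · exact hw
      · exact hz i
    set x' : Fin d → ℂ := fun i => x i.succ with hx'
    have hxc : x = (Fin.cons (x 0) x' : Fin (d + 1) → ℂ) := (Fin.cons_self_tail x).symm
    set H : (Fin d → ℂ) → ℂ := fun v => F (Fin.cons (x 0) v : Fin (d + 1) → ℂ) -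
      ∑ a₀, c 0 a₀ * F (Fin.cons (p a₀) v : Fin (d + 1) → ℂ) with hH
    have hHs : SeparatelyHolomorphicOn E H :=
      (hF.fin_cons (hx 0)).sub (SeparatelyHolomorphicOn.sum_mul _ fun a₀ => hF.fin_cons (hp a₀))
    have hHb : ∀ v, (∀ i, v i ∈ E) → ‖H v‖ ≤ B * η := fun v hv =>
      hη 0 _ B (hF.differentiableOn_cons hv) fun z hz => hB _ (hmem hz hv)
    have h1 := norm_sum_prod_mul_le (fun i : Fin d => c i.succ) (fun _ => p) (fun _ => hp)
      (fun i => hN i.succ) hHs hHb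
    have h2 := ih (fun i => c i.succ) x' (fun i => hx i.succ) (fun i => hN i.succ)
      (fun i => hη i.succ) (hF.fin_cons (hx 0)) fun z hz => hB _ (hmem (hx 0) hz)
    -- The first summand is the error in the last `d` variables at `x 0`. The second applies their
    -- interpolation to the error `H` in the first variable and contributes `B η N^d`.
    have h3 : F x - ∑ a : Fin (d + 1) → ι, (∏ i, c i (a i)) * F (fun i => p (a i)) =
        (F (Fin.cons (x 0) x' : Fin (d + 1) → ℂ) - ∑ a : Fin d → ι, (∏ i, c i.succ (a i)) *
          F (Fin.cons (x 0) (fun i => p (a i)) : Fin (d + 1) → ℂ)) +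
        ∑ a : Fin d → ι, (∏ i, c i.succ (a i)) * H fun i => p (a i) := by
      rw [← hxc, sum_fin_succ_pi, Finset.sum_comm]
      simp only [hH, mul_sub, Finset.sum_sub_distrib, Finset.mul_sum]
      rw [sub_add_sub_cancel]
      congr 1
      refine Finset.sum_congr rfl fun a _ => Finset.sum_congr rfl fun a₀ _ => ?_
      rw [hcons, Fin.prod_univ_succ]
      simp only [Fin.cons_zero, Fin.cons_succ]
      ring
    rw [h3, Finset.sum_range_succ, mul_add]
    exact (norm_add_le _ _).trans (add_le_add h2 h1)

theorem sum_range_succ_pow_le {M : ℝ} (hM : 0 ≤ M) (k : ℕ) :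
    ∑ i ∈ Finset.range (k + 1), M ^ i ≤ (M + 1) ^ k := by
  induction k with
  | zero => simp
  | succ k ih =>
    rw [Finset.sum_range_succ, pow_succ (M + 1), mul_add, mul_one, add_comm, pow_succ]
    gcongr
    linarith

/-- Cauchy-Schwarz over the `d` terms produces `√d`, and `∑_{i < d} μ^{2i} ≤ (μ² + 1)^{d-1}`. -/
theorem sum_range_pow_mul_le {μ σ : ℝ} (hσ : 0 ≤ σ) (h : σ ^ 2 = μ ^ 2 + 1) (d : ℕ) :
    σ * ∑ i ∈ Finset.range d, μ ^ i ≤ √d * σ ^ d := by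
  cases d with
  | zero => simp
  | succ k =>
    have h1 : ∑ i ∈ Finset.range (k + 1), μ ^ i ≤ √((k + 1 : ℕ) : ℝ) * σ ^ k := by
      refine le_of_sq_le_sq ?_ (by positivity)
      rw [mul_pow, Real.sq_sqrt (by positivity), ← pow_mul, mul_comm k 2, pow_mul, h]
      have h2 := sq_sum_le_card_mul_sum_sq (s := Finset.range (k + 1)) (f := fun i => μ ^ i)
      rw [Finset.card_range] at h2
      refine h2.trans (mul_le_mul_of_nonneg_left ?_ (by positivity))
      simp only [← pow_mul]
      simp only [mul_comm _ 2, pow_mul μ 2]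
      exact sum_range_succ_pow_le (sq_nonneg μ) k
    rw [pow_succ]
    nlinarith [mul_le_mul_of_nonneg_left h1 hσ]

/-! ### Chebyshev interpolation on hyper-rectangles -/

namespace Rect

variable {d : ℕ} (D : Rect d)

theorem toUnit_fromUnit (i : Fin d) (x : ℝ) : D.toUnit i (D.fromUnit i x) = x := by
  have := sub_ne_zero.2 (D.lower_lt_upper i).ne'
  unfold toUnit fromUnit
  field_simp
  ring

theorem fromUnit_toUnit (i : Fin d) (s : ℝ) : D.fromUnit i (D.toUnit i s) = s := by
  have := sub_ne_zero.2 (D.lower_lt_upper i).ne'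
  unfold toUnit fromUnit
  field_simp
  ring

theorem toUnit_mem_Icc {s : Fin d → ℝ} (hs : s ∈ D.toSet) (i : Fin d) :
    D.toUnit i (s i) ∈ Set.Icc (-1 : ℝ) 1 := by
  have h1 := hs.1 i
  have h2 := hs.2 i
  have h3 := D.lower_lt_upper i
  unfold toUnit
  rw [Set.mem_Icc, le_div_iff₀ (by linarith), div_le_iff₀ (by linarith)]
  constructor <;> linarith

end Rect

/-- The weight `2^{#{i | l_i > 0}} / (m + 1)^d` is a product over the coordinates, so the sum over
`l` factors. -/
theorem chebInterp_eq {d : ℕ} (D : Rect d) (m : ℕ) (q : (Fin d → Fin (m + 1)) → ℝ)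
    (s : Fin d → ℝ) :
    chebInterp D m q s = ∑ j, (∏ i, chebKernel m (D.toUnit i (s i)) (j i)) * q j := by
  unfold chebInterp chebCoeff
  simp only [Finset.mul_sum, Finset.sum_mul]
  rw [Finset.sum_comm]
  refine Finset.sum_congr rfl fun j _ => ?_
  simp only [chebKernel]
  rw [Finset.prod_univ_sum, Finset.sum_mul, Fintype.piFinset_univ]
  refine Finset.sum_congr rfl fun l _ => ?_
  rw [Finset.prod_mul_distrib, Finset.prod_mul_distrib, Finset.prod_div_distrib, Finset.prod_const,
    Finset.card_univ, Fintype.card_fin, Finset.prod_ite, Finset.prod_const, Finset.prod_const_one,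
    mul_one]
  simp only [tensorCheb, gridNode, Rect.toUnit_fromUnit]
  ring

theorem abs_chebInterp_le {d : ℕ} (D : Rect d) {m : ℕ} (hm : 1 ≤ m)
    {q : (Fin d → Fin (m + 1)) → ℝ} {ε : ℝ} (hq : ∀ j, |q j| ≤ ε) {s : Fin d → ℝ}
    (hs : s ∈ D.toSet) : |chebInterp D m q s| ≤ lebesgueBound d m * ε := by
  have hε : 0 ≤ ε := (abs_nonneg _).trans (hq fun _ => 0)
  rw [chebInterp_eq]
  calc |∑ j, (∏ i, chebKernel m (D.toUnit i (s i)) (j i)) * q j|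
      ≤ ∑ j : Fin d → Fin (m + 1), (∏ i, |chebKernel m (D.toUnit i (s i)) (j i)|) * ε := by
        refine (Finset.abs_sum_le_sum_abs _ _).trans (Finset.sum_le_sum fun j _ => ?_)
        rw [abs_mul, Finset.abs_prod]
        exact mul_le_mul_of_nonneg_left (hq j) (Finset.prod_nonneg fun i _ => abs_nonneg _)
    _ = (∏ i, ∑ j, |chebKernel m (D.toUnit i (s i)) j|) * ε := by
        rw [Finset.prod_univ_sum, Fintype.piFinset_univ, Finset.sum_mul]
    _ ≤ (∏ _i : Fin d, (2 / Real.pi * Real.log ((m : ℝ) + 1) + 1)) * ε := by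
        refine mul_le_mul_of_nonneg_right (Finset.prod_le_prod
          (fun i _ => Finset.sum_nonneg fun j _ => abs_nonneg _)
          fun i _ => sum_abs_chebKernel_le hm (D.toUnit_mem_Icc hs i)) hε
    _ = _ := by rw [Finset.prod_const, Finset.card_univ, Fintype.card_fin, lebesgueBound]

theorem chebInterp_sub {d : ℕ} (D : Rect d) (m : ℕ) (q r : (Fin d → Fin (m + 1)) → ℝ)
    (s : Fin d → ℝ) :
    chebInterp D m (fun j => q j - r j) s = chebInterp D m q s - chebInterp D m r s := by
  simp only [chebInterp_eq, mul_sub, Finset.sum_sub_distrib]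

theorem epsInt_eq {ρ : ℝ} (hρ : 1 < ρ) (d m : ℕ) (B : ℝ) :
    epsInt ρ d m B = B * (2 * ρ⁻¹ ^ m) * (√d * √(2 / (1 - ρ⁻¹ ^ 2)) ^ d) := by
  have h0 : 0 < ρ⁻¹ := inv_pos.2 (by linarith)
  have hq1 : ρ⁻¹ ^ 2 < 1 := pow_lt_one₀ h0.le (inv_lt_one_of_one_lt₀ hρ) (by norm_num)
  have hs0 : 0 < 1 - ρ⁻¹ ^ 2 := by linarith
  have h1 : √(2 / (1 - ρ⁻¹ ^ 2)) ^ d = 2 ^ ((d : ℝ) / 2) * (1 - ρ⁻¹ ^ 2) ^ (-((d : ℝ) / 2)) := by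
    rw [Real.sqrt_eq_rpow, ← Real.rpow_natCast, ← Real.rpow_mul (by positivity),
      Real.div_rpow (by norm_num) hs0.le, Real.rpow_neg hs0.le, one_div_mul_eq_div]
    rfl
  rw [epsInt, h1, Real.rpow_add (by norm_num), Real.rpow_one, ← inv_pow, ← inv_pow]
  ring

theorem abs_sub_chebInterp_le {d : ℕ} (D : Rect d) {m : ℕ} (hm : 1 ≤ m) {ρ B : ℝ} (hρ : 1 < ρ)
    {f : D.toSet → ℝ} (hf : HasBoundedAnalyticExtension D ρ B f)
    (q : (Fin d → Fin (m + 1)) → ℝ)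
    (hq : ∀ j (h : gridNode D m j ∈ D.toSet), q j = f ⟨gridNode D m j, h⟩) (s : D.toSet) :
    |f s - chebInterp D m q s| ≤ epsInt ρ d m B := by
  obtain ⟨F, hF, hfF, hFB⟩ := hf
  set aff : (Fin d → ℂ) → Fin d → ℂ := fun z i =>
    (((D.upper i - D.lower i) / 2 : ℝ) : ℂ) * z i + (((D.upper i + D.lower i) / 2 : ℝ) : ℂ)
    with haff
  have hmem : ∀ z : Fin d → ℂ, (∀ i, z i ∈ bernsteinEllipse ρ) →
      aff z ∈ genBernsteinEllipse D ρ := fun z hz i => ⟨z i, hz i, rfl⟩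
  set H : (Fin d → ℂ) → ℂ := fun z => F (aff z) with hH
  have haffd : Differentiable ℂ aff := by
    rw [differentiable_pi]
    intro i
    simp only [haff]
    fun_prop
  have hHs : SeparatelyHolomorphicOn (bernsteinEllipse ρ) H := by
    intro z hz i w hw
    have hz' : ∀ j, Function.update z i w j ∈ bernsteinEllipse ρ := by
      intro j
      rcases eq_or_ne j i with rfl | hj
      · simpa using hw
      · simpa [hj] using hz j
    have h1 : DifferentiableAt ℂ F (aff (Function.update z i w)) :=
      (hF _ (hmem _ hz')).differentiableAt
    have h2 : DifferentiableAt ℂ (fun w : ℂ => aff (Function.update z i w)) w :=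
      haffd.differentiableAt.comp w (hasFDerivAt_update z w).differentiableAt
    exact (DifferentiableAt.comp w h1 h2).differentiableWithinAt
  have hHB : ∀ z : Fin d → ℂ, (∀ i, z i ∈ bernsteinEllipse ρ) → ‖H z‖ ≤ B :=
    fun z hz => hFB _ (hmem z hz)
  have hnode : ∀ j, chebNode m j ∈ Set.Icc (-1 : ℝ) 1 := fun j =>
    ⟨Real.neg_one_le_cos _, Real.cos_le_one _⟩
  have hreal : ∀ (y : Fin d → ℝ), aff (fun i => (y i : ℂ)) =
      fun i => ((D.fromUnit i (y i) : ℝ) : ℂ) := by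
    intro y
    funext i
    simp only [haff, Rect.fromUnit]
    push_cast
    ring
  set x : Fin d → ℝ := fun i => D.toUnit i ((s : Fin d → ℝ) i) with hx
  have hxI : ∀ i, x i ∈ Set.Icc (-1 : ℝ) 1 := D.toUnit_mem_Icc s.2
  have hfs : H (fun i => (x i : ℂ)) = (f s : ℂ) := by
    rw [← hfF, hH]
    simp only [hreal, hx, Rect.fromUnit_toUnit]
  have hgrid : ∀ j, gridNode D m j ∈ D.toSet := by
    intro j
    have hl := D.lower_lt_upper
    constructor <;> intro i <;> simp only [gridNode, Rect.fromUnit] <;>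
      nlinarith [(hnode (j i)).1, (hnode (j i)).2, hl i]
  have hfq : ∀ j : Fin d → Fin (m + 1), H (fun i => (chebNode m (j i) : ℂ)) = (q j : ℂ) := by
    intro j
    rw [hq j (hgrid j), ← hfF, hH]
    simp only [hreal (fun i => chebNode m (j i))]
    rfl
  have hmain := norm_sub_sum_prod_mul_le (fun i j => (chebKernel m (x i) j : ℂ))
    (fun j => (chebNode m j : ℂ)) (fun i => (x i : ℂ))
    (fun j => ofReal_mem_bernsteinEllipse hρ (hnode j))
    (fun i => ofReal_mem_bernsteinEllipse hρ (hxI i))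
    (fun i G B hG hB => norm_sum_chebKernel_mul_le hm hρ hG hB (hxI i))
    (fun i G B hG hB => norm_sub_sum_chebKernel_mul_le hm hρ hG hB (hxI i)) hHs hHB
  have hlhs : H (fun i => (x i : ℂ)) - ∑ j : Fin d → Fin (m + 1),
      (∏ i, (chebKernel m (x i) (j i) : ℂ)) * H (fun i => (chebNode m (j i) : ℂ)) =
      ((f s - chebInterp D m q s : ℝ) : ℂ) := by
    rw [hfs, chebInterp_eq]
    simp only [hfq]
    push_cast
    rfl
  rw [hlhs, Complex.norm_real, Real.norm_eq_abs] at hmain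
  refine hmain.trans ?_
  have h0 : 0 < ρ⁻¹ := inv_pos.2 (by linarith)
  have hq1 : ρ⁻¹ ^ 2 < 1 := pow_lt_one₀ h0.le (inv_lt_one_of_one_lt₀ hρ) (by norm_num)
  have hs0 : 0 < 1 - ρ⁻¹ ^ 2 := by linarith
  have hB0 : 0 ≤ B := (norm_nonneg _).trans
    (hHB _ fun i => ofReal_mem_bernsteinEllipse hρ (hxI i))
  -- `μ` is the norm of the interpolation in one variable and `2 ρ⁻ᵐ σ` its error; they satisfy `μ²
  -- + 1 = σ²`.
  have hsum := sum_range_pow_mul_le (μ := √((1 + ρ⁻¹ ^ 2) / (1 - ρ⁻¹ ^ 2)))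
    (σ := √(2 / (1 - ρ⁻¹ ^ 2))) (Real.sqrt_nonneg _) (by
      rw [Real.sq_sqrt (by positivity), Real.sq_sqrt (by positivity)]
      generalize ρ⁻¹ ^ 2 = q at hs0
      field_simp
      ring) d
  rw [epsInt_eq hρ]
  calc _ = B * (2 * ρ⁻¹ ^ m) * (√(2 / (1 - ρ⁻¹ ^ 2)) *
        ∑ i ∈ Finset.range d, √((1 + ρ⁻¹ ^ 2) / (1 - ρ⁻¹ ^ 2)) ^ i) := by ring
    _ ≤ _ := mul_le_mul_of_nonneg_left hsum (by positivity)

end Bermudan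

end

noncomputable section

namespace Bermudan

/-! ### Finitely supported random variables -/

section FiniteSupport

variable {Ω E : Type*} {mΩ : MeasurableSpace Ω} [MeasurableSpace E] [MeasurableSingletonClass E]
  {P : Measure Ω} {X : Ω → E} {T : Finset E}

/-- This dispenses with any measurability of `g`: prices and extrapolated prices are arbitrary
functions of the state. -/
theorem ae_eq_sum_indicator (hT : ∀ᵐ ω ∂P, X ω ∈ T) (g : E → ℝ) :
    (fun ω => g (X ω)) =ᵐ[P] fun ω => ∑ x ∈ T, (X ⁻¹' {x}).indicator (fun _ => g x) ω := by
  filter_upwards [hT] with ω hω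
  rw [Finset.sum_eq_single_of_mem _ hω]
  · simp
  · intro x _ hx
    rw [Set.indicator_of_notMem]
    exact fun h => hx h.symm

theorem integrable_comp_of_finite [IsFiniteMeasure P] (hX : Measurable X)
    (hT : ∀ᵐ ω ∂P, X ω ∈ T) (g : E → ℝ) : Integrable (fun ω => g (X ω)) P := by
  refine Integrable.congr ?_ (ae_eq_sum_indicator hT g).symm
  exact integrable_finsetSum _ fun x _ =>
    (integrable_const _).indicator (hX (measurableSet_singleton x))

theorem setIntegral_comp_of_finite [IsFiniteMeasure P] (hX : Measurable X)
    (hT : ∀ᵐ ω ∂P, X ω ∈ T) (g : E → ℝ) (C : Set Ω) :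
    ∫ ω in C, g (X ω) ∂P = ∑ x ∈ T, g x * P.real (C ∩ X ⁻¹' {x}) := by
  have hae := ae_restrict_of_ae (s := C) (ae_eq_sum_indicator hT g)
  rw [integral_congr_ae hae, integral_finsetSum _ fun x _ =>
    ((integrable_const _).indicator (hX (measurableSet_singleton x)))]
  refine Finset.sum_congr rfl fun x _ => ?_
  have hm : MeasurableSet (X ⁻¹' {x}) := hX (measurableSet_singleton x)
  rw [integral_indicator hm, Measure.restrict_restrict hm, setIntegral_const, smul_eq_mul,
    Set.inter_comm, mul_comm]

theorem integral_eq_sum_of_finite {μ : Measure E} [IsFiniteMeasure μ]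
    (hT : μ (T : Set E)ᶜ = 0) (g : E → ℝ) : ∫ x, g x ∂μ = ∑ x ∈ T, g x * μ.real {x} := by
  have h : ∀ᵐ x ∂μ, id x ∈ T := hT
  have := setIntegral_comp_of_finite measurable_id h g Set.univ
  simpa using this

end FiniteSupport

/-! ### Optimal stopping of finitely supported Markov chains -/

namespace Model

variable {d : ℕ} (M : Model d)

/-- A Markov chain on the dates `k, …, K` with the transition kernels of the model whose state at
date `k` is almost surely in a finite set. -/
structure IsFiniteChain {Ω : Type*} {mΩ : MeasurableSpace Ω} (P : Measure Ω) (ℱ : Filtration ℕ mΩ)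
    (X : ℕ → Ω → M.states) (k K : ℕ) : Prop where
  adapted : ∀ n, k ≤ n → n ≤ K → Measurable[ℱ n] (X n)
  finite_init : ∃ T : Finset M.states, ∀ᵐ ω ∂P, X k ω ∈ T
  transition : ∀ n, k ≤ n → n < K → ∀ A : Set M.states, MeasurableSet A →
    P⟦X (n + 1) ⁻¹' A | ℱ n⟧ =ᵐ[P] fun ω => (M.trans n (X n ω)).real A

/-- The value function of the backward recursion with `i` remaining dates after the date `k`. -/
def snell : ℕ → ℕ → M.states → ℝ
  | 0, k => M.payoff k
  | i + 1, k => fun s => max (M.payoff k s) (∫ x, snell i (k + 1) x ∂(M.trans k s))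

variable {M}

namespace IsFiniteChain

variable {Ω : Type*} {mΩ : MeasurableSpace Ω} {P : Measure Ω} [IsProbabilityMeasure P]
  {ℱ : Filtration ℕ mΩ} {X : ℕ → Ω → M.states} {k K : ℕ}

theorem measurable (h : M.IsFiniteChain P ℱ X k K) {n : ℕ} (h1 : k ≤ n) (h2 : n ≤ K) :
    Measurable (X n) := (h.adapted n h1 h2).mono (ℱ.le n) le_rfl

theorem real_inter (h : M.IsFiniteChain P ℱ X k K) {n : ℕ} (h1 : k ≤ n) (h2 : n < K)
    {C : Set Ω} (hC : MeasurableSet[ℱ n] C) {A : Set M.states} (hA : MeasurableSet A) :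
    P.real (C ∩ X (n + 1) ⁻¹' A) = ∫ ω in C, (M.trans n (X n ω)).real A ∂P := by
  have hm : MeasurableSet (X (n + 1) ⁻¹' A) := h.measurable (by omega) (by omega) hA
  have hi : Integrable ((X (n + 1) ⁻¹' A).indicator fun _ => (1 : ℝ)) P :=
    (integrable_const _).indicator hm
  rw [← integral_congr_ae (ae_restrict_of_ae (h.transition n h1 h2 A hA)),
    setIntegral_condExp (ℱ.le n) hi hC, integral_indicator hm, Measure.restrict_restrict hm,
    setIntegral_const, smul_eq_mul, mul_one, Set.inter_comm]

theorem exists_finite_succ (hfin : M.FiniteTransitions K) (h : M.IsFiniteChain P ℱ X k K) {n : ℕ}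
    (h1 : k ≤ n) (h2 : n < K) {T : Finset M.states} (hT : ∀ᵐ ω ∂P, X n ω ∈ T) :
    ∃ T' : Finset M.states, (∀ᵐ ω ∂P, X (n + 1) ω ∈ T') ∧
      ∀ x ∈ T, M.trans n x (T' : Set M.states)ᶜ = 0 := by
  classical
  choose U hU using hfin n h2
  have hx : ∀ x ∈ T, M.trans n x ((T.biUnion U : Finset M.states) : Set M.states)ᶜ = 0 := by
    intro x hx
    refine measure_mono_null (Set.compl_subset_compl.2 ?_) (hU x)
    exact_mod_cast Finset.subset_biUnion_of_mem U hx
  refine ⟨T.biUnion U, ?_, hx⟩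
  have hA : MeasurableSet ((T.biUnion U : Finset M.states) : Set M.states)ᶜ :=
    (Finset.measurableSet _).compl
  have h3 := h.real_inter h1 h2 (C := Set.univ) MeasurableSet.univ hA
  have h4 : (fun ω => (M.trans n (X n ω)).real
      ((T.biUnion U : Finset M.states) : Set M.states)ᶜ) =ᵐ[P] fun _ => 0 := by
    filter_upwards [hT] with ω hω
    rw [measureReal_def, hx _ hω, ENNReal.toReal_zero]
  rw [Measure.restrict_univ, integral_congr_ae h4, integral_zero, Set.univ_inter,
    measureReal_eq_zero_iff] at h3
  exact h3

theorem exists_finite (hfin : M.FiniteTransitions K) (h : M.IsFiniteChain P ℱ X k K) {n : ℕ}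
    (h1 : k ≤ n) (h2 : n ≤ K) : ∃ T : Finset M.states, ∀ᵐ ω ∂P, X n ω ∈ T := by
  induction n, h1 using Nat.le_induction with
  | base => exact h.finite_init
  | succ n hn ih =>
    obtain ⟨T, hT⟩ := ih (by omega)
    obtain ⟨T', hT', _⟩ := h.exists_finite_succ hfin hn (by omega) hT
    exact ⟨T', hT'⟩

theorem integrable_comp (hfin : M.FiniteTransitions K) (h : M.IsFiniteChain P ℱ X k K) {n : ℕ}
    (h1 : k ≤ n) (h2 : n ≤ K) (g : M.states → ℝ) : Integrable (fun ω => g (X n ω)) P := by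
  obtain ⟨T, hT⟩ := h.exists_finite hfin h1 h2
  exact integrable_comp_of_finite (h.measurable h1 h2) hT g

/-- The Markov property, given for sets, is applied to the finitely many singletons that carry mass.
-/
theorem setIntegral_succ (hfin : M.FiniteTransitions K) (h : M.IsFiniteChain P ℱ X k K) {n : ℕ}
    (h1 : k ≤ n) (h2 : n < K) (g : M.states → ℝ) {C : Set Ω} (hC : MeasurableSet[ℱ n] C) :
    ∫ ω in C, g (X (n + 1) ω) ∂P = ∫ ω in C, ∫ x, g x ∂(M.trans n (X n ω)) ∂P := by
  obtain ⟨T, hT⟩ := h.exists_finite hfin h1 h2.le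
  obtain ⟨T', hT', hT0⟩ := h.exists_finite_succ hfin h1 h2 hT
  rw [setIntegral_comp_of_finite (h.measurable (by omega) (by omega)) hT' g C]
  have hker : (fun ω => ∫ x, g x ∂(M.trans n (X n ω))) =ᵐ[P] fun ω =>
      ∑ y ∈ T', g y * (M.trans n (X n ω)).real {y} := by
    filter_upwards [hT] with ω hω
    have := M.markov n
    exact integral_eq_sum_of_finite (hT0 _ hω) g
  rw [integral_congr_ae (ae_restrict_of_ae hker), integral_finsetSum]
  · refine Finset.sum_congr rfl fun y _ => ?_
    rw [integral_const_mul, h.real_inter h1 h2 hC (measurableSet_singleton y)]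
  · intro y _
    exact (integrable_comp_of_finite (h.measurable h1 h2.le) hT
      fun x => g y * (M.trans n x).real {y}).integrableOn

theorem succ (hfin : M.FiniteTransitions K) (h : M.IsFiniteChain P ℱ X k K) (hk : k < K) :
    M.IsFiniteChain P ℱ X (k + 1) K where
  adapted n h1 h2 := h.adapted n (by omega) h2
  finite_init := h.exists_finite hfin (by omega) (by omega)
  transition n h1 h2 := h.transition n (by omega) h2

theorem integrable_stopped (hfin : M.FiniteTransitions K) (h : M.IsFiniteChain P ℱ X k K)
    (f : ℕ → M.states → ℝ) {τ : Ω → ℕ} (hτ : IsStoppingTime ℱ fun ω => (τ ω : WithTop ℕ))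
    (hτk : ∀ ω, k ≤ τ ω ∧ τ ω ≤ K) : Integrable (fun ω => f (τ ω) (X (τ ω) ω)) P := by
  have heq : (fun ω => f (τ ω) (X (τ ω) ω)) = fun ω => ∑ n ∈ Finset.Icc k K,
      {ω | τ ω = n}.indicator (fun ω => f n (X n ω)) ω := by
    funext ω
    rw [Finset.sum_eq_single_of_mem (τ ω) (Finset.mem_Icc.2 (hτk ω))]
    · rw [Set.indicator_of_mem (by simp)]
    · intro n _ hn
      rw [Set.indicator_of_notMem]
      exact fun h => hn h.symm
  rw [heq]
  refine integrable_finsetSum _ fun n hn => ?_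
  have hn' := Finset.mem_Icc.1 hn
  have hm : MeasurableSet[ℱ n] {ω | τ ω = n} := by simpa using hτ.measurableSet_eq n
  exact (h.integrable_comp hfin hn'.1 hn'.2 (f n)).indicator (ℱ.le n _ hm)

/-- The integrals run over arbitrary `C` in `ℱ k`, which makes the claim a conditional one and lets
the induction pass to `C \ {τ = k}`. There `τ` agrees with `max τ (k + 1)`, admissible from date `k
+ 1` on. -/
theorem setIntegral_stopped_le (hfin : M.FiniteTransitions K) {i : ℕ} :
    ∀ {k : ℕ}, k + i = K → M.IsFiniteChain P ℱ X k K → ∀ {τ : Ω → ℕ},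
      IsStoppingTime ℱ (fun ω => (τ ω : WithTop ℕ)) → (∀ ω, k ≤ τ ω ∧ τ ω ≤ K) →
      ∀ {C : Set Ω}, MeasurableSet[ℱ k] C →
      ∫ ω in C, M.payoff (τ ω) (X (τ ω) ω) ∂P ≤ ∫ ω in C, M.snell i k (X k ω) ∂P := by
  induction i with
  | zero =>
    intro k hk h τ hτ hτk C hC
    have : ∀ ω, τ ω = k := fun ω => by have := hτk ω; omega
    simp only [this, snell]
    exact le_rfl
  | succ i ih =>
    intro k hk h τ hτ hτk C hC
    have hkK : k < K := by omega
    have hD : MeasurableSet[ℱ k] {ω | τ ω = k} := by simpa using hτ.measurableSet_eq k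
    set D := {ω | τ ω = k} with hDdef
    have hτ' : IsStoppingTime ℱ fun ω => ((max (τ ω) (k + 1) : ℕ) : WithTop ℕ) := by
      intro n
      change MeasurableSet[ℱ n] {ω | ((max (τ ω) (k + 1) : ℕ) : WithTop ℕ) ≤ n}
      by_cases hn : k + 1 ≤ n
      · have : {ω | ((max (τ ω) (k + 1) : ℕ) : WithTop ℕ) ≤ n} = {ω | (τ ω : WithTop ℕ) ≤ n} := by
          ext ω
          simp only [Set.mem_ofPred_eq, Nat.cast_le]
          omega
        rw [this]
        exact hτ n
      · have : {ω | ((max (τ ω) (k + 1) : ℕ) : WithTop ℕ) ≤ n} = ∅ := by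
          ext ω
          simp only [Set.mem_ofPred_eq, Nat.cast_le, Set.mem_empty_iff_false, iff_false]
          omega
        rw [this]
        exact @MeasurableSet.empty _ (ℱ n)
    have hi := h.integrable_stopped hfin M.payoff hτ hτk
    have hsn := h.integrable_comp hfin le_rfl hkK.le (M.snell (i + 1) k)
    rw [← integral_inter_add_sdiff (ℱ.le k D hD) hi.integrableOn,
      ← integral_inter_add_sdiff (ℱ.le k D hD) hsn.integrableOn]
    have hCD : MeasurableSet[ℱ k] (C ∩ D) := hC.inter hD
    have hCD' : MeasurableSet[ℱ k] (C \ D) := hC.diff hD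
    refine add_le_add ?_ ?_
    · refine setIntegral_mono_on hi.integrableOn hsn.integrableOn (ℱ.le k _ hCD) fun ω hω => ?_
      have hω : τ ω = k := hω.2
      rw [hω]
      exact le_max_left _ _
    · have h1 : ∫ ω in C \ D, M.payoff (τ ω) (X (τ ω) ω) ∂P = ∫ ω in C \ D,
          M.payoff (max (τ ω) (k + 1)) (X (max (τ ω) (k + 1)) ω) ∂P := by
        refine setIntegral_congr_fun (ℱ.le k _ hCD') fun ω hω => ?_
        have h2 : τ ω ≠ k := hω.2
        have h3 := (hτk ω).1
        rw [max_eq_left (by omega)]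
      rw [h1]
      refine (ih (by omega) (h.succ hfin hkK) hτ' (fun ω => ?_)
        (ℱ.mono (Nat.le_succ k) _ hCD')).trans ?_
      · have := (hτk ω).2
        exact ⟨le_max_right _ _, max_le this (by omega)⟩
      · rw [h.setIntegral_succ hfin le_rfl hkK _ hCD']
        refine setIntegral_mono_on (h.integrable_comp hfin le_rfl hkK.le fun s =>
          ∫ x, M.snell i (k + 1) x ∂(M.trans k s)).integrableOn hsn.integrableOn
          (ℱ.le k _ hCD') fun ω _ => ?_
        exact le_max_right _ _

/-- The optimal rule is to exercise as soon as the payoff is at least the continuation value. -/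
theorem exists_setIntegral_stopped_eq (hfin : M.FiniteTransitions K) {i : ℕ} :
    ∀ {k : ℕ}, k + i = K → M.IsFiniteChain P ℱ X k K → ∃ τ : Ω → ℕ,
      IsStoppingTime ℱ (fun ω => (τ ω : WithTop ℕ)) ∧ (∀ ω, k ≤ τ ω ∧ τ ω ≤ K) ∧
      ∀ {C : Set Ω}, MeasurableSet[ℱ k] C →
      ∫ ω in C, M.payoff (τ ω) (X (τ ω) ω) ∂P = ∫ ω in C, M.snell i k (X k ω) ∂P := by
  classical
  induction i with
  | zero =>
    intro k hk h
    exact ⟨fun _ => k, isStoppingTime_const ℱ k, fun _ => ⟨le_rfl, (by omega : k ≤ K)⟩, fun _ => rfl⟩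
  | succ i ih =>
    intro k hk h
    have hkK : k < K := by omega
    obtain ⟨τ', hτ', hτk', hval⟩ := ih (by omega) (h.succ hfin hkK)
    obtain ⟨T, hT⟩ := h.finite_init
    set cont : M.states → ℝ := fun s => ∫ x, M.snell i (k + 1) x ∂(M.trans k s) with hcont
    -- Restricting the exercise region to the finite set `T` of possible states makes it measurable
    -- whatever the payoff is.
    set A : Finset M.states := T.filter fun s => cont s ≤ M.payoff k s with hA
    set D : Set Ω := X k ⁻¹' (A : Set M.states) with hDdef
    have hD : MeasurableSet[ℱ k] D := h.adapted k le_rfl hkK.le (Finset.measurableSet A)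
    set τ : Ω → ℕ := fun ω => if ω ∈ D then k else τ' ω with hτdef
    have hτk : ∀ ω, k ≤ τ ω ∧ τ ω ≤ K := by
      intro ω
      have := hτk' ω
      simp only [hτdef]
      split_ifs <;> omega
    have hτ : IsStoppingTime ℱ fun ω => (τ ω : WithTop ℕ) := by
      intro n
      change MeasurableSet[ℱ n] {ω | ((τ ω : ℕ) : WithTop ℕ) ≤ n}
      rcases lt_or_ge n k with hn | hn
      · have : {ω | ((τ ω : ℕ) : WithTop ℕ) ≤ n} = ∅ := by
          ext ω
          have := (hτk ω).1
          simp only [Set.mem_ofPred_eq, Nat.cast_le, Set.mem_empty_iff_false, iff_false]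
          omega
        rw [this]
        exact @MeasurableSet.empty _ (ℱ n)
      · have : {ω | ((τ ω : ℕ) : WithTop ℕ) ≤ n} =
            D ∪ (Dᶜ ∩ {ω | ((τ' ω : ℕ) : WithTop ℕ) ≤ n}) := by
          ext ω
          by_cases hω : ω ∈ D <;> simp [hτdef, hω, hn]
        rw [this]
        have hDn := ℱ.mono hn _ hD
        exact hDn.union (hDn.compl.inter (hτ' n))
    refine ⟨τ, hτ, hτk, fun {C} hC => ?_⟩
    have hi := h.integrable_stopped hfin M.payoff hτ hτk
    have hsn := h.integrable_comp hfin le_rfl hkK.le (M.snell (i + 1) k)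
    rw [← integral_inter_add_sdiff (ℱ.le k D hD) hi.integrableOn,
      ← integral_inter_add_sdiff (ℱ.le k D hD) hsn.integrableOn]
    have hCD : MeasurableSet[ℱ k] (C ∩ D) := hC.inter hD
    have hCD' : MeasurableSet[ℱ k] (C \ D) := hC.diff hD
    congr 1
    · refine setIntegral_congr_fun (ℱ.le k _ hCD) fun ω hω => ?_
      have h1 : τ ω = k := if_pos hω.2
      have h2 : X k ω ∈ A := hω.2
      simp only [h1]
      exact (max_eq_left (Finset.mem_filter.1 h2).2).symm
    · have h1 : ∫ ω in C \ D, M.payoff (τ ω) (X (τ ω) ω) ∂P =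
          ∫ ω in C \ D, M.payoff (τ' ω) (X (τ' ω) ω) ∂P := by
        refine setIntegral_congr_fun (ℱ.le k _ hCD') fun ω hω => ?_
        have h2 : τ ω = τ' ω := if_neg hω.2
        simp only [h2]
      rw [h1, hval (ℱ.mono (Nat.le_succ k) _ hCD'), h.setIntegral_succ hfin le_rfl hkK _ hCD']
      refine setIntegral_congr_ae (ℱ.le k _ hCD') ?_
      filter_upwards [hT] with ω hω hmem
      have h2 : X k ω ∉ A := hmem.2
      refine (max_eq_right ?_).symm
      by_contra! hlt
      exact h2 (Finset.mem_filter.2 ⟨hω, hlt.le⟩)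

/-- The backward recursion computes the value of the optimal stopping problem. -/
theorem optimalStoppingValue_eq (hfin : M.FiniteTransitions K) {i : ℕ} (hk : k + i = K)
    (h : M.IsFiniteChain P ℱ X k K) :
    optimalStoppingValue P ℱ X M.payoff k K = ∫ ω, M.snell i k (X k ω) ∂P := by
  refine IsGreatest.csSup_eq ⟨?_, ?_⟩
  · obtain ⟨τ, hτ, hτk, hval⟩ := exists_setIntegral_stopped_eq hfin hk h
    refine ⟨τ, hτ, hτk, ?_⟩
    simpa using (hval MeasurableSet.univ).symm
  · rintro v ⟨τ, hτ, hτk, rfl⟩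
    simpa using setIntegral_stopped_le hfin hk h hτ hτk MeasurableSet.univ

end IsFiniteChain

instance (k : ℕ) (s : M.states) : IsProbabilityMeasure (M.pathLaw k s) := by
  unfold pathLaw
  infer_instance

theorem ae_pathLaw_init (k : ℕ) (s : M.states) : ∀ᵐ ω ∂(M.pathLaw k s), ω k = s := by
  have h := DFunLike.congr_fun (Kernel.traj_map_frestrictLe_of_le (X := fun _ => M.states)
    (κ := M.historyTrans) (le_refl k)) (fun _ => s)
  rw [Kernel.map_apply _ (Preorder.measurable_frestrictLe k), Kernel.deterministic_apply] at h
  have hA : MeasurableSet {x : ∀ _ : Finset.Iic k, M.states |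
      x ⟨k, Finset.mem_Iic.2 le_rfl⟩ = s} :=
    (measurable_pi_apply (X := fun _ => M.states) (⟨k, Finset.mem_Iic.2 le_rfl⟩ : Finset.Iic k))
      (measurableSet_singleton s)
  have h2 : ∀ᵐ x ∂((M.pathLaw k s).map (Preorder.frestrictLe k)),
      x ⟨k, Finset.mem_Iic.2 le_rfl⟩ = s := by
    unfold pathLaw
    rw [h, ae_dirac_iff hA]
    rfl
  exact ae_of_ae_map (Preorder.measurable_frestrictLe k).aemeasurable h2

theorem isFiniteChain_pathLaw (k K : ℕ) (s : M.states) :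
    M.IsFiniteChain (M.pathLaw k s) Filtration.piLE (fun n ω => ω n) k K where
  adapted n _ _ := by
    rw [Filtration.piLE_eq_comap_frestrictLe]
    exact (measurable_pi_apply (⟨n, Finset.mem_Iic.2 le_rfl⟩ : Finset.Iic n)).comp
      (comap_measurable (Preorder.frestrictLe n))
  finite_init := ⟨{s}, by simpa using ae_pathLaw_init k s⟩
  transition n h1 h2 A hA := by
    have hm : MeasurableSet ((fun ω : ℕ → M.states => ω (n + 1)) ⁻¹' A) :=
      measurable_pi_apply _ hA
    have hi : Integrable (((fun ω : ℕ → M.states => ω (n + 1)) ⁻¹' A).indicator fun _ => (1 : ℝ))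
        (M.pathLaw k s) := (integrable_const _).indicator hm
    refine (Kernel.condExp_traj h1 hi).trans (Filter.Eventually.of_forall fun ω => ?_)
    simp only
    rw [integral_indicator hm, setIntegral_const, smul_eq_mul, mul_one, measureReal_def,
      measureReal_def]
    congr 1
    have h3 := congrArg (fun μ : Measure M.states => μ A) (DFunLike.congr_fun
      (Kernel.map_traj_succ_self (X := fun _ => M.states) (κ := M.historyTrans) (a := n))
      (Preorder.frestrictLe n ω))
    rw [Kernel.map_apply' _ (measurable_pi_apply (X := fun _ => M.states) (n + 1)) _ hA] at h3
    rw [h3, historyTrans, Kernel.comap_apply]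
    rfl

theorem price_eq_snell {K k i : ℕ} (hfin : M.FiniteTransitions K) (hk : k + i = K)
    (s : M.states) : M.price K k s = M.snell i k s := by
  rw [price, (isFiniteChain_pathLaw k K s).optimalStoppingValue_eq hfin hk]
  have : (fun ω : ℕ → M.states => M.snell i k (ω k)) =ᵐ[M.pathLaw k s] fun _ => M.snell i k s := by
    filter_upwards [ae_pathLaw_init k s] with ω hω
    rw [hω]
  rw [integral_congr_ae this]
  simp

theorem price_self (K : ℕ) (hfin : M.FiniteTransitions K) (s : M.states) :
    M.price K K s = M.payoff K s := price_eq_snell hfin (add_zero K) s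

/-- The equation holds at every state and not only almost surely, since each price is an optimal
stopping value for the path law started at that state. The nodes need this, as the process may never
visit them. -/
theorem price_eq_max {K k : ℕ} (hfin : M.FiniteTransitions K) (hk : k < K) (s : M.states) :
    M.price K k s = max (M.payoff k s) (M.contValue K k s) := by
  obtain ⟨i, rfl⟩ : ∃ i, K = k + (i + 1) := ⟨K - k - 1, by omega⟩
  rw [price_eq_snell hfin rfl, contValue]
  simp only [price_eq_snell hfin (show k + 1 + i = k + (i + 1) by omega)]
  rfl

theorem IsMarkovChain.isFiniteChain {Ω : Type*} {mΩ : MeasurableSpace Ω} {P : Measure Ω}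
    {ℱ : Filtration ℕ mΩ} {K : ℕ} {s₀ : M.states} {S : ℕ → Ω → M.states}
    (hS : M.IsMarkovChain P ℱ K s₀ S) : M.IsFiniteChain P ℱ S 0 K where
  adapted n _ h := hS.adapted n h
  finite_init := ⟨{s₀}, by simpa using hS.init⟩
  transition n _ h := hS.transition n h

theorem optimalStoppingValue_one_eq {Ω : Type*} {mΩ : MeasurableSpace Ω} {P : Measure Ω}
    [IsProbabilityMeasure P] {ℱ : Filtration ℕ mΩ} {K : ℕ} (hK : 1 ≤ K)
    (hfin : M.FiniteTransitions K) {S : ℕ → Ω → M.states} (hS : M.IsFiniteChain P ℱ S 1 K) :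
    optimalStoppingValue P ℱ S M.payoff 1 K = ∫ ω, M.price K 1 (S 1 ω) ∂P := by
  obtain ⟨i, rfl⟩ : ∃ i, K = 1 + i := ⟨K - 1, by omega⟩
  rw [hS.optimalStoppingValue_eq hfin rfl]
  simp only [price_eq_snell hfin rfl]

end Model

end Bermudan

end

noncomputable section

namespace Bermudan

/-! ### Propagation of the errors -/

section LebesgueProd

variable (d : ℕ) (m : ℕ → ℕ)

/-- The condition `1 ≤ k` matters: the subtraction is truncated, and for `k = 0` the product would
have one factor. -/
theorem lebesgueProd_pred {k : ℕ} (hk : 1 ≤ k) : lebesgueProd d m k (k - 1) = 1 := by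
  rw [lebesgueProd, Finset.Icc_eq_empty (by omega), Finset.prod_empty]

theorem lebesgueProd_eq_mul {k l : ℕ} (hkl : k ≤ l) :
    lebesgueProd d m k l = lebesgueBound d (m k) * lebesgueProd d m (k + 1) l := by
  rw [lebesgueProd, lebesgueProd, ← Finset.insert_Icc_add_one_left_eq_Icc hkl,
    Finset.prod_insert (by simp)]

theorem sum_lebesgueProd_pred {k K : ℕ} (h1 : 1 ≤ k) (h2 : k < K) (α : ℕ → ℝ) :
    ∑ l ∈ Finset.Ico k K, lebesgueProd d m k (l - 1) * α l = α k + lebesgueBound d (m k) *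
      ∑ l ∈ Finset.Ico (k + 1) K, lebesgueProd d m (k + 1) (l - 1) * α l := by
  rw [Finset.sum_eq_sum_Ico_succ_bot h2, lebesgueProd_pred d m h1, one_mul, Finset.mul_sum]
  congr 1
  refine Finset.sum_congr rfl fun l hl => ?_
  have := (Finset.mem_Ico.1 hl).1
  rw [lebesgueProd_eq_mul d m (by omega : k ≤ l - 1), mul_assoc]

theorem sum_lebesgueProd {k K : ℕ} (h2 : k < K) (γ : ℕ → ℝ) :
    ∑ l ∈ Finset.Ico k K, lebesgueProd d m k l * γ l = lebesgueBound d (m k) *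
      (γ k + ∑ l ∈ Finset.Ico (k + 1) K, lebesgueProd d m (k + 1) l * γ l) := by
  rw [Finset.sum_eq_sum_Ico_succ_bot h2, mul_add, Finset.mul_sum, lebesgueProd_eq_mul d m le_rfl,
    lebesgueProd, Finset.Icc_eq_empty (by omega), Finset.prod_empty, mul_one]
  congr 1
  refine Finset.sum_congr rfl fun l hl => ?_
  rw [lebesgueProd_eq_mul d m (by have := (Finset.mem_Ico.1 hl).1; omega : k ≤ l), mul_assoc]

end LebesgueProd

theorem abs_integral_sub_le_of_finite {E : Type*} [MeasurableSpace E] [MeasurableSingletonClass E]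
    {μ : Measure E} [IsProbabilityMeasure μ] {T : Finset E} (hT : μ (T : Set E)ᶜ = 0)
    {f g : E → ℝ} {e : ℝ} (h : ∀ x, |f x - g x| ≤ e) : |∫ x, f x ∂μ - ∫ x, g x ∂μ| ≤ e := by
  have hT' : ∀ᵐ x ∂μ, id x ∈ T := hT
  have hf : Integrable f μ := integrable_comp_of_finite measurable_id hT' f
  have hg : Integrable g μ := integrable_comp_of_finite measurable_id hT' g
  rw [← integral_sub hf hg]
  simpa using norm_integral_le_of_norm_le_const (μ := μ) (f := fun x => f x - g x)
    (Filter.Eventually.of_forall h)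

theorem Rect.clamp_eq {d : ℕ} (D : Rect d) {s : Fin d → ℝ} (hs : s ∈ D.toSet) :
    D.clamp s = s := by
  funext i
  rw [Rect.clamp, max_eq_right (hs.1 i), min_eq_right (hs.2 i)]

namespace Run

variable {d K : ℕ} {M : Model d} (R : Run M K)

theorem extrapPrice_last : R.extrapPrice K = M.payoff K :=
  dif_neg fun h => h.2.ne rfl

theorem abs_contValue_sub_approxCont_le (hfin : M.FiniteTransitions K) {k : ℕ} (h1 : 1 ≤ k)
    (h2 : k < K) (hdeg : 1 ≤ R.deg k) {ρ B e ε : ℝ} (hρ : 1 < ρ)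
    (hQ : HasBoundedAnalyticExtension (R.box k) ρ B
      (fun x => M.contValue K k (R.boxState h1 h2 x)))
    (hnode : ∀ j : Fin d → Fin (R.deg k + 1),
      |R.hatCont k (R.boxState h1 h2 (R.boxNode k j)) - R.nodeEstimate k j| ≤ ε)
    (he : ∀ s, |M.price K (k + 1) s - R.extrapPrice (k + 1) s| ≤ e) (x : (R.box k).toSet) :
    |M.contValue K k (R.boxState h1 h2 x) - R.approxCont k x| ≤
      epsInt ρ d (R.deg k) B + lebesgueBound d (R.deg k) * (e + ε) := by
  set q : (Fin d → Fin (R.deg k + 1)) → ℝ := fun j =>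
    M.contValue K k (R.boxState h1 h2 (R.boxNode k j)) with hq
  have hint := abs_sub_chebInterp_le (R.box k) hdeg hρ hQ q (fun j h => rfl) x
  have hq' : ∀ j, |q j - R.nodeEstimate k j| ≤ e + ε := by
    intro j
    obtain ⟨T, hT⟩ := hfin k h2 (R.boxState h1 h2 (R.boxNode k j))
    have := M.markov k
    have h3 : |q j - R.hatCont k (R.boxState h1 h2 (R.boxNode k j))| ≤ e :=
      abs_integral_sub_le_of_finite hT he
    exact (abs_sub_le _ _ _).trans (add_le_add h3 (hnode j))
  have hstab := abs_chebInterp_le (R.box k) hdeg hq' x.2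
  rw [chebInterp_sub] at hstab
  exact (abs_sub_le _ _ _).trans (add_le_add hint hstab)

/-- On `A_k` only the error of `V^OB` occurs; in the box only that of the maximum, which is
1-Lipschitz; elsewhere the error at the clamped point adds to that of flat extrapolation. -/
theorem abs_price_sub_extrapPrice_le (hfin : M.FiniteTransitions K) {ε : ℕ → ℝ}
    (hOB : R.ExtrapolationAccurate ε) {k : ℕ} (h1 : 1 ≤ k) (h2 : k < K) (hε : 0 ≤ ε k) {c : ℝ}
    (hc : ∀ x : (R.box k).toSet, |M.contValue K k (R.boxState h1 h2 x) - R.approxCont k x| ≤ c)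
    (s : M.states) : |M.price K k s - R.extrapPrice k s| ≤ c + ε k := by
  have happ : ∀ x : (R.box k).toSet,
      |M.price K k (R.boxState h1 h2 x) - R.approxPrice h1 h2 x| ≤ c := by
    intro x
    rw [Model.price_eq_max hfin h2, approxPrice, max_comm, max_comm (M.payoff k _)]
    exact (abs_max_sub_max_le_abs _ _ _).trans (hc x)
  rw [extrapPrice, dif_pos ⟨h1, h2⟩, extrap]
  obtain ⟨hin, hout⟩ := hOB k h1 h2 s
  split_ifs with hs
  · rw [abs_sub_comm]
    -- The clamped point shows that the box is nonempty, whence `0 ≤ c`.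
    have hc0 := (abs_nonneg _).trans (hc ⟨_, (R.box k).clamp_mem s⟩)
    linarith [(hin hs).2]
  · by_cases hbox : (s : Fin d → ℝ) ∈ (R.box k).toSet
    · have h3 := happ ⟨s, hbox⟩
      have h4 : (⟨(R.box k).clamp s, (R.box k).clamp_mem s⟩ : (R.box k).toSet) = ⟨s, hbox⟩ :=
        Subtype.ext ((R.box k).clamp_eq hbox)
      rw [Rect.flat, h4]
      exact h3.trans (le_add_of_nonneg_right hε)
    · have h3 := hout hbox hs
      rw [abs_sub_comm] at h3
      have h4 := (abs_sub_le _ _ _).trans (add_le_add h3.le (happ ⟨_, (R.box k).clamp_mem s⟩))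
      rw [add_comm]
      exact h4

theorem abs_price_sub_extrapPrice_le_sum (hfin : M.FiniteTransitions K)
    (hdeg : ∀ k, 1 ≤ k → k < K → 1 ≤ R.deg k) {εOB : ℕ → ℝ}
    (hεOB : ∀ k, 1 ≤ k → k < K → 0 < εOB k) (hOB : R.ExtrapolationAccurate εOB) {ρ B : ℕ → ℝ}
    (hρ : ∀ k, 1 ≤ k → k < K → 1 < ρ k)
    (hQ : ∀ k, ∀ (h1 : 1 ≤ k) (h2 : k < K), HasBoundedAnalyticExtension (R.box k) (ρ k) (B k)
      (fun x => M.contValue K k (R.boxState h1 h2 x)))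
    {εQAE : ℕ → ℝ}
    (hnode : ∀ k, ∀ (h1 : 1 ≤ k) (h2 : k < K), ∀ j : Fin d → Fin (R.deg k + 1),
      |R.hatCont k (R.boxState h1 h2 (R.boxNode k j)) - R.nodeEstimate k j| ≤ εQAE k) {i : ℕ} :
    ∀ {k : ℕ}, 1 ≤ k → k + i = K → ∀ s, |M.price K k s - R.extrapPrice k s| ≤
      (∑ l ∈ Finset.Ico k K, lebesgueProd d R.deg k (l - 1) * epsInt (ρ l) d (R.deg l) (B l)) +
        (∑ l ∈ Finset.Ico k K, lebesgueProd d R.deg k (l - 1) * εOB l) +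
        ∑ l ∈ Finset.Ico k K, lebesgueProd d R.deg k l * εQAE l := by
  induction i with
  | zero =>
    rintro k h1 rfl s
    rw [add_zero] at *
    simp [extrapPrice_last, Model.price_self k hfin]
  | succ i ih =>
    intro k h1 hk s
    have h2 : k < K := by omega
    have hc := R.abs_contValue_sub_approxCont_le hfin h1 h2 (hdeg k h1 h2) (hρ k h1 h2)
      (hQ k h1 h2) (hnode k h1 h2) (ih (by omega : 1 ≤ k + 1) (by omega))
    refine (R.abs_price_sub_extrapPrice_le hfin hOB h1 h2 (hεOB k h1 h2).le hc s).trans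
      (le_of_eq ?_)
    rw [sum_lebesgueProd_pred d R.deg h1 h2 εOB,
      sum_lebesgueProd_pred d R.deg h1 h2 fun l => epsInt (ρ l) d (R.deg l) (B l),
      sum_lebesgueProd d R.deg h2]
    ring

end Run

end Bermudan

end

/-! ### The error bound for the price at date zero -/

theorem theorem3 (d K : ℕ) (hd : 1 ≤ d) (hK : 1 ≤ K) (M : Bermudan.Model d)
    {Ω : Type*} {mΩ : MeasurableSpace Ω} (P : MeasureTheory.Measure Ω)
    [MeasureTheory.IsProbabilityMeasure P] (ℱ : MeasureTheory.Filtration ℕ mΩ)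
    (s₀ : M.states) (S : ℕ → Ω → M.states) (hS : M.IsMarkovChain P ℱ K s₀ S)
    (hpay : ∀ k, 1 ≤ k → k ≤ K → MeasureTheory.MemLp (M.payoff k) 2 (P.map (S k)))
    (hfin : M.FiniteTransitions K)
    (R : Bermudan.Run M K) (hdeg : ∀ k, 1 ≤ k → k < K → 1 ≤ R.deg k)
    (εOB : ℕ → ℝ) (hεOB : ∀ k, 1 ≤ k → k < K → 0 < εOB k)
    (hOB : R.ExtrapolationAccurate εOB)
    (ρ B : ℕ → ℝ) (hρ : ∀ k, 1 ≤ k → k < K → 1 < ρ k) (hB : ∀ k, 1 ≤ k → k < K → 0 < B k)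
    (hQ : ∀ k, ∀ (h1 : 1 ≤ k) (h2 : k < K),
      Bermudan.HasBoundedAnalyticExtension (R.box k) (ρ k) (B k)
        (fun x => M.contValue K k (R.boxState h1 h2 x)))
    (εQAE : ℕ → ℝ) (hεQAE : ∀ k < K, 0 < εQAE k)
    (hnode : ∀ k, ∀ (h1 : 1 ≤ k) (h2 : k < K), ∀ j : Fin d → Fin (R.deg k + 1),
      |R.hatCont k (R.boxState h1 h2 (R.boxNode k j)) - R.nodeEstimate k j| ≤ εQAE k)
    (hfinal : |(∫ ω, R.extrapPrice 1 (S 1 ω) ∂P) - R.output| ≤ εQAE 0) :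
    |Bermudan.optimalStoppingValue P ℱ S M.payoff 1 K - R.output| ≤
      (∑ k ∈ Finset.Ico 1 K, Bermudan.lebesgueProd d R.deg 1 (k - 1) *
          Bermudan.epsInt (ρ k) d (R.deg k) (B k)) +
        (∑ k ∈ Finset.Ico 1 K, Bermudan.lebesgueProd d R.deg 1 (k - 1) * εOB k) +
        ∑ k ∈ Finset.range K, Bermudan.lebesgueProd d R.deg 1 k * εQAE k := by
  -- No exercise is possible at date `0`, so the stopping problem is that of the chain from date
  -- `1`, and the initial value is the mean of `V_1(S_1)`.
  have hchain := hS.isFiniteChain.succ hfin hK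
  rw [Bermudan.Model.optimalStoppingValue_one_eq hK hfin hchain]
  have he := R.abs_price_sub_extrapPrice_le_sum hfin hdeg hεOB hOB hρ hQ hnode le_rfl
    (Nat.add_sub_cancel' hK)
  have hi1 := hchain.integrable_comp hfin le_rfl hK (M.price K 1)
  have hi2 := hchain.integrable_comp hfin le_rfl hK (R.extrapPrice 1)
  have hmain := norm_integral_le_of_norm_le_const (μ := P)
    (f := fun ω => M.price K 1 (S 1 ω) - R.extrapPrice 1 (S 1 ω)) (Filter.Eventually.of_forall fun ω => he (S 1 ω))
  rw [Real.norm_eq_abs, integral_sub hi1 hi2, probReal_univ, mul_one] at hmain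
  refine (abs_sub_le _ _ _).trans ((add_le_add hmain hfinal).trans (le_of_eq ?_))
  have h0 : Bermudan.lebesgueProd d R.deg 1 0 = 1 := by simp [Bermudan.lebesgueProd]
  rw [Finset.range_eq_Ico, Finset.sum_eq_sum_Ico_succ_bot hK, h0]
  ring
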